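/- **Setting.** Let $n\ge 1$, $K$, $t\ge 0$, $n_{\min},n_{\max},s\le n$ be integers, $\tau\in[0,1]$, $\alpha_n\in(0,1)$, $B_0=(1-\tau)I_K+\tau 1_K1_K^\top$. Let $z_0,\dots,z_t:[n]\to[K]$ be deterministic community memberships such that at every time all community sizes lie in $[n_{\min},n_{\max}]$ and at most $s$ nodes change community between consecutive times; put $\varepsilon_n=s/n$. Let $(P_i)_{ab}=\alpha_n (B_0)_{z_i(a)z_i(b)}$, and let $A_0,\dots,A_t\in\{0,1\}^{n\times n}$ be symmetric random matrices with zero diagonal whose entries $(A_i)_{ab}$, $a<b$, $0\le i\le t$, are jointly independent with $(A_i)_{ab}\sim\mathrm{Ber}((P_i)_{ab})$ (deterministic dynamic stochastic block model). Let $\bar n_{\max}$ and $\bar n_{\min}$ be the maximum and minimum of $\sum_\ell m_\ell (B_0)_{k\ell}$ over $k\le K$ and over integers $(m_\ell)_{\ell\le K}$ with $n_{\min}\le m_\ell\le n_{\max}$, $\sum_\ell m_\ell=n$. Assume $\bar n_{\min}>0$ and put $$\mu_B=\frac{\bar n_{\max}}{\bar n_{\min}},\qquad x_n=\sqrt{\bar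 n_{\max}\alpha_n\varepsilon_n},\qquad \rho_n=\min(1,x_n),\qquad t_{\min}=\frac{\log(\rho_n/(\alpha_n n))}{2\log(1-\rho_n)}$$ ($t_{\min}=0$ if $\rho_n=1$). For a matrix $M$ with non-negative entries and row sums $d_i$, let $L(M)=D^{-1/2}MD^{-1/2}$ with $D=\mathrm{diag}(d_i)$ and the convention $0^{-1/2}=0$; $\|\cdot\|$ is the spectral norm. Let $A_t^{\mathrm{smooth}}$ be either the uniform estimator $\frac1r\sum_{k=0}^{r-1}A_{t-k}$ with $1\le r\le t+1$, or the exponential estimator $A_t^{\exp}$ defined by $A_0^{\exp}=A_0$, $A_i^{\exp}=(1-\lambda)A_{i-1}^{\exp}+\lambda A_i$, with $\lambda\in(0,1]$. Let $\beta_{\max}$ be the largest weight: $\beta_{\max}=1/r$ in the first case, $\beta_{\max}=\max(\lambda,(1-\lambda)^t)$ in the second. Assume $\beta_{\max}\sim\rho_n$ in the following sense, with constants $c_1,c_2>0$: $$\min(1,c_1x_n)\le b\quad\text{and}\quad \beta_{\max}\le c_2\,\rho_n,\qquad\text{where } b=1/r,\text{ respectively } b=\lambda .$$ (For instance $\lambda=\rho_n$,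 with $t$ large enough that $(1-\lambda)^t\le c_2\rho_n$.) **Theorem.** For all $\nu>0$ and $c_1,c_2>0$ there are constants $C_\nu,C'_\nu>0$, depending only on $\nu,c_1,c_2$, such that in the above setting, if $t\ge t_{\min}$ and $$\frac{\alpha_n}{\rho_n}\ \ge\ C'_\nu\,\mu_B\,\frac{\log n}{\bar n_{\min}},$$ then with probability at least $1-n^{-\nu}$ $$\big\|L(A_t^{\mathrm{smooth}})-L(P_t)\big\|\ \le\ C_\nu\,\mu_B\sqrt{\frac{n\rho_n}{\bar n_{\min}^2\,\alpha_n}}$$ and, if $\bar n_{\min}\ge 2$, all row sums of $A_t^{\mathrm{smooth}}$ are positive (so that $L(A_t^{\mathrm{smooth}})$ needs no convention). -/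

import Mathlib

namespace DSBM

/-- Degree of node `i` in the weighted graph with adjacency matrix `M`. -/
noncomputable def degree {n : ℕ} (M : Matrix (Fin n) (Fin n) ℝ) (i : Fin n) : ℝ :=
  ∑ j, M i j

/-- Normalized Laplacian `L(M) = D(M)^{-1/2} M D(M)^{-1/2}`
(with the convention `0^{-1/2} = 0`). -/
noncomputable def laplacian {n : ℕ} (M : Matrix (Fin n) (Fin n) ℝ) :
    Matrix (Fin n) (Fin n) ℝ :=
  Matrix.diagonal (fun i => (Real.sqrt (degree M i))⁻¹) * M *
    Matrix.diagonal (fun i => (Real.sqrt (degree M i))⁻¹)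

/-- Spectral norm: operator norm with respect to the Euclidean norm. -/
noncomputable def specNorm {n : ℕ} (M : Matrix (Fin n) (Fin n) ℝ) : ℝ :=
  ‖Matrix.toEuclideanCLM (n := Fin n) (𝕜 := ℝ) M‖

/-- The matrix `(1 - τ) Id + τ 1 1ᵀ`. -/
def baseMatrix (K : ℕ) (τ : ℝ) : Matrix (Fin K) (Fin K) ℝ :=
  (1 - τ) • (1 : Matrix (Fin K) (Fin K) ℝ) + τ • Matrix.of (fun _ _ => (1 : ℝ))

/-- The matrix `P = Θ (α B₀) Θᵀ`, where `Θ i k = 1` iff node `i` is in community `z i = k`. -/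
def probMatrix {n K : ℕ} (α : ℝ) (B₀ : Matrix (Fin K) (Fin K) ℝ) (z : Fin n → Fin K) :
    Matrix (Fin n) (Fin n) ℝ :=
  Matrix.of fun i j => α * B₀ (z i) (z j)

/-- Number of nodes in community `k`. -/
def commSize {n K : ℕ} (z : Fin n → Fin K) (k : Fin K) : ℕ :=
  (Finset.univ.filter fun i => z i = k).card

/-- Admissible community sizes: `nmin ≤ m k ≤ nmax` for all `k`, and `∑ m k = n`. -/
def admissibleSizes (n K nmin nmax : ℕ) : Set (Fin K → ℕ) :=
  {m | (∀ k, nmin ≤ m k ∧ m k ≤ nmax) ∧ ∑ k, m k = n}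

/-- The values `∑ ℓ, m ℓ * B₀ k ℓ`, over all admissible sizes `m` and communities `k`. -/
def degreeProfiles {K : ℕ} (B₀ : Matrix (Fin K) (Fin K) ℝ) (n nmin nmax : ℕ) : Set ℝ :=
  {x | ∃ m ∈ admissibleSizes n K nmin nmax, ∃ k : Fin K, x = ∑ l, (m l : ℝ) * B₀ k l}

/-- Maximum of the finite set of degree profiles. -/
noncomputable def nbarMax {K : ℕ} (B₀ : Matrix (Fin K) (Fin K) ℝ) (n nmin nmax : ℕ) : ℝ :=
  sSup (degreeProfiles B₀ n nmin nmax)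

/-- Minimum of the finite set of degree profiles. -/
noncomputable def nbarMin {K : ℕ} (B₀ : Matrix (Fin K) (Fin K) ℝ) (n nmin nmax : ℕ) : ℝ :=
  sInf (degreeProfiles B₀ n nmin nmax)

/-- Deterministic community memberships `z 0, …, z t`: the community sizes stay between `nmin`
and `nmax`, and at most `s` nodes change community between consecutive time steps. -/
structure IsRegularMembership {n K : ℕ} (t nmin nmax s : ℕ) (z : ℕ → Fin n → Fin K) : Prop where
  sizes : ∀ i ≤ t, commSize (z i) ∈ admissibleSizes n K nmin nmax
  changes : ∀ i < t, (Finset.univ.filter fun a => z (i + 1) a ≠ z i a).card ≤ s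

/-- Given the memberships `z 0, …, z t`, the adjacency matrices `A 0, …, A t` are symmetric with
zero diagonal, and their entries above the diagonal are independent Bernoulli variables (jointly
over entries and times) with parameters given by the matrices `probMatrix α B₀ (z i)`. -/
structure IsSBMSequence {n K : ℕ} {Ω : Type*} [MeasurableSpace Ω]
    (ℙ : MeasureTheory.Measure Ω) (t : ℕ) (α : ℝ) (B₀ : Matrix (Fin K) (Fin K) ℝ)
    (z : ℕ → Fin n → Fin K) (A : ℕ → Ω → Matrix (Fin n) (Fin n) ℝ) : Prop where
  measurable : ∀ i ≤ t, ∀ a b, Measurable fun ω => A i ω a b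
  zero_or_one : ∀ i ≤ t, ∀ ω a b, A i ω a b = 0 ∨ A i ω a b = 1
  symm : ∀ i ≤ t, ∀ ω a b, A i ω b a = A i ω a b
  diag : ∀ i ≤ t, ∀ ω a, A i ω a a = 0
  prob : ∀ i ≤ t, ∀ a b, a < b → ℙ.real {ω | A i ω a b = 1} = probMatrix α B₀ (z i) a b
  indep : ProbabilityTheory.iIndepFun
    (fun (e : {e : ℕ × Fin n × Fin n // e.1 ≤ t ∧ e.2.1 < e.2.2}) (ω : Ω) =>
      A e.1.1 ω e.1.2.1 e.1.2.2) ℙ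

/-- Uniform estimator: average of the last `r` matrices (meaningful for `1 ≤ r ≤ t + 1`). -/
noncomputable def unifSmooth {n : ℕ} (r t : ℕ) (M : ℕ → Matrix (Fin n) (Fin n) ℝ) :
    Matrix (Fin n) (Fin n) ℝ :=
  (1 / (r : ℝ)) • ∑ k ∈ Finset.range r, M (t - k)

/-- Exponential estimator with forgetting factor `lam`. -/
noncomputable def expSmooth {n : ℕ} (lam : ℝ) :
    ℕ → (ℕ → Matrix (Fin n) (Fin n) ℝ) → Matrix (Fin n) (Fin n) ℝ
  | 0, M => M 0
  | t + 1, M => (1 - lam) • expSmooth lam t M + lam • M (t + 1)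

/-- The exponential estimator as a weighted sum: the weights are `lam * (1 - lam) ^ k` for `k < t`,
and `(1 - lam) ^ t` for the oldest matrix. -/
theorem expSmooth_eq_sum {n : ℕ} (lam : ℝ) (t : ℕ) (M : ℕ → Matrix (Fin n) (Fin n) ℝ) :
    expSmooth lam t M =
      ∑ k ∈ Finset.range t, (lam * (1 - lam) ^ k) • M (t - k) + (1 - lam) ^ t • M 0 := by
  induction t with
  | zero => simp [expSmooth]
  | succ t ih =>
    rw [expSmooth, ih, Finset.sum_range_succ', smul_add, Finset.smul_sum]
    have h : ∀ k ∈ Finset.range t, (1 - lam) • (lam * (1 - lam) ^ k) • M (t - k)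
        = (lam * (1 - lam) ^ (k + 1)) • M (t + 1 - (k + 1)) := by
      intro k _
      rw [smul_smul, Nat.add_sub_add_right]
      congr 1
      ring
    rw [Finset.sum_congr rfl h, smul_smul, pow_succ' (1 - lam) t]
    simp only [pow_zero, mul_one, Nat.sub_zero]
    abel

/-- Largest weight of the exponential estimator at time `t`. -/
noncomputable def expMaxWeight (lam : ℝ) (t : ℕ) : ℝ := max lam ((1 - lam) ^ t)

/-- `S` is the uniform estimator or the exponential estimator at time `t`, and its largest weight
`βmax` is comparable to `ρ = min 1 x`, with comparison constants `c₁, c₂`. For large `x` (where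
`ρ = 1`) the lower bound `min 1 (c₁ * x)` means that there is no smoothing: `r = 1`, `lam = 1`. -/
def IsSmoother {n : ℕ} (c₁ c₂ x : ℝ) (t : ℕ)
    (S : (ℕ → Matrix (Fin n) (Fin n) ℝ) → Matrix (Fin n) (Fin n) ℝ) : Prop :=
  (∃ r : ℕ, 1 ≤ r ∧ r ≤ t + 1 ∧
    min 1 (c₁ * x) ≤ 1 / (r : ℝ) ∧ 1 / (r : ℝ) ≤ c₂ * min 1 x ∧ S = unifSmooth r t) ∨
  (∃ lam : ℝ, 0 < lam ∧ lam ≤ 1 ∧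
    min 1 (c₁ * x) ≤ lam ∧ expMaxWeight lam t ≤ c₂ * min 1 x ∧ S = expSmooth lam t)

/-- Minimal time `log (ρ / (α n)) / (2 log (1 - ρ))` (equal to `0` for `ρ = 1`). -/
noncomputable def tMin (n : ℕ) (α ρ : ℝ) : ℝ :=
  Real.log (ρ / (α * n)) / (2 * Real.log (1 - ρ))

end DSBM

namespace DSBM

open MeasureTheory
open scoped Matrix

/-! Both smoothers are averages `∑ w k • A (t - k)`, where the weights sum to one, are at most some
`β ≤ c₂ ρ`, and have mean age `κ = ∑ w k * k` with `κ x² ≲ ρ` (`IsSmoother.exists_weights`). The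
error separates into noise and bias, both of spectral size `√(nαρ)`; dividing by the minimal
expected degree `α * nMin` gives the stated rate.

Noise. Above the diagonal the average is `β U`, where `U` is a sum of independent Bernoulli
variables with coefficients `w k / β ∈ [0, 1]`. By convexity of `exp`, its exponential moments are
at most those of independent Poisson entries with means `m = E U ≤ α / β`
(`IsSBMSequence.poissonDominated`). So `U` behaves like the adjacency matrix of a sparse graph of
density `α / β`, and the density assumption gives `n α / β ≥ log n`. In this regime the
Kahn–Szemerédi / Feige–Ofek argument (`PoissonDominated.specNorm_tail`) yields `‖U - m‖ ≲ √(nα/β)`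
without a logarithmic factor. The bilinear form is tested on a net of integer vectors. Pairs with a
small coefficient are handled by Chernoff and a union bound over the net; pairs with a large
coefficient by bounded row and column sums, a discrepancy property of vertex sets, and a dyadic
summation (`heavySum_le`). After multiplication by `β` the noise is of order `√(nαβ) ≲ √(nαρ)`.

Bias. In `k` steps at most `k s` nodes move, so `P (t - k)` and `P t` differ only in as many rows
and columns, and the squared Frobenius distance is linear in `k`. Jensen's inequality turns this
into a bound linear in `κ`, and `x² n = s α nMax` turns `κ x² ≲ ρ` into the rate
(`IsRegularMembership.smoothing_bias`).

Laplacian. The degrees of the average are not uniformly close to those of `P t`, since a node that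
moved may have a large bias. `specNorm_laplacian_sub_le` therefore needs only a pointwise lower
bound on the degrees, and measures their deviation in `ℓ²`, through the Frobenius norm of a diagonal
matrix times `L(P)`. The `ℓ²` deviation of the row sums is controlled by
`PoissonDominated.row_sq_tail`. The factor `μB` is the product of two factors `√μB`: one from the
ratio of degrees, one from the `ℓ²` bound. -/

/-! ### Spectral norm through bilinear forms -/

/-- Euclidean norm of a vector. -/
noncomputable def euclNorm {n : ℕ} (x : Fin n → ℝ) : ℝ := Real.sqrt (∑ a, x a ^ 2)

theorem euclNorm_nonneg {n : ℕ} (x : Fin n → ℝ) : 0 ≤ euclNorm x := Real.sqrt_nonneg _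

theorem euclNorm_sq {n : ℕ} (x : Fin n → ℝ) : euclNorm x ^ 2 = ∑ a, x a ^ 2 :=
  Real.sq_sqrt (Finset.sum_nonneg fun _ _ => sq_nonneg _)

theorem norm_eq_euclNorm {n : ℕ} (x : EuclideanSpace ℝ (Fin n)) : ‖x‖ = euclNorm x.ofLp := by
  rw [EuclideanSpace.norm_eq, euclNorm]
  simp

theorem euclNorm_eq_norm {n : ℕ} (x : Fin n → ℝ) :
    euclNorm x = ‖(WithLp.toLp 2 x : EuclideanSpace ℝ (Fin n))‖ := by
  rw [norm_eq_euclNorm]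

/-- The bilinear form of a matrix. -/
def bilin {n : ℕ} (M : Matrix (Fin n) (Fin n) ℝ) (x y : Fin n → ℝ) : ℝ :=
  ∑ a, ∑ b, M a b * (x a * y b)

theorem inner_toEuclideanCLM_eq_bilin {n : ℕ} (M : Matrix (Fin n) (Fin n) ℝ)
    (x y : EuclideanSpace ℝ (Fin n)) :
    inner ℝ x (Matrix.toEuclideanCLM (n := Fin n) (𝕜 := ℝ) M y) = bilin M x.ofLp y.ofLp := by
  rw [Matrix.inner_toEuclideanCLM]
  simp only [bilin, dotProduct, Matrix.mulVec, Finset.mul_sum]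
  refine Finset.sum_congr rfl fun a _ => Finset.sum_congr rfl fun b _ => ?_
  ring

theorem specNorm_nonneg {n : ℕ} (M : Matrix (Fin n) (Fin n) ℝ) : 0 ≤ specNorm M := norm_nonneg _

theorem bilin_le {n : ℕ} (M : Matrix (Fin n) (Fin n) ℝ) (x y : Fin n → ℝ) :
    bilin M x y ≤ specNorm M * (euclNorm x * euclNorm y) := by
  have h := inner_toEuclideanCLM_eq_bilin M (WithLp.toLp 2 x) (WithLp.toLp 2 y)
  have h' := real_inner_le_norm (WithLp.toLp 2 x : EuclideanSpace ℝ (Fin n))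
    (Matrix.toEuclideanCLM (n := Fin n) (𝕜 := ℝ) M (WithLp.toLp 2 y))
  rw [h] at h'
  refine h'.trans ?_
  have h2 := (Matrix.toEuclideanCLM (n := Fin n) (𝕜 := ℝ) M).le_opNorm (WithLp.toLp 2 y)
  rw [euclNorm_eq_norm, euclNorm_eq_norm, specNorm]
  calc _ ≤ ‖(WithLp.toLp 2 x : EuclideanSpace ℝ (Fin n))‖ * _ :=
        mul_le_mul_of_nonneg_left h2 (norm_nonneg _)
    _ = _ := by ring

theorem specNorm_le {n : ℕ} (M : Matrix (Fin n) (Fin n) ℝ) {C : ℝ} (hC : 0 ≤ C)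
    (h : ∀ x y : Fin n → ℝ, bilin M x y ≤ C * (euclNorm x * euclNorm y)) : specNorm M ≤ C := by
  refine ContinuousLinearMap.opNorm_le_bound _ hC fun y => ?_
  set T := Matrix.toEuclideanCLM (n := Fin n) (𝕜 := ℝ) M
  have h1 := h (T y).ofLp y.ofLp
  rw [← inner_toEuclideanCLM_eq_bilin, ← norm_eq_euclNorm, ← norm_eq_euclNorm,
    real_inner_self_eq_norm_sq] at h1
  rcases (norm_nonneg (T y)).eq_or_lt with h0 | h0
  · rw [← h0]; positivity
  · nlinarith

theorem specNorm_add_le {n : ℕ} (M N : Matrix (Fin n) (Fin n) ℝ) :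
    specNorm (M + N) ≤ specNorm M + specNorm N := by
  simp only [specNorm, map_add]; exact norm_add_le _ _

theorem specNorm_sub_le {n : ℕ} (M N : Matrix (Fin n) (Fin n) ℝ) :
    specNorm (M - N) ≤ specNorm M + specNorm N := by
  simp only [specNorm, map_sub]; exact norm_sub_le _ _

theorem specNorm_mul_le {n : ℕ} (M N : Matrix (Fin n) (Fin n) ℝ) :
    specNorm (M * N) ≤ specNorm M * specNorm N := by
  simp only [specNorm, map_mul]; exact norm_mul_le _ _

theorem specNorm_smul {n : ℕ} (c : ℝ) (M : Matrix (Fin n) (Fin n) ℝ) :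
    specNorm (c • M) = |c| * specNorm M := by
  simp only [specNorm, map_smul, norm_smul, Real.norm_eq_abs]

theorem bilin_transpose {n : ℕ} (M : Matrix (Fin n) (Fin n) ℝ) (x y : Fin n → ℝ) :
    bilin Mᵀ x y = bilin M y x := by
  simp only [bilin, Matrix.transpose_apply]
  rw [Finset.sum_comm]
  refine Finset.sum_congr rfl fun a _ => Finset.sum_congr rfl fun b _ => ?_
  ring

theorem specNorm_transpose_le {n : ℕ} (M : Matrix (Fin n) (Fin n) ℝ) :
    specNorm Mᵀ ≤ specNorm M :=
  specNorm_le _ (specNorm_nonneg _) fun x y => by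
    rw [bilin_transpose, mul_comm (euclNorm x)]; exact bilin_le _ _ _

theorem specNorm_transpose {n : ℕ} (M : Matrix (Fin n) (Fin n) ℝ) : specNorm Mᵀ = specNorm M :=
  le_antisymm (specNorm_transpose_le M) (by simpa using specNorm_transpose_le Mᵀ)

theorem bilin_sq_le {n : ℕ} (M : Matrix (Fin n) (Fin n) ℝ) (x y : Fin n → ℝ) :
    bilin M x y ^ 2 ≤ (∑ a, ∑ b, M a b ^ 2) * ((∑ a, x a ^ 2) * ∑ b, y b ^ 2) := by
  have h := Finset.sum_mul_sq_le_sq_mul_sq (Finset.univ : Finset (Fin n × Fin n))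
    (fun p => M p.1 p.2) (fun p => x p.1 * y p.2)
  simp only [Fintype.sum_prod_type] at h
  rw [Finset.sum_mul_sum]
  simpa only [bilin, mul_pow] using h

/-- The spectral norm is at most the Frobenius norm. -/
theorem specNorm_le_sqrt_sum_sq {n : ℕ} (M : Matrix (Fin n) (Fin n) ℝ) :
    specNorm M ≤ Real.sqrt (∑ a, ∑ b, M a b ^ 2) := by
  refine specNorm_le _ (Real.sqrt_nonneg _) fun x y => ?_
  refine (Real.le_sqrt_of_sq_le (bilin_sq_le M x y)).trans (le_of_eq ?_)
  rw [Real.sqrt_mul (by positivity), Real.sqrt_mul (by positivity)]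
  rfl

theorem specNorm_diagonal_le {n : ℕ} (v : Fin n → ℝ) {C : ℝ} (hC : 0 ≤ C) (h : ∀ a, |v a| ≤ C) :
    specNorm (Matrix.diagonal v) ≤ C := by
  open scoped Matrix.Norms.L2Operator in
  have h1 : specNorm (Matrix.diagonal v) = ‖v‖ := Matrix.l2_opNorm_diagonal v
  rw [h1, pi_norm_le_iff_of_nonneg hC]
  simpa using h

/-- The normalized Laplacian of a symmetric nonnegative matrix has spectral norm at most one. -/
theorem specNorm_laplacian_le_one {n : ℕ} (M : Matrix (Fin n) (Fin n) ℝ) (hM : ∀ a b, 0 ≤ M a b)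
    (hs : ∀ a b, M b a = M a b) : specNorm (laplacian M) ≤ 1 := by
  have hd : ∀ a, 0 ≤ degree M a := fun a => Finset.sum_nonneg fun b _ => hM a b
  have key : ∀ a, degree M a * ((Real.sqrt (degree M a))⁻¹) ^ 2 ≤ 1 := by
    intro a
    rw [inv_pow, Real.sq_sqrt (hd a)]
    exact mul_inv_le_one
  -- AM–GM entry by entry. Each row sum is cancelled by the squared normalisation, and symmetry
  -- treats the columns in the same way; rescaling to unit vectors then gives the product form.
  have hq : ∀ x y : Fin n → ℝ,
      bilin (laplacian M) x y ≤ (1 / 2) * (∑ a, x a ^ 2 + ∑ b, y b ^ 2) := by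
    intro x y
    set g : Fin n → ℝ := fun a => (Real.sqrt (degree M a))⁻¹ with hg
    have h1 : bilin (laplacian M) x y ≤
        ∑ a, ∑ b, (M a b * (g a * x a) ^ 2 / 2 + M a b * (g b * y b) ^ 2 / 2) := by
      refine Finset.sum_le_sum fun a _ => Finset.sum_le_sum fun b _ => ?_
      simp only [laplacian, Matrix.mul_diagonal, Matrix.diagonal_mul]
      change g a * M a b * g b * (x a * y b) ≤ _
      nlinarith [mul_nonneg (hM a b) (sq_nonneg (g a * x a - g b * y b))]
    have h2 : ∀ x : Fin n → ℝ, ∑ a, ∑ b, M a b * (g a * x a) ^ 2 / 2 ≤ (1 / 2) * ∑ a, x a ^ 2 := by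
      intro x
      rw [Finset.mul_sum]
      refine Finset.sum_le_sum fun a _ => ?_
      rw [← Finset.sum_div, ← Finset.sum_mul]
      have := mul_le_mul_of_nonneg_right (key a) (sq_nonneg (x a))
      change degree M a * (g a * x a) ^ 2 / 2 ≤ _
      rw [mul_pow, ← mul_assoc]
      change degree M a * g a ^ 2 * x a ^ 2 ≤ _ at this
      linarith
    have h3 : ∑ a, ∑ b, M a b * (g b * y b) ^ 2 / 2 ≤ (1 / 2) * ∑ a, y a ^ 2 := by
      rw [Finset.sum_comm]
      refine le_trans (le_of_eq ?_) (h2 y)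
      refine Finset.sum_congr rfl fun a _ => Finset.sum_congr rfl fun b _ => ?_
      rw [hs]
    refine h1.trans ?_
    simp only [Finset.sum_add_distrib]
    linarith [h2 x]
  refine specNorm_le _ zero_le_one fun x y => ?_
  rw [one_mul]
  rcases (euclNorm_nonneg x).eq_or_lt with hx | hx
  · have := bilin_le (laplacian M) x y
    rw [← hx] at this ⊢; simpa using this
  rcases (euclNorm_nonneg y).eq_or_lt with hy | hy
  · have := bilin_le (laplacian M) x y
    rw [← hy] at this ⊢; simpa using this
  have h4 := hq (fun a => x a / euclNorm x) (fun a => y a / euclNorm y)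
  have h5 : ∀ x : Fin n → ℝ, 0 < euclNorm x → ∑ a, (x a / euclNorm x) ^ 2 = 1 := by
    intro x hx
    simp only [div_pow, ← Finset.sum_div]
    rw [← euclNorm_sq, div_self (by positivity)]
  rw [h5 x hx, h5 y hy] at h4
  have h6 : bilin (laplacian M) (fun a => x a / euclNorm x) (fun a => y a / euclNorm y)
      = bilin (laplacian M) x y / (euclNorm x * euclNorm y) := by
    simp only [bilin, Finset.sum_div]
    refine Finset.sum_congr rfl fun a _ => Finset.sum_congr rfl fun b _ => ?_
    field_simp
  rw [h6, div_le_iff₀ (by positivity)] at h4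
  linarith

/-! ### Perturbation of the normalized Laplacian -/

theorem laplacian_apply {n : ℕ} (M : Matrix (Fin n) (Fin n) ℝ) (a b : Fin n) :
    laplacian M a b = (Real.sqrt (degree M a))⁻¹ * M a b * (Real.sqrt (degree M b))⁻¹ := by
  simp only [laplacian, Matrix.mul_diagonal, Matrix.diagonal_mul]

/-- In Frobenius norm, row `a` of `L(P)` has square at most `p / g`, because `P a b ^ 2 ≤ p * P a b`
and the row sum cancels the degree of `a`. Thus an `ℓ²` bound on `Z` suffices where the operator
norm of the diagonal factor would need a sup bound. -/
theorem specNorm_diagonal_mul_laplacian_le {n : ℕ} {P : Matrix (Fin n) (Fin n) ℝ} {p g c : ℝ}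
    (hP : ∀ a b, 0 ≤ P a b) (hPp : ∀ a b, P a b ≤ p) (hg : 0 < g)
    (hdP : ∀ a, g ≤ degree P a) (hc : 0 ≤ c) (w Z : Fin n → ℝ) (hw : ∀ a, |w a| ≤ c) :
    specNorm (Matrix.diagonal (fun a => w a * Z a) * laplacian P) ≤
      c * Real.sqrt (p / g * ∑ a, Z a ^ 2) := by
  have hpos : ∀ a, 0 < degree P a := fun a => hg.trans_le (hdP a)
  refine (specNorm_le_sqrt_sum_sq _).trans ?_
  have h : ∑ a, ∑ b, (Matrix.diagonal (fun a => w a * Z a) * laplacian P) a b ^ 2 ≤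
      c ^ 2 * (p / g * ∑ a, Z a ^ 2) := by
    rw [Finset.mul_sum, Finset.mul_sum]
    refine Finset.sum_le_sum fun a _ => ?_
    have hb : ∀ b, (Matrix.diagonal (fun a => w a * Z a) * laplacian P) a b ^ 2 ≤
        (c ^ 2 * Z a ^ 2 * (p / g) / degree P a) * P a b := by
      intro b
      rw [Matrix.diagonal_mul, laplacian_apply, mul_pow, mul_pow, mul_pow, mul_pow, inv_pow,
        inv_pow, Real.sq_sqrt (hpos a).le, Real.sq_sqrt (hpos b).le]
      have h1 : w a ^ 2 ≤ c ^ 2 := sq_le_sq' (by linarith [neg_abs_le (w a), hw a])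
        ((le_abs_self _).trans (hw a))
      have h2 : P a b ^ 2 ≤ p * P a b := by nlinarith [hP a b, hPp a b]
      have h3 : (degree P b)⁻¹ ≤ g⁻¹ := inv_anti₀ hg (hdP b)
      have h4 : 0 ≤ (degree P a)⁻¹ := inv_nonneg.2 (hpos a).le
      have h5 : 0 ≤ (degree P b)⁻¹ := inv_nonneg.2 (hpos b).le
      have h6 : 0 ≤ p * P a b := (sq_nonneg _).trans h2
      calc w a ^ 2 * Z a ^ 2 * ((degree P a)⁻¹ * P a b ^ 2 * (degree P b)⁻¹)
          ≤ c ^ 2 * Z a ^ 2 * ((degree P a)⁻¹ * (p * P a b) * g⁻¹) := by gcongr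
        _ = _ := by rw [div_eq_mul_inv, div_eq_mul_inv]; ring
    refine (Finset.sum_le_sum fun b _ => hb b).trans (le_of_eq ?_)
    rw [← Finset.mul_sum]
    change _ / degree P a * degree P a = _
    rw [div_mul_cancel₀ _ (hpos a).ne']
    ring
  refine (Real.sqrt_le_sqrt h).trans (le_of_eq ?_)
  rw [Real.sqrt_mul (sq_nonneg c), Real.sqrt_sq hc]

/-- Perturbation bound for the normalized Laplacian. -/
theorem specNorm_laplacian_sub_le {n : ℕ} {A P : Matrix (Fin n) (Fin n) ℝ} {p g G q : ℝ}
    (hP : ∀ a b, 0 ≤ P a b) (hPs : ∀ a b, P b a = P a b) (hPp : ∀ a b, P a b ≤ p) (hg : 0 < g)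
    (hdP : ∀ a, g ≤ degree P a) (hdG : ∀ a, degree P a ≤ G) (hdA : ∀ a, g / 4 ≤ degree A a)
    (hq : 0 ≤ q) :
    specNorm (laplacian A - laplacian P) ≤ 4 / g * specNorm (A - P) +
      (2 * Real.sqrt (G / g) + 1) * (2 / g * q + 2 / g *
        Real.sqrt (p / g * ∑ a, (degree P a - degree A a - q) ^ 2)) := by
  have hposA : ∀ a, 0 < degree A a := fun a => by linarith [hdA a]
  have hposP : ∀ a, 0 < degree P a := fun a => hg.trans_le (hdP a)
  set f : Fin n → ℝ := fun a => (Real.sqrt (degree A a))⁻¹ with hf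
  set E : Fin n → ℝ := fun a => Real.sqrt (degree P a) / Real.sqrt (degree A a) with hE
  set w : Fin n → ℝ := fun a => (Real.sqrt (degree A a) *
    (Real.sqrt (degree P a) + Real.sqrt (degree A a)))⁻¹ with hw
  set Z : Fin n → ℝ := fun a => degree P a - degree A a - q with hZ
  -- With `E = √(deg P / deg A)`, normalising `P` by the degrees of `A` gives `E L(P) E`, and `E L E
  -- - L = (E - 1) L E + L (E - 1)`.
  have hdec : laplacian A - laplacian P =
      Matrix.diagonal f * (A - P) * Matrix.diagonal f +
        (Matrix.diagonal (fun a => E a - 1) * laplacian P * Matrix.diagonal E +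
          laplacian P * Matrix.diagonal (fun a => E a - 1)) := by
    ext a b
    simp only [Matrix.sub_apply, Matrix.add_apply, Matrix.mul_diagonal, Matrix.diagonal_mul,
      laplacian_apply, hE, hf]
    have h1 := (Real.sqrt_pos.2 (hposA a)).ne'
    have h2 := (Real.sqrt_pos.2 (hposA b)).ne'
    have h3 := (Real.sqrt_pos.2 (hposP a)).ne'
    have h4 := (Real.sqrt_pos.2 (hposP b)).ne'
    field_simp
    ring
  have hE1 : ∀ a, E a - 1 = w a * q + w a * Z a := by
    intro a
    have h1 := Real.sqrt_pos.2 (hposA a)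
    have h3 := Real.sqrt_pos.2 (hposP a)
    have h5 := Real.sq_sqrt (hposA a).le
    have h6 := Real.sq_sqrt (hposP a).le
    simp only [hE, hw, hZ]
    rw [← mul_add, show q + (degree P a - degree A a - q) =
      Real.sqrt (degree P a) ^ 2 - Real.sqrt (degree A a) ^ 2 by rw [h5, h6]; ring]
    field_simp
    ring
  have hwle : ∀ a, |w a| ≤ 2 / g := by
    intro a
    have h1 : Real.sqrt g / 2 ≤ Real.sqrt (degree A a) := by
      refine Real.le_sqrt_of_sq_le ?_
      rw [div_pow, Real.sq_sqrt hg.le]; linarith [hdA a]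
    have h2 : Real.sqrt g ≤ Real.sqrt (degree P a) := Real.sqrt_le_sqrt (hdP a)
    have h3 := Real.sqrt_pos.2 hg
    have h4 := Real.sq_sqrt hg.le
    rw [abs_of_nonneg (by positivity), ← inv_div]
    refine inv_anti₀ (by positivity) ?_
    nlinarith
  have hEle : ∀ a, |E a| ≤ 2 * Real.sqrt (G / g) := by
    intro a
    simp only [hE]
    rw [abs_of_nonneg (by positivity), ← Real.sqrt_div (hposP a).le]
    refine Real.sqrt_le_iff.2 ⟨by positivity, ?_⟩
    have hG : 0 ≤ G := (hposP a).le.trans (hdG a)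
    rw [mul_pow, Real.sq_sqrt (by positivity), div_le_iff₀ (hposA a)]
    have : G / g * (g / 4) ≤ G / g * degree A a := by gcongr; exact hdA a
    have h5 : G / g * (g / 4) = G / 4 := by field_simp
    linarith [hdG a]
  have hfle : ∀ a, |f a| ≤ 2 / Real.sqrt g := by
    intro a
    have h1 : Real.sqrt g / 2 ≤ Real.sqrt (degree A a) := by
      refine Real.le_sqrt_of_sq_le ?_
      rw [div_pow, Real.sq_sqrt hg.le]; linarith [hdA a]
    have h3 := Real.sqrt_pos.2 hg
    simp only [hf]
    rw [abs_of_nonneg (by positivity), ← inv_div]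
    exact inv_anti₀ (by positivity) h1
  have hR : specNorm (Matrix.diagonal (fun a => E a - 1) * laplacian P) ≤
      2 / g * q + 2 / g * Real.sqrt (p / g * ∑ a, Z a ^ 2) := by
    -- The constant part `q` of the degree deviation is paid in operator norm with `‖L(P)‖ ≤ 1`;
    -- only the remainder `Z` goes through the Frobenius norm.
    have h1 : Matrix.diagonal (fun a => E a - 1) * laplacian P =
        Matrix.diagonal (fun a => w a * q) * laplacian P +
          Matrix.diagonal (fun a => w a * Z a) * laplacian P := by
      rw [← add_mul, Matrix.diagonal_add]
      simp only [hE1]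
    rw [h1]
    refine (specNorm_add_le _ _).trans (add_le_add ?_ ?_)
    · refine (specNorm_mul_le _ _).trans ?_
      have h2 : specNorm (Matrix.diagonal (fun a => w a * q)) ≤ 2 / g * q := by
        refine specNorm_diagonal_le _ (by positivity) fun a => ?_
        rw [abs_mul, abs_of_nonneg hq]
        exact mul_le_mul_of_nonneg_right (hwle a) hq
      calc _ ≤ 2 / g * q * 1 := mul_le_mul h2 (specNorm_laplacian_le_one P hP hPs)
            (specNorm_nonneg _) (by positivity)
        _ = _ := mul_one _
    · exact specNorm_diagonal_mul_laplacian_le hP hPp hg hdP (by positivity) w Z hwle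
  have hLt : (laplacian P * Matrix.diagonal (fun a => E a - 1)) =
      (Matrix.diagonal (fun a => E a - 1) * laplacian P)ᵀ := by
    ext a b
    simp only [Matrix.transpose_apply, Matrix.mul_diagonal, Matrix.diagonal_mul, laplacian_apply]
    rw [hPs a b]; ring
  rw [hdec]
  refine (specNorm_add_le _ _).trans (add_le_add ?_ ((specNorm_add_le _ _).trans ?_))
  · have h1 : specNorm (Matrix.diagonal f) ≤ 2 / Real.sqrt g :=
      specNorm_diagonal_le _ (by positivity) hfle
    calc _ ≤ specNorm (Matrix.diagonal f * (A - P)) * specNorm (Matrix.diagonal f) :=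
          specNorm_mul_le _ _
      _ ≤ (specNorm (Matrix.diagonal f) * specNorm (A - P)) * specNorm (Matrix.diagonal f) :=
          mul_le_mul_of_nonneg_right (specNorm_mul_le _ _) (specNorm_nonneg _)
      _ ≤ (2 / Real.sqrt g * specNorm (A - P)) * (2 / Real.sqrt g) := by
          have := specNorm_nonneg (A - P)
          have := specNorm_nonneg (Matrix.diagonal f)
          gcongr
      _ = _ := by
          have h3 := Real.sqrt_pos.2 hg
          have h4 := Real.sq_sqrt hg.le
          field_simp
          rw [h4]; ring
  · rw [hLt, specNorm_transpose]
    have h1 := specNorm_mul_le (Matrix.diagonal (fun a => E a - 1) * laplacian P)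
      (Matrix.diagonal E)
    have h2 : specNorm (Matrix.diagonal E) ≤ 2 * Real.sqrt (G / g) :=
      specNorm_diagonal_le _ (by positivity) hEle
    have h3 := specNorm_nonneg (Matrix.diagonal (fun a => E a - 1) * laplacian P)
    set r := specNorm (Matrix.diagonal (fun a => E a - 1) * laplacian P)
    calc _ ≤ r * (2 * Real.sqrt (G / g)) + r := by
          gcongr
          exact h1.trans (mul_le_mul_of_nonneg_left h2 h3)
      _ = (2 * Real.sqrt (G / g) + 1) * r := by ring
      _ ≤ _ := mul_le_mul_of_nonneg_left hR (by positivity)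

/-! ### Discretization of the unit ball by integer vectors -/

theorem bilin_add_left {n : ℕ} (M : Matrix (Fin n) (Fin n) ℝ) (x x' y : Fin n → ℝ) :
    bilin M (fun a => x a + x' a) y = bilin M x y + bilin M x' y := by
  simp only [bilin, ← Finset.sum_add_distrib]
  refine Finset.sum_congr rfl fun a _ => Finset.sum_congr rfl fun b _ => ?_
  ring

theorem bilin_add_right {n : ℕ} (M : Matrix (Fin n) (Fin n) ℝ) (x y y' : Fin n → ℝ) :
    bilin M x (fun a => y a + y' a) = bilin M x y + bilin M x y' := by
  simp only [bilin, ← Finset.sum_add_distrib]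
  refine Finset.sum_congr rfl fun a _ => Finset.sum_congr rfl fun b _ => ?_
  ring

theorem bilin_div_div {n : ℕ} (M : Matrix (Fin n) (Fin n) ℝ) (x y : Fin n → ℝ) (c d : ℝ) :
    bilin M (fun a => x a / c) (fun a => y a / d) = bilin M x y / (c * d) := by
  simp only [bilin, Finset.sum_div]
  refine Finset.sum_congr rfl fun a _ => Finset.sum_congr rfl fun b _ => ?_
  rw [div_mul_div_comm, mul_div_assoc']

theorem euclNorm_le_iff {n : ℕ} (x : Fin n → ℝ) {c : ℝ} (hc : 0 ≤ c) :
    euclNorm x ≤ c ↔ ∑ a, x a ^ 2 ≤ c ^ 2 := by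
  rw [euclNorm, Real.sqrt_le_left hc]

theorem euclNorm_div {n : ℕ} (x : Fin n → ℝ) {c : ℝ} (hc : 0 < c) :
    euclNorm (fun a => x a / c) = euclNorm x / c := by
  simp only [euclNorm, div_pow, ← Finset.sum_div]
  rw [Real.sqrt_div (by positivity), Real.sqrt_sq hc.le]

/-- Rounding is towards zero, so that rounded vectors stay in the ball and inherit pointwise bounds.
-/
theorem exists_int_trunc (y : ℝ) : ∃ k : ℤ, |(k : ℝ)| ≤ |y| ∧ |y - k| ≤ 1 := by
  rcases le_total 0 y with h | h
  · have h1 := Int.floor_le y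
    have h2 := Int.lt_floor_add_one y
    have h3 : (0 : ℝ) ≤ ⌊y⌋ := by exact_mod_cast Int.floor_nonneg.2 h
    refine ⟨⌊y⌋, ?_, ?_⟩
    · rwa [abs_of_nonneg h, abs_of_nonneg h3]
    · rw [abs_le]; constructor <;> linarith
  · have h1 := Int.le_ceil y
    have h2 := Int.ceil_lt_add_one y
    have h3 : (⌈y⌉ : ℝ) ≤ 0 := by exact_mod_cast Int.ceil_le.2 (by simpa using h)
    refine ⟨⌈y⌉, ?_, ?_⟩
    · rw [abs_of_nonpos h, abs_of_nonpos h3]; linarith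
    · rw [abs_le]; constructor <;> linarith

/-- Integer vectors of Euclidean norm at most `4 √n`. -/
noncomputable def intNet (n : ℕ) : Finset (Fin n → ℤ) :=
  (Fintype.piFinset fun _ => Finset.Icc (-(4 * n : ℤ)) (4 * n)).filter
    fun k => ∑ a, k a ^ 2 ≤ 16 * n

theorem mem_intNet {n : ℕ} (k : Fin n → ℤ) : k ∈ intNet n ↔ ∑ a, (k a : ℝ) ^ 2 ≤ 16 * n := by
  have hcast : ∑ a, (k a : ℝ) ^ 2 ≤ 16 * n ↔ ∑ a, k a ^ 2 ≤ 16 * (n : ℤ) := by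
    exact_mod_cast Iff.rfl
  rw [hcast, intNet, Finset.mem_filter, Fintype.mem_piFinset]
  refine ⟨fun h => h.2, fun h => ⟨fun a => ?_, h⟩⟩
  have h1 : k a ^ 2 ≤ 16 * n :=
    (Finset.single_le_sum (fun b _ => sq_nonneg (k b)) (Finset.mem_univ a)).trans h
  have hn : (1 : ℤ) ≤ n := by exact_mod_cast (Fin.pos a)
  rw [Finset.mem_Icc, ← abs_le]
  exact abs_le_of_sq_le_sq (by nlinarith) (by positivity)

/-- The correction `2 exp (-N)` makes the induction close: `exp (-(N+1)²) ≤ exp (-(N+1))` and `e ≥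
2`. -/
theorem sum_Icc_exp_neg_sq_le (N : ℕ) :
    ∑ k ∈ Finset.Icc (-(N : ℤ)) N, Real.exp (-(k : ℝ) ^ 2) ≤ 4 - 2 * Real.exp (-N) := by
  induction N with
  | zero => simp; norm_num
  | succ N ih =>
    have h : Finset.Icc (-((N + 1 : ℕ) : ℤ)) ((N + 1 : ℕ) : ℤ) =
        insert (-((N : ℤ) + 1)) (insert ((N : ℤ) + 1) (Finset.Icc (-(N : ℤ)) N)) := by
      ext x
      simp only [Finset.mem_Icc, Finset.mem_insert]
      push_cast
      omega
    rw [h, Finset.sum_insert, Finset.sum_insert]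
    · push_cast
      have h1 : Real.exp (-(-((N : ℝ) + 1)) ^ 2) ≤ Real.exp (-((N : ℝ) + 1)) := by
        apply Real.exp_le_exp.2; nlinarith [Nat.cast_nonneg (α := ℝ) N]
      have h2 : Real.exp (-((N : ℝ) + 1) ^ 2) ≤ Real.exp (-((N : ℝ) + 1)) := by
        apply Real.exp_le_exp.2; nlinarith [Nat.cast_nonneg (α := ℝ) N]
      have h3 : Real.exp (-(N : ℝ)) = Real.exp 1 * Real.exp (-((N : ℝ) + 1)) := by
        rw [← Real.exp_add]; congr 1; ring
      have h4 : (2 : ℝ) ≤ Real.exp 1 := by linarith [Real.add_one_le_exp (1 : ℝ)]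
      have h5 := Real.exp_pos (-((N : ℝ) + 1))
      nlinarith
    · simp
    · simp only [Finset.mem_insert, Finset.mem_Icc]; omega

/-- Gaussian weighting: each point of the net contributes at least one to `∑ exp (16 n - |k|²)`.
This sum is at most `exp (16 n)` times a product of `n` one-dimensional sums, each below `4 ≤ e²`.
-/
theorem card_intNet_le (n : ℕ) : ((intNet n).card : ℝ) ≤ Real.exp (18 * n) := by
  have h1 : ((intNet n).card : ℝ) ≤
      ∑ k ∈ intNet n, Real.exp (16 * n) * ∏ a, Real.exp (-(k a : ℝ) ^ 2) := by
    rw [Finset.card_eq_sum_ones, Nat.cast_sum]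
    refine Finset.sum_le_sum fun k hk => ?_
    rw [← Real.exp_sum, ← Real.exp_add, Finset.sum_neg_distrib]
    rw [mem_intNet] at hk
    have h0 : 0 ≤ 16 * (n : ℝ) + -∑ a, (k a : ℝ) ^ 2 := by linarith
    simpa using Real.one_le_exp h0
  have h2 : ∑ k ∈ intNet n, Real.exp (16 * n) * ∏ a, Real.exp (-(k a : ℝ) ^ 2) ≤
      Real.exp (16 * n) *
        ∏ _a : Fin n, ∑ k ∈ Finset.Icc (-(4 * n : ℤ)) (4 * n), Real.exp (-(k : ℝ) ^ 2) := by
    rw [← Finset.mul_sum, Finset.prod_univ_sum]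
    refine mul_le_mul_of_nonneg_left ?_ (Real.exp_pos _).le
    exact Finset.sum_le_sum_of_subset_of_nonneg (Finset.filter_subset _ _)
      fun _ _ _ => Finset.prod_nonneg fun _ _ => (Real.exp_pos _).le
  have h3 : ∑ k ∈ Finset.Icc (-(4 * n : ℤ)) (4 * n), Real.exp (-(k : ℝ) ^ 2) ≤ Real.exp 2 := by
    have h4 := sum_Icc_exp_neg_sq_le (4 * n)
    push_cast at h4
    have h5 : (2 : ℝ) ≤ Real.exp 1 := by linarith [Real.add_one_le_exp (1 : ℝ)]
    have h6 : Real.exp 2 = Real.exp 1 * Real.exp 1 := by rw [← Real.exp_add]; norm_num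
    have := Real.exp_pos (-(4 * n : ℝ))
    nlinarith
  refine h1.trans (h2.trans ?_)
  rw [Finset.prod_const, Finset.card_univ, Fintype.card_fin]
  calc _ ≤ Real.exp (16 * n) * (Real.exp 2) ^ n := by
        refine mul_le_mul_of_nonneg_left (pow_le_pow_left₀ ?_ h3 n) (Real.exp_pos _).le
        exact Finset.sum_nonneg fun _ _ => (Real.exp_pos _).le
    _ = _ := by rw [← Real.exp_nat_mul, ← Real.exp_add]; congr 1; ring

/-- Truncate `4 √n u` coordinatewise: `n` errors of size at most `1 / (4 √n)` have Euclidean norm at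
most `1/4`. The pointwise bound on `k` is needed for the row sums, where the Chernoff coefficients
must stay bounded. -/
theorem exists_mem_intNet {n : ℕ} (hn : 0 < n) (u : Fin n → ℝ) (hu : euclNorm u ≤ 1) :
    ∃ k ∈ intNet n, (∀ a, |(k a : ℝ)| ≤ 4 * Real.sqrt n * |u a|) ∧
      euclNorm (fun a => u a - k a / (4 * Real.sqrt n)) ≤ 1 / 4 := by
  have hn' : (0 : ℝ) < n := by exact_mod_cast hn
  have hs := Real.sqrt_pos.2 hn'
  have hsq := Real.sq_sqrt hn'.le
  choose k hk1 hk2 using fun a => exists_int_trunc (4 * Real.sqrt n * u a)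
  have hk3 : ∀ a, |(k a : ℝ)| ≤ 4 * Real.sqrt n * |u a| := by
    intro a
    have := hk1 a
    rwa [abs_mul, abs_of_pos (by positivity : 0 < 4 * Real.sqrt n)] at this
  refine ⟨k, ?_, hk3, ?_⟩
  · rw [mem_intNet]
    rw [euclNorm_le_iff _ zero_le_one] at hu
    calc ∑ a, (k a : ℝ) ^ 2 ≤ ∑ a, 16 * n * u a ^ 2 := by
          refine Finset.sum_le_sum fun a _ => ?_
          rw [← sq_abs, ← sq_abs (u a)]
          calc |(k a : ℝ)| ^ 2 ≤ (4 * Real.sqrt n * |u a|) ^ 2 := by gcongr; exact hk3 a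
            _ = _ := by rw [mul_pow, mul_pow, hsq]; ring
      _ ≤ _ := by
          rw [← Finset.mul_sum]
          nlinarith
  · rw [euclNorm_le_iff _ (by norm_num)]
    calc ∑ a, (u a - k a / (4 * Real.sqrt n)) ^ 2 ≤ ∑ _a : Fin n, 1 / (16 * (n : ℝ)) := by
          refine Finset.sum_le_sum fun a _ => ?_
          have h1 : u a - k a / (4 * Real.sqrt n) =
              (4 * Real.sqrt n * u a - k a) / (4 * Real.sqrt n) := by field_simp
          rw [h1, div_pow, mul_pow, hsq]
          have h2 : (4 * Real.sqrt n * u a - k a) ^ 2 ≤ 1 := by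
            rw [← sq_abs]; exact pow_le_one₀ (abs_nonneg _) (hk2 a)
          rw [show (4 : ℝ) ^ 2 * n = 16 * n by norm_num]
          gcongr
      _ = _ := by
          rw [Finset.sum_const, Finset.card_univ, Fintype.card_fin, nsmul_eq_mul]
          field_simp; norm_num

/-- The spectral norm is controlled by the bilinear form on integer vectors. -/
theorem specNorm_le_of_intNet {n : ℕ} (hn : 0 < n) (M : Matrix (Fin n) (Fin n) ℝ) {B : ℝ}
    (hB : 0 ≤ B) (h : ∀ k ∈ intNet n, ∀ l ∈ intNet n,
      bilin M (fun a => (k a : ℝ)) (fun a => (l a : ℝ)) ≤ 16 * n * B) : specNorm M ≤ 2 * B := by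
  have hn' : (0 : ℝ) < n := by exact_mod_cast hn
  have hs := Real.sqrt_pos.2 hn'
  have hsq := Real.sq_sqrt hn'.le
  have hN := specNorm_nonneg M
  have key : ∀ u v : Fin n → ℝ, euclNorm u ≤ 1 → euclNorm v ≤ 1 →
      bilin M u v ≤ B + specNorm M / 2 := by
    intro u v hu hv
    obtain ⟨k, hk, hk1, hk2⟩ := exists_mem_intNet hn u hu
    obtain ⟨l, hl, hl1, hl2⟩ := exists_mem_intNet hn v hv
    set c := 4 * Real.sqrt n with hc
    have hcp : 0 < c := by positivity
    have hx : euclNorm (fun a => (k a : ℝ) / c) ≤ 1 := by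
      rw [euclNorm_div _ hcp, div_le_one hcp, euclNorm_le_iff _ hcp.le, hc, mul_pow, hsq]
      rw [mem_intNet] at hk; linarith
    -- Each of the two rounding errors costs `‖M‖ / 4`; their sum `‖M‖ / 2` is absorbed at the end,
    -- hence the factor `2`.
    have e1 : bilin M u v = bilin M (fun a => (u a - k a / c)) v +
        (bilin M (fun a => (k a : ℝ) / c) (fun a => v a - l a / c) +
          bilin M (fun a => (k a : ℝ) / c) (fun a => (l a : ℝ) / c)) := by
      rw [← bilin_add_right, add_comm, ]
      simp only [sub_add_cancel]
      rw [← bilin_add_left]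
      simp
    have b1 := bilin_le M (fun a => (u a - k a / c)) v
    have b2 := bilin_le M (fun a => (k a : ℝ) / c) (fun a => v a - l a / c)
    have b3 : bilin M (fun a => (k a : ℝ) / c) (fun a => (l a : ℝ) / c) ≤ B := by
      rw [bilin_div_div, div_le_iff₀ (by positivity)]
      refine (h k hk l hl).trans (le_of_eq ?_)
      rw [hc]; linear_combination -(16 * B) * hsq
    have b4 : euclNorm (fun a => (u a - k a / c)) * euclNorm v ≤ 1 / 4 * 1 :=
      mul_le_mul hk2 hv (euclNorm_nonneg _) (by norm_num)
    have b5 : euclNorm (fun a => (k a : ℝ) / c) * euclNorm (fun a => v a - l a / c) ≤ 1 * (1 / 4) :=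
      mul_le_mul hx hl2 (euclNorm_nonneg _) (by norm_num)
    have b6 := mul_le_mul_of_nonneg_left b4 hN
    have b7 := mul_le_mul_of_nonneg_left b5 hN
    linarith
  have h2 : specNorm M ≤ B + specNorm M / 2 := by
    refine specNorm_le _ (by positivity) fun x y => ?_
    rcases (euclNorm_nonneg x).eq_or_lt with hx | hx
    · have := bilin_le M x y
      rw [← hx] at this ⊢; simpa using this
    rcases (euclNorm_nonneg y).eq_or_lt with hy | hy
    · have := bilin_le M x y
      rw [← hy] at this ⊢; simpa using this
    have h4 := key (fun a => x a / euclNorm x) (fun a => y a / euclNorm y)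
      (by rw [euclNorm_div _ hx, div_self hx.ne']) (by rw [euclNorm_div _ hy, div_self hy.ne'])
    rwa [bilin_div_div, div_le_iff₀ (by positivity)] at h4
  linarith

/-- The Euclidean norm of a vector is attained up to a constant on an integer vector with entries
of comparable sizes. -/
theorem exists_mem_intNet_le_sum {n : ℕ} (hn : 0 < n) (Y : Fin n → ℝ) (hY : 0 < euclNorm Y) :
    ∃ k ∈ intNet n, (∀ a, |(k a : ℝ)| ≤ 4 * Real.sqrt n * (|Y a| / euclNorm Y)) ∧
      3 * Real.sqrt n * euclNorm Y ≤ ∑ a, k a * Y a := by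
  have hn' : (0 : ℝ) < n := by exact_mod_cast hn
  have hs := Real.sqrt_pos.2 hn'
  obtain ⟨k, hk, hk1, hk2⟩ := exists_mem_intNet hn (fun a => Y a / euclNorm Y)
    (by rw [euclNorm_div _ hY, div_self hY.ne'])
  refine ⟨k, hk, fun a => ?_, ?_⟩
  · have := hk1 a
    rwa [abs_div, abs_of_pos hY] at this
  · set c := 4 * Real.sqrt n with hc
    have hcp : 0 < c := by positivity
    -- Cauchy–Schwarz against the rounding error, of norm at most `1/4`, leaves at least three
    -- quarters of the norm of `Y`.
    have h1 := Real.sum_mul_le_sqrt_mul_sqrt Finset.univ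
      (fun a => Y a / euclNorm Y - k a / c) Y
    have h2 : ∑ a, (Y a / euclNorm Y - k a / c) * Y a = euclNorm Y - (∑ a, k a * Y a) / c := by
      simp only [sub_mul, Finset.sum_sub_distrib]
      congr 1
      · rw [eq_comm, ← mul_right_inj' hY.ne', ← sq, euclNorm_sq, Finset.mul_sum]
        refine Finset.sum_congr rfl fun a _ => ?_
        field_simp
      · rw [Finset.sum_div]
        refine Finset.sum_congr rfl fun a _ => ?_
        ring
    rw [h2] at h1
    have h3 : euclNorm Y - (∑ a, k a * Y a) / c ≤ 1 / 4 * euclNorm Y :=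
      h1.trans (mul_le_mul_of_nonneg_right hk2 (Real.sqrt_nonneg _))
    have h4 : 3 / 4 * euclNorm Y ≤ (∑ a, k a * Y a) / c := by linarith
    rw [le_div_iff₀ hcp] at h4
    rw [hc] at h4
    linarith

/-! ### Dyadic summation for the heavy pairs -/

theorem sum_two_pow_le (N : ℕ) {A : ℝ} (hA : 0 ≤ A) :
    ∑ i ∈ Finset.range N, (if (2 : ℝ) ^ i ≤ A then (2 : ℝ) ^ i else 0) ≤ 2 * A := by
  induction N generalizing A with
  | zero => simpa using hA
  | succ N ih =>
    rw [Finset.sum_range_succ]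
    split_ifs with h
    · have h1 : ∑ i ∈ Finset.range N, (if (2 : ℝ) ^ i ≤ A then (2 : ℝ) ^ i else 0) ≤
          ∑ i ∈ Finset.range N, (2 : ℝ) ^ i := by
        refine Finset.sum_le_sum fun i _ => ?_
        split_ifs
        · exact le_rfl
        · positivity
      rw [geom_sum_eq (by norm_num)] at h1
      norm_num at h1
      linarith
    · simpa using ih hA

theorem sum_two_pow_inv_le (N : ℕ) {A : ℝ} (hA : 0 < A) :
    ∑ i ∈ Finset.range N, (if A ≤ (2 : ℝ) ^ i then ((2 : ℝ) ^ i)⁻¹ else 0) ≤ 2 / A := by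
  induction N generalizing A with
  | zero => simp; positivity
  | succ N ih =>
    rw [Finset.sum_range_succ']
    have h1 : ∀ i, (if A ≤ (2 : ℝ) ^ (i + 1) then ((2 : ℝ) ^ (i + 1))⁻¹ else 0) =
        (1 / 2) * (if A / 2 ≤ (2 : ℝ) ^ i then ((2 : ℝ) ^ i)⁻¹ else 0) := by
      intro i
      have : A / 2 ≤ (2 : ℝ) ^ i ↔ A ≤ (2 : ℝ) ^ (i + 1) := by
        rw [div_le_iff₀ (by norm_num), pow_succ]
      simp only [this]
      split_ifs
      · rw [pow_succ, mul_inv]; ring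
      · simp
    by_cases h2 : A ≤ 1
    · have h3 : ∑ i ∈ Finset.range N, (if A ≤ (2 : ℝ) ^ (i + 1) then ((2 : ℝ) ^ (i + 1))⁻¹ else 0)
          ≤ 1 := by
        simp only [h1]
        rw [← Finset.mul_sum]
        have h4 : ∑ i ∈ Finset.range N, (if A / 2 ≤ (2 : ℝ) ^ i then ((2 : ℝ) ^ i)⁻¹ else 0) ≤
            ∑ i ∈ Finset.range N, (if (1 : ℝ) ≤ (2 : ℝ) ^ i then ((2 : ℝ) ^ i)⁻¹ else 0) := by
          refine Finset.sum_le_sum fun i _ => ?_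
          rw [if_pos (one_le_pow₀ (by norm_num))]
          split_ifs
          · exact le_rfl
          · positivity
        have := ih (A := 1) one_pos
        linarith
      have h5 : 2 ≤ 2 / A := by rw [le_div_iff₀ hA]; linarith
      simp only [pow_zero, h2, if_true]
      linarith
    · have h3 := ih (A := A / 2) (by positivity)
      simp only [h1, pow_zero, h2, if_false, add_zero]
      rw [← Finset.mul_sum]
      have : 2 / (A / 2) = 4 / A := by field_simp; norm_num
      rw [this] at h3
      calc _ ≤ 1 / 2 * (4 / A) := by gcongr
        _ = _ := by ring

set_option maxHeartbeats 1000000 in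
/-- Pointwise bound for the contribution of a pair of dyadic levels. -/
theorem heavy_level_bound {n δ C₁ C₂ s t e : ℝ} {i j : ℕ} (hn : 0 < n) (hδ : 0 < δ)
    (hC₁ : 0 ≤ C₁) (hC₂ : 0 ≤ C₂) (hs : 0 ≤ s) (ht : 0 ≤ t) (htn : t * 4 ^ j ≤ 16 * n)
    (hheavy : δ ≤ 2 ^ j * 2 ^ i) (h0 : t = 0 → e ≤ 0) (hdeg : e ≤ C₁ * δ ^ 2 * s)
    (h1 : 0 < t → e ≤ 3 * (δ ^ 2 * s * t / n) + C₂ * t * (1 + Real.log (n / t)))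
    (h2 : 0 < t → e ≤ 4 * (δ ^ 2 * s * t / n) * Real.exp ((1 + Real.log (n / t)) / 4)
      + 4 * C₂ * t) :
    e * (2 ^ i * 2 ^ j) ≤ (C₁ + 4 * C₂ + 32) * δ * (s * 4 ^ i * (t * 4 ^ j) / n
      + s * 4 ^ i * (if (2 : ℝ) ^ j ≤ 2 ^ i / δ then (2 : ℝ) ^ j else 0) * (δ / 2 ^ i)
      + s * 4 ^ i * (if δ / 2 ^ i ≤ (2 : ℝ) ^ j then ((2 : ℝ) ^ j)⁻¹ else 0) * (δ / 2 ^ i)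
      + t * 4 ^ j * (if (2 : ℝ) ^ i ≤ δ * 2 ^ j then (2 : ℝ) ^ i else 0) * (δ * 2 ^ j)⁻¹
      + t * 4 ^ j * (if (2 : ℝ) ^ i ≤ δ then (2 : ℝ) ^ i else 0) * δ⁻¹) := by
  have h4i : (4 : ℝ) ^ i = 2 ^ i * 2 ^ i := by rw [← mul_pow]; norm_num
  have h4j : (4 : ℝ) ^ j = 2 ^ j * 2 ^ j := by rw [← mul_pow]; norm_num
  have h16 : (16 : ℝ) ^ j = (2 ^ j * 2 ^ j) ^ 2 := by rw [← h4j, ← pow_mul, mul_comm, pow_mul]; norm_num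
  have hI1 : (1 : ℝ) ≤ 2 ^ i := one_le_pow₀ (by norm_num)
  have hJ1 : (1 : ℝ) ≤ 2 ^ j := one_le_pow₀ (by norm_num)
  have hlogJ : Real.log (((2 : ℝ) ^ j * 2 ^ j) ^ 2) ≤ 3 * (2 ^ j - 1) := by
    have hj : (j : ℝ) ≤ 2 ^ j - 1 := by
      have : j + 1 ≤ 2 ^ j := Nat.lt_two_pow_self
      have h' : ((j + 1 : ℕ) : ℝ) ≤ ((2 ^ j : ℕ) : ℝ) := by exact_mod_cast this
      push_cast at h'; linarith
    rw [← h16, Real.log_pow]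
    have : Real.log 16 ≤ 3 := by
      rw [show (16 : ℝ) = 2 ^ 4 by norm_num, Real.log_pow]
      have := Real.log_two_lt_d9
      norm_num; linarith
    have hj0 : (0 : ℝ) ≤ j := Nat.cast_nonneg j
    nlinarith
  rw [h4j] at htn
  rw [h4i, h4j]
  set I : ℝ := 2 ^ i with hI
  set J : ℝ := 2 ^ j with hJ
  clear_value I J
  have hIp : 0 < I := by linarith
  have hJp : 0 < J := by linarith
  have hT1 : 0 ≤ s * (I * I) * (t * (J * J)) / n := by positivity
  have hT2 : 0 ≤ s * (I * I) * (if J ≤ I / δ then J else 0) * (δ / I) := by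
    split_ifs <;> positivity
  have hT3 : 0 ≤ s * (I * I) * (if δ / I ≤ J then J⁻¹ else 0) * (δ / I) := by
    split_ifs <;> positivity
  have hT4 : 0 ≤ t * (J * J) * (if I ≤ δ * J then I else 0) * (δ * J)⁻¹ := by
    split_ifs <;> positivity
  have hT5 : 0 ≤ t * (J * J) * (if I ≤ δ then I else 0) * δ⁻¹ := by
    split_ifs <;> positivity
  set T1 := s * (I * I) * (t * (J * J)) / n with hT1d
  set T2 := s * (I * I) * (if J ≤ I / δ then J else 0) * (δ / I) with hT2d
  set T3 := s * (I * I) * (if δ / I ≤ J then J⁻¹ else 0) * (δ / I) with hT3d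
  set T4 := t * (J * J) * (if I ≤ δ * J then I else 0) * (δ * J)⁻¹ with hT4d
  set T5 := t * (J * J) * (if I ≤ δ then I else 0) * δ⁻¹ with hT5d
  have hIJ : 0 < I * J := by positivity
  -- In each case below, the term proportional to `s` is charged to one of `T1`, `T2`, `T3` and the
  -- term in `C₂ * t` to `T4` or `T5`.
  have fin : ∀ c₁ X : ℝ, 0 ≤ c₁ → c₁ ≤ 32 → 0 ≤ X → X ≤ T1 + T2 + T3 →
      ∀ Y : ℝ, 0 ≤ Y → Y ≤ T4 + T5 → e * (I * J) ≤ δ * ((C₁ + c₁) * X + 4 * C₂ * Y) →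
      e * (I * J) ≤ (C₁ + 4 * C₂ + 32) * δ * (T1 + T2 + T3 + T4 + T5) := by
    intro c₁ X hc hc' hX hX' Y hY hY' h
    refine h.trans ?_
    have e1 : (C₁ + c₁) * X ≤ (C₁ + 4 * C₂ + 32) * (T1 + T2 + T3) :=
      mul_le_mul (by linarith) hX' hX (by linarith)
    have e2 : 4 * C₂ * Y ≤ (C₁ + 4 * C₂ + 32) * (T4 + T5) :=
      mul_le_mul (by linarith) hY' hY (by linarith)
    calc _ ≤ δ * ((C₁ + 4 * C₂ + 32) * (T1 + T2 + T3) + (C₁ + 4 * C₂ + 32) * (T4 + T5)) := by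
          gcongr
      _ = _ := by ring
  rcases ht.eq_or_lt with ht0 | htp
  · have := mul_nonpos_of_nonpos_of_nonneg (h0 ht0.symm) hIJ.le
    refine this.trans (by positivity)
  -- When `I` dominates `δ J`, the degree bound alone suffices.
  by_cases hA : J ≤ I / δ
  · refine fin 0 T2 le_rfl (by norm_num) hT2 (by linarith) 0 le_rfl (by linarith) ?_
    calc e * (I * J) ≤ C₁ * δ ^ 2 * s * (I * J) := mul_le_mul_of_nonneg_right hdeg hIJ.le
      _ = _ := by rw [hT2d, if_pos hA]; field_simp; ring
  have hA' : I ≤ δ * J := by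
    rw [not_le, div_lt_iff₀ hδ] at hA; linarith
  have h3 : δ / I ≤ J := by rwa [div_le_iff₀ hIp]
  have hexp14 : Real.exp (1 / 4) ≤ 2 := by
    rw [← Real.le_log_iff_exp_le (by norm_num)]
    linarith [Real.log_two_gt_d9]
  have hY4 : 4 * C₂ * t * (I * J) = δ * (4 * C₂ * T4) := by
    rw [hT4d, if_pos hA']; field_simp
  -- Small level set: `n / t` is at most the square of `n / (t J²)`, so the tilt factor `exp ((1 +
  -- log (n/t)) / 4)` is at most a multiple of `√(n / (t J²))`. Since `t J² ≤ 16 n`, that root is at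
  -- most `4 n / (t J²)`.
  by_cases hB : t * (J * J) * (J * J) ≤ n
  · have hτ : 0 < t * (J * J) := by positivity
    have hR : Real.exp ((1 + Real.log (n / t)) / 4) ≤ 8 * (n / (t * (J * J))) := by
      have e1 : n / t ≤ (n / (t * (J * J))) ^ 2 := by
        rw [div_pow, div_le_div_iff₀ htp (by positivity)]
        calc n * (t * (J * J)) ^ 2 = n * t * (t * (J * J) * (J * J)) := by ring
          _ ≤ n * t * n := by gcongr
          _ = _ := by ring
      have e2 : Real.log (n / t) ≤ 2 * Real.log (n / (t * (J * J))) := by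
        have := Real.log_le_log (by positivity) e1
        rwa [Real.log_pow] at this
      have e3 : Real.exp ((1 + Real.log (n / t)) / 4) ≤
          Real.exp (1 / 4) * Real.sqrt (n / (t * (J * J))) := by
        have e4 : Real.sqrt (n / (t * (J * J))) =
            Real.exp (Real.log (n / (t * (J * J))) / 2) := by
          rw [← Real.log_sqrt (by positivity), Real.exp_log (by positivity)]
        rw [e4, ← Real.exp_add]
        exact Real.exp_le_exp.2 (by linarith)
      have e5 : Real.sqrt (n / (t * (J * J))) ≤ 4 * (n / (t * (J * J))) := by
        refine Real.sqrt_le_iff.2 ⟨by positivity, ?_⟩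
        have : 1 / 16 ≤ n / (t * (J * J)) := by
          rw [div_le_div_iff₀ (by norm_num) hτ]; linarith
        nlinarith
      calc _ ≤ _ := e3
        _ ≤ 2 * (4 * (n / (t * (J * J)))) := by gcongr
        _ = _ := by ring
    refine fin 32 T3 (by norm_num) le_rfl hT3 (by linarith) T4 hT4 (by linarith) ?_
    calc e * (I * J) ≤ (4 * (δ ^ 2 * s * t / n) * (8 * (n / (t * (J * J)))) + 4 * C₂ * t)
          * (I * J) := by
          refine mul_le_mul_of_nonneg_right ((h2 htp).trans ?_) hIJ.le
          gcongr
      _ = δ * (32 * T3 + 4 * C₂ * T4) := by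
          rw [add_mul, hY4, mul_add]
          congr 1
          rw [hT3d, if_pos h3]; field_simp; ring
      _ ≤ _ := by
          have : 0 ≤ C₁ * T3 := by positivity
          gcongr; linarith
  · rw [not_le] at hB
    have hnt : n / t ≤ (J * J) ^ 2 := by
      rw [div_le_iff₀ htp]; nlinarith
    -- Now `n / t < J⁴`. For `I ≤ δ` the untilted bound `h1` is used with `log (n/t) ≲ J`; for `I >
    -- δ` the tilted bound `h2`, whose tilt factor is at most `2 J`.
    by_cases hD : I ≤ δ
    · refine fin 3 T1 (by norm_num) (by norm_num) hT1 (by linarith) T5 hT5 (by linarith) ?_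
      have e1 : 1 + Real.log (n / t) ≤ 4 * J := by
        have := (Real.log_le_log (by positivity) hnt).trans hlogJ
        linarith
      calc e * (I * J) ≤ (3 * (δ ^ 2 * s * t / n) + C₂ * t * (4 * J)) * (I * J) := by
            refine mul_le_mul_of_nonneg_right ((h1 htp).trans ?_) hIJ.le
            gcongr
        _ = 3 * (δ ^ 2 * s * t / n) * (I * J) + δ * (4 * C₂ * T5) := by
            rw [add_mul, hT5d, if_pos hD]
            congr 1
            field_simp
        _ ≤ 3 * (δ * T1) + δ * (4 * C₂ * T5) := by
            have e2 : δ ^ 2 * s * t / n * (I * J) ≤ δ * T1 :=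
              calc δ ^ 2 * s * t / n * (I * J) ≤ (δ * (J * I)) * s * t / n * (I * J) := by
                    rw [sq]; gcongr
                _ = δ * T1 := by rw [hT1d]; ring
            linarith
        _ ≤ _ := by
            have : 0 ≤ C₁ * T1 := by positivity
            rw [← mul_assoc, mul_comm 3 δ, mul_assoc, ← mul_add]
            gcongr; linarith
    · rw [not_le] at hD
      have hR : Real.exp ((1 + Real.log (n / t)) / 4) ≤ 2 * J := by
        have e1 : Real.log (n / t) ≤ 4 * Real.log J := by
          have := Real.log_le_log (by positivity) hnt
          rw [← sq, ← pow_mul, Real.log_pow] at this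
          push_cast at this
          linarith
        calc _ ≤ Real.exp (1 / 4 + Real.log J) := Real.exp_le_exp.2 (by linarith)
          _ = Real.exp (1 / 4) * J := by rw [Real.exp_add, Real.exp_log hJp]
          _ ≤ _ := by gcongr
      refine fin 8 T1 (by norm_num) (by norm_num) hT1 (by linarith) T4 hT4 (by linarith) ?_
      calc e * (I * J) ≤ (4 * (δ ^ 2 * s * t / n) * (2 * J) + 4 * C₂ * t) * (I * J) := by
            refine mul_le_mul_of_nonneg_right ((h2 htp).trans ?_) hIJ.le
            gcongr
        _ = 8 * (δ ^ 2 * s * t / n * (J * (I * J))) + δ * (4 * C₂ * T4) := by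
            rw [add_mul, hY4]; ring
        _ ≤ 8 * (δ * T1) + δ * (4 * C₂ * T4) := by
            have e2 : δ ^ 2 * s * t / n * (J * (I * J)) ≤ δ * T1 :=
              calc δ ^ 2 * s * t / n * (J * (I * J)) ≤ (δ * I) * s * t / n * (J * (I * J)) := by
                    rw [sq]; gcongr
                _ = δ * T1 := by rw [hT1d]; ring
            linarith
        _ ≤ _ := by
            have : 0 ≤ C₁ * T1 := by positivity
            rw [← mul_assoc, mul_comm 8 δ, mul_assoc, ← mul_add]
            gcongr; linarith

theorem heavy_levels_sum_le {n δ C₁ C₂ : ℝ} (N : ℕ) {s t : ℕ → ℝ} {e : ℕ → ℕ → ℝ} (hn : 0 < n)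
    (hδ : 0 < δ) (hC₁ : 0 ≤ C₁) (hC₂ : 0 ≤ C₂) (hs : ∀ i, 0 ≤ s i) (ht : ∀ j, 0 ≤ t j)
    (hsn : ∑ i ∈ Finset.range N, s i * 4 ^ i ≤ 16 * n)
    (htn : ∑ j ∈ Finset.range N, t j * 4 ^ j ≤ 16 * n)
    (h0 : ∀ i j, t j = 0 → e i j ≤ 0) (hdeg : ∀ i j, e i j ≤ C₁ * δ ^ 2 * s i)
    (h1 : ∀ i j, s i ≤ t j → 0 < t j →
      e i j ≤ 3 * (δ ^ 2 * s i * t j / n) + C₂ * t j * (1 + Real.log (n / t j)))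
    (h2 : ∀ i j, s i ≤ t j → 0 < t j →
      e i j ≤ 4 * (δ ^ 2 * s i * t j / n) * Real.exp ((1 + Real.log (n / t j)) / 4)
        + 4 * C₂ * t j) :
    ∑ i ∈ Finset.range N, ∑ j ∈ Finset.range N,
      (if δ ≤ 2 ^ j * 2 ^ i ∧ s i ≤ t j then e i j * (2 ^ i * 2 ^ j) else 0) ≤
      384 * (C₁ + 4 * C₂ + 32) * n * δ := by
  set σ : ℕ → ℝ := fun i => s i * 4 ^ i with hσ
  set τ : ℕ → ℝ := fun j => t j * 4 ^ j with hτ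
  have hσ0 : ∀ i, 0 ≤ σ i := fun i => mul_nonneg (hs i) (by positivity)
  have hτ0 : ∀ i, 0 ≤ τ i := fun i => mul_nonneg (ht i) (by positivity)
  have hpt : ∀ i ∈ Finset.range N, ∀ j ∈ Finset.range N,
      (if δ ≤ 2 ^ j * 2 ^ i ∧ s i ≤ t j then e i j * (2 ^ i * 2 ^ j) else 0) ≤
      (C₁ + 4 * C₂ + 32) * δ * (σ i * τ j / n
      + σ i * (if (2 : ℝ) ^ j ≤ 2 ^ i / δ then (2 : ℝ) ^ j else 0) * (δ / 2 ^ i)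
      + σ i * (if δ / 2 ^ i ≤ (2 : ℝ) ^ j then ((2 : ℝ) ^ j)⁻¹ else 0) * (δ / 2 ^ i)
      + τ j * (if (2 : ℝ) ^ i ≤ δ * 2 ^ j then (2 : ℝ) ^ i else 0) * (δ * 2 ^ j)⁻¹
      + τ j * (if (2 : ℝ) ^ i ≤ δ then (2 : ℝ) ^ i else 0) * δ⁻¹) := by
    intro i _ j hj
    by_cases h : δ ≤ 2 ^ j * 2 ^ i ∧ s i ≤ t j
    · rw [if_pos h]
      exact heavy_level_bound hn hδ hC₁ hC₂ (hs i) (ht j)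
        ((Finset.single_le_sum (fun j _ => hτ0 j) hj).trans htn) h.1 (h0 i j) (hdeg i j)
        (h1 i j h.2) (h2 i j h.2)
    · rw [if_neg h]
      have := hσ0 i
      have := hτ0 j
      refine mul_nonneg (by positivity) ?_
      refine add_nonneg (add_nonneg (add_nonneg (add_nonneg ?_ ?_) ?_) ?_) ?_ <;>
        positivity
  refine (Finset.sum_le_sum fun i hi => Finset.sum_le_sum fun j hj => hpt i hi j hj).trans ?_
  simp only [← Finset.mul_sum]
  -- The first term factorises and gives `16² n`. In each of the other four, the geometric sum over
  -- the free index cancels the last factor up to `2` and leaves `32 n`; in total `256 + 4 * 32 =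
  -- 384`.
  have hsum : ∑ i ∈ Finset.range N, ∑ j ∈ Finset.range N, (σ i * τ j / n
      + σ i * (if (2 : ℝ) ^ j ≤ 2 ^ i / δ then (2 : ℝ) ^ j else 0) * (δ / 2 ^ i)
      + σ i * (if δ / 2 ^ i ≤ (2 : ℝ) ^ j then ((2 : ℝ) ^ j)⁻¹ else 0) * (δ / 2 ^ i)
      + τ j * (if (2 : ℝ) ^ i ≤ δ * 2 ^ j then (2 : ℝ) ^ i else 0) * (δ * 2 ^ j)⁻¹
      + τ j * (if (2 : ℝ) ^ i ≤ δ then (2 : ℝ) ^ i else 0) * δ⁻¹) ≤ 384 * n := by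
    simp only [Finset.sum_add_distrib]
    have b1 : ∑ i ∈ Finset.range N, ∑ j ∈ Finset.range N, σ i * τ j / n ≤ 256 * n := by
      simp only [← Finset.sum_div]
      rw [← Finset.sum_mul_sum, div_le_iff₀ hn]
      calc _ ≤ (16 * n) * (16 * n) := mul_le_mul hsn htn
            (Finset.sum_nonneg fun j _ => hτ0 j) (by positivity)
        _ = _ := by ring
    have b2 : ∑ i ∈ Finset.range N, ∑ j ∈ Finset.range N,
        σ i * (if (2 : ℝ) ^ j ≤ 2 ^ i / δ then (2 : ℝ) ^ j else 0) * (δ / 2 ^ i) ≤ 32 * n := by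
      calc _ ≤ ∑ i ∈ Finset.range N, σ i * 2 := by
            refine Finset.sum_le_sum fun i _ => ?_
            rw [← Finset.sum_mul, ← Finset.mul_sum, mul_assoc]
            refine mul_le_mul_of_nonneg_left ?_ (hσ0 i)
            calc _ ≤ 2 * (2 ^ i / δ) * (δ / 2 ^ i) := by
                  gcongr; exact sum_two_pow_le N (by positivity)
              _ = 2 := by field_simp
        _ ≤ _ := by rw [← Finset.sum_mul]; linarith
    have b3 : ∑ i ∈ Finset.range N, ∑ j ∈ Finset.range N,
        σ i * (if δ / 2 ^ i ≤ (2 : ℝ) ^ j then ((2 : ℝ) ^ j)⁻¹ else 0) * (δ / 2 ^ i)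
          ≤ 32 * n := by
      calc _ ≤ ∑ i ∈ Finset.range N, σ i * 2 := by
            refine Finset.sum_le_sum fun i _ => ?_
            rw [← Finset.sum_mul, ← Finset.mul_sum, mul_assoc]
            refine mul_le_mul_of_nonneg_left ?_ (hσ0 i)
            calc _ ≤ 2 / (δ / 2 ^ i) * (δ / 2 ^ i) := by
                  gcongr; exact sum_two_pow_inv_le N (by positivity)
              _ = 2 := by field_simp
        _ ≤ _ := by rw [← Finset.sum_mul]; linarith
    have b4 : ∑ i ∈ Finset.range N, ∑ j ∈ Finset.range N,
        τ j * (if (2 : ℝ) ^ i ≤ δ * 2 ^ j then (2 : ℝ) ^ i else 0) * (δ * 2 ^ j)⁻¹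
          ≤ 32 * n := by
      rw [Finset.sum_comm]
      calc _ ≤ ∑ j ∈ Finset.range N, τ j * 2 := by
            refine Finset.sum_le_sum fun j _ => ?_
            rw [← Finset.sum_mul, ← Finset.mul_sum, mul_assoc]
            refine mul_le_mul_of_nonneg_left ?_ (hτ0 j)
            calc _ ≤ 2 * (δ * 2 ^ j) * (δ * 2 ^ j)⁻¹ := by
                  gcongr; exact sum_two_pow_le N (by positivity)
              _ = 2 := by field_simp
        _ ≤ _ := by rw [← Finset.sum_mul]; linarith
    have b5 : ∑ i ∈ Finset.range N, ∑ j ∈ Finset.range N,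
        τ j * (if (2 : ℝ) ^ i ≤ δ then (2 : ℝ) ^ i else 0) * δ⁻¹ ≤ 32 * n := by
      rw [Finset.sum_comm]
      calc _ ≤ ∑ j ∈ Finset.range N, τ j * 2 := by
            refine Finset.sum_le_sum fun j _ => ?_
            rw [← Finset.sum_mul, ← Finset.mul_sum, mul_assoc]
            refine mul_le_mul_of_nonneg_left ?_ (hτ0 j)
            calc _ ≤ 2 * δ * δ⁻¹ := by
                  gcongr; exact sum_two_pow_le N hδ.le
              _ = 2 := by field_simp
        _ ≤ _ := by rw [← Finset.sum_mul]; linarith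
    linarith
  calc _ ≤ (C₁ + 4 * C₂ + 32) * δ * (384 * n) := mul_le_mul_of_nonneg_left hsum (by positivity)
    _ = _ := by ring

/-! ### Poisson domination and Chernoff bounds -/

/-- A random nonnegative matrix whose exponential moments are bounded by those of a matrix of
independent Poisson variables with means `m`. -/
structure PoissonDominated {n : ℕ} {Ω : Type*} [MeasurableSpace Ω] (ℙ : Measure Ω)
    (U : Ω → Matrix (Fin n) (Fin n) ℝ) (m : Matrix (Fin n) (Fin n) ℝ) : Prop where
  nonneg : ∀ ω a b, 0 ≤ U ω a b
  mean_nonneg : ∀ a b, 0 ≤ m a b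
  integrable : ∀ c : Matrix (Fin n) (Fin n) ℝ,
    Integrable (fun ω => Real.exp (∑ a, ∑ b, c a b * U ω a b)) ℙ
  mgf_le : ∀ c : Matrix (Fin n) (Fin n) ℝ,
    ∫ ω, Real.exp (∑ a, ∑ b, c a b * U ω a b) ∂ℙ ≤
      Real.exp (∑ a, ∑ b, m a b * (Real.exp (c a b) - 1))

theorem PoissonDominated.transpose {n : ℕ} {Ω : Type*} [MeasurableSpace Ω] {ℙ : Measure Ω}
    {U : Ω → Matrix (Fin n) (Fin n) ℝ} {m : Matrix (Fin n) (Fin n) ℝ} (h : PoissonDominated ℙ U m) :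
    PoissonDominated ℙ (fun ω => (U ω).transpose) m.transpose where
  nonneg ω a b := h.nonneg ω b a
  mean_nonneg a b := h.mean_nonneg b a
  integrable c := by
    have := h.integrable c.transpose
    simp only [Matrix.transpose_apply] at this ⊢
    refine this.congr (Filter.Eventually.of_forall fun ω => ?_)
    simp only
    rw [Finset.sum_comm]
  mgf_le c := by
    have := h.mgf_le c.transpose
    simp only [Matrix.transpose_apply] at this ⊢
    rw [Finset.sum_comm]
    refine le_trans (le_of_eq ?_) this
    congr 1
    ext ω
    rw [Finset.sum_comm]

theorem measureReal_exists_mem_le {Ω : Type*} [MeasurableSpace Ω] {ℙ : Measure Ω}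
    [IsFiniteMeasure ℙ] {β : Type*} (s : Finset β)
    (p : β → Ω → Prop) {δ : ℝ} (h : ∀ i ∈ s, ℙ.real {ω | p i ω} ≤ δ) :
    ℙ.real {ω | ∃ i ∈ s, p i ω} ≤ s.card * δ := by
  have h1 : {ω | ∃ i ∈ s, p i ω} = ⋃ i ∈ s, {ω | p i ω} := by ext ω; simp
  rw [h1]
  refine (measureReal_biUnion_finset_le s _).trans ((Finset.sum_le_sum h).trans ?_)
  rw [Finset.sum_const, nsmul_eq_mul]

section tails

variable {n : ℕ} {Ω : Type*} [MeasurableSpace Ω] {ℙ : Measure Ω} [IsProbabilityMeasure ℙ]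
  {U : Ω → Matrix (Fin n) (Fin n) ℝ} {m : Matrix (Fin n) (Fin n) ℝ}

theorem PoissonDominated.chernoff (h : PoissonDominated ℙ U m) (c : Matrix (Fin n) (Fin n) ℝ)
    (s : ℝ) : ℙ.real {ω | s ≤ ∑ a, ∑ b, c a b * U ω a b} ≤
      Real.exp (-s + ∑ a, ∑ b, m a b * (Real.exp (c a b) - 1)) := by
  have h1 := ProbabilityTheory.measure_ge_le_exp_mul_mgf (μ := ℙ)
    (X := fun ω => ∑ a, ∑ b, c a b * U ω a b) s (t := 1) zero_le_one
    (by simpa using h.integrable c)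
  refine h1.trans ?_
  rw [Real.exp_add, neg_mul, one_mul]
  refine mul_le_mul_of_nonneg_left ?_ (Real.exp_pos _).le
  simpa [ProbabilityTheory.mgf] using h.mgf_le c

theorem exp_sub_one_le_add_sq {x : ℝ} (hx : |x| ≤ 1) : Real.exp x - 1 ≤ x + x ^ 2 := by
  have h := Real.abs_exp_sub_one_sub_id_le hx
  linarith [le_abs_self (Real.exp x - 1 - x)]

/-- For coefficients in `[-1, 1]` the Poisson exponent `exp x - 1` is at most `x + x²`: the linear
part is the mean, the quadratic part the variance. -/
theorem PoissonDominated.chernoff_centered (h : PoissonDominated ℙ U m)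
    (c : Matrix (Fin n) (Fin n) ℝ) (hc : ∀ a b, |c a b| ≤ 1) (s : ℝ) :
    ℙ.real {ω | s ≤ ∑ a, ∑ b, c a b * (U ω a b - m a b)} ≤
      Real.exp (-s + ∑ a, ∑ b, m a b * c a b ^ 2) := by
  have h1 := h.chernoff c (s + ∑ a, ∑ b, c a b * m a b)
  have h2 : {ω | s ≤ ∑ a, ∑ b, c a b * (U ω a b - m a b)} =
      {ω | s + ∑ a, ∑ b, c a b * m a b ≤ ∑ a, ∑ b, c a b * U ω a b} := by
    ext ω
    simp only [Set.mem_ofPred_eq, mul_sub, Finset.sum_sub_distrib, le_sub_iff_add_le]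
  rw [h2]
  refine h1.trans (Real.exp_le_exp.2 ?_)
  have h3 : ∑ a, ∑ b, m a b * (Real.exp (c a b) - 1) ≤
      ∑ a, ∑ b, (c a b * m a b + m a b * c a b ^ 2) := by
    refine Finset.sum_le_sum fun a _ => Finset.sum_le_sum fun b _ => ?_
    have := mul_le_mul_of_nonneg_left (exp_sub_one_le_add_sq (hc a b)) (h.mean_nonneg a b)
    linarith
  simp only [Finset.sum_add_distrib] at h3
  linarith

theorem natCast_mul_exp_le {n : ℕ} (hn : 0 < n) {a D : ℝ} (ha : 0 ≤ a) (hD : Real.log n ≤ D) :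
    (n : ℝ) * Real.exp (-((a + 1) * D)) ≤ (n : ℝ) ^ (-a) := by
  have hn' : (0 : ℝ) < n := by exact_mod_cast hn
  rw [Real.rpow_def_of_pos hn']
  nth_rewrite 1 [← Real.exp_log hn']
  rw [← Real.exp_add]
  exact Real.exp_le_exp.2 (by nlinarith)

theorem exp_neg_mul_le_rpow {n : ℕ} (hn : 0 < n) {a : ℝ} (ha : 0 ≤ a) :
    Real.exp (-(a * n)) ≤ (n : ℝ) ^ (-a) := by
  have hn' : (0 : ℝ) < n := by exact_mod_cast hn
  rw [Real.rpow_def_of_pos hn']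
  have := Real.log_le_sub_one_of_pos hn'
  exact Real.exp_le_exp.2 (by nlinarith)

/-- With high probability all row sums are of the order of their means. -/
theorem PoissonDominated.row_sum_tail (h : PoissonDominated ℙ U m) (hn : 0 < n) {a D : ℝ}
    (ha : 0 ≤ a) (hD : Real.log n ≤ D) (hm : ∀ i, ∑ b, m i b ≤ D) :
    ℙ.real {ω | ∃ i ∈ Finset.univ, (a + 3) * D ≤ ∑ b, U ω i b} ≤ (n : ℝ) ^ (-a) := by
  have hn1 : (1 : ℝ) ≤ n := by exact_mod_cast hn
  have hD0 : 0 ≤ D := (Real.log_nonneg hn1).trans hD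
  refine (measureReal_exists_mem_le _ _ (δ := Real.exp (-((a + 1) * D))) fun i _ => ?_).trans ?_
  · have h1 := h.chernoff (Matrix.of fun x _ => if x = i then 1 else 0) ((a + 3) * D)
    have h2 : ∀ ω, ∑ x, ∑ b, (Matrix.of fun x _ => if x = i then (1 : ℝ) else 0 :
        Matrix (Fin n) (Fin n) ℝ) x b * U ω x b = ∑ b, U ω i b := by
      intro ω
      rw [Finset.sum_eq_single i]
      · simp
      · intro x _ hx; simp [hx]
      · simp
    have h3 : ∑ x, ∑ b, m x b * (Real.exp ((Matrix.of fun x _ => if x = i then (1 : ℝ) else 0 :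
        Matrix (Fin n) (Fin n) ℝ) x b) - 1) = (∑ b, m i b) * (Real.exp 1 - 1) := by
      rw [Finset.sum_eq_single i, Finset.sum_mul]
      · simp
      · intro x _ hx; simp [hx]
      · simp
    simp only [h2, h3] at h1
    refine h1.trans (Real.exp_le_exp.2 ?_)
    have h4 : Real.exp 1 - 1 ≤ 2 := by linarith [Real.exp_one_lt_d9]
    have h5 : (∑ b, m i b) * (Real.exp 1 - 1) ≤ D * 2 :=
      mul_le_mul (hm i) h4 (by linarith [Real.add_one_le_exp (1 : ℝ)]) hD0
    linarith
  · rw [Finset.card_univ, Fintype.card_fin]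
    exact natCast_mul_exp_le hn ha hD

/-- Coefficients of the light part of the bilinear form at integer vectors. -/
noncomputable def lightCoeff {n : ℕ} (r : ℝ) (k l : Fin n → ℤ) : Matrix (Fin n) (Fin n) ℝ :=
  Matrix.of fun x y => if |(k x : ℝ) * l y| ≤ r then (k x : ℝ) * l y / r else 0

/-- The cutoff `r = 16 √(nq)` makes the coefficients at most one and the variance term at most `q
(16 n)² / r² = n`. The remaining exponent `(a + 36) n` beats the `exp (36 n)` pairs of net points.
-/
theorem PoissonDominated.light_tail (h : PoissonDominated ℙ U m) (hn : 0 < n) {a q : ℝ}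
    (ha : 0 ≤ a) (hq : 0 < q) (hm : ∀ x y, m x y ≤ q) :
    ℙ.real {ω | ∃ p ∈ intNet n ×ˢ intNet n, (a + 37) * n ≤ ∑ x, ∑ y,
      lightCoeff (16 * Real.sqrt (n * q)) p.1 p.2 x y * (U ω x y - m x y)} ≤ (n : ℝ) ^ (-a) := by
  have hn' : (0 : ℝ) < n := by exact_mod_cast hn
  have hr : 0 < 16 * Real.sqrt (n * q) := by positivity
  have hr2 : (16 * Real.sqrt (n * q)) ^ 2 = 256 * (n * q) := by
    rw [mul_pow, Real.sq_sqrt (by positivity)]; norm_num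
  set r := 16 * Real.sqrt (n * q) with hrdef
  refine (measureReal_exists_mem_le _ _ (δ := Real.exp (-((a + 36) * n))) fun p hp => ?_).trans ?_
  · rw [Finset.mem_product, mem_intNet, mem_intNet] at hp
    refine (h.chernoff_centered _ (fun x y => ?_) _).trans (Real.exp_le_exp.2 ?_)
    · simp only [lightCoeff, Matrix.of_apply]
      split_ifs with h1
      · rw [abs_div, abs_of_pos hr, div_le_one hr]; exact h1
      · simp
    · have h2 : ∑ x, ∑ y, m x y * lightCoeff r p.1 p.2 x y ^ 2 ≤
          ∑ x, ∑ y, (p.1 x : ℝ) ^ 2 * (p.2 y : ℝ) ^ 2 * (1 / (256 * n)) := by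
        refine Finset.sum_le_sum fun x _ => Finset.sum_le_sum fun y _ => ?_
        simp only [lightCoeff, Matrix.of_apply]
        split_ifs
        · rw [div_pow, hr2, mul_pow]
          calc _ ≤ q * ((p.1 x : ℝ) ^ 2 * (p.2 y : ℝ) ^ 2 / (256 * (n * q))) := by
                gcongr; exact hm x y
            _ = _ := by field_simp
        · rw [zero_pow two_ne_zero, mul_zero]; positivity
      simp only [← Finset.sum_mul, ← Finset.mul_sum] at h2
      have h3 : (∑ x, (p.1 x : ℝ) ^ 2) * (∑ y, (p.2 y : ℝ) ^ 2) * (1 / (256 * n)) ≤ n := by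
        calc _ ≤ (16 * n) * (16 * n) * (1 / (256 * n : ℝ)) := by
              gcongr
              · exact hp.1
              · exact hp.2
          _ = _ := by field_simp; norm_num
      linarith
  · rw [Finset.card_product, Nat.cast_mul]
    calc _ ≤ Real.exp (18 * n) * Real.exp (18 * n) * Real.exp (-((a + 36) * n)) := by
          have := card_intNet_le n
          gcongr
      _ = Real.exp (-(a * n)) := by rw [← Real.exp_add, ← Real.exp_add]; congr 1; ring
      _ ≤ _ := exp_neg_mul_le_rpow hn ha

/-- Dividing by `√D` bounds the coefficients by one and the variance term by `|k|² ≤ 16 n`; thus `34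
= 16 + 18`, with `18` for the net. -/
theorem PoissonDominated.row_form_tail (h : PoissonDominated ℙ U m) (hn : 0 < n) {a D : ℝ}
    (ha : 0 ≤ a) (hD : 0 < D) (hm : ∀ i, ∑ b, m i b ≤ D) :
    ℙ.real {ω | ∃ k ∈ (intNet n).filter (fun k => ∀ x, |(k x : ℝ)| ≤ Real.sqrt D),
      (a + 34) * n ≤ ∑ x, ∑ y, k x / Real.sqrt D * (U ω x y - m x y)} ≤ (n : ℝ) ^ (-a) := by
  have hs := Real.sqrt_pos.2 hD
  have hn' : (0 : ℝ) < n := by exact_mod_cast hn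
  refine (measureReal_exists_mem_le _ _ (δ := Real.exp (-((a + 18) * n))) fun k hk => ?_).trans ?_
  · rw [Finset.mem_filter, mem_intNet] at hk
    refine (h.chernoff_centered (Matrix.of fun x _ => k x / Real.sqrt D) (fun x y => ?_) _).trans
      (Real.exp_le_exp.2 ?_)
    · simp only [Matrix.of_apply]
      rw [abs_div, abs_of_pos hs, div_le_one hs]
      exact hk.2 x
    · have h2 : ∑ x, ∑ y, m x y * (Matrix.of fun x _ => k x / Real.sqrt D :
          Matrix (Fin n) (Fin n) ℝ) x y ^ 2 ≤ ∑ x, (k x : ℝ) ^ 2 := by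
        refine Finset.sum_le_sum fun x _ => ?_
        simp only [Matrix.of_apply]
        rw [← Finset.sum_mul, div_pow, Real.sq_sqrt hD.le]
        calc _ ≤ D * ((k x : ℝ) ^ 2 / D) := by gcongr; exact hm x
          _ = _ := by field_simp
      linarith [hk.1]
  · have h3 : (((intNet n).filter (fun k => ∀ x, |(k x : ℝ)| ≤ Real.sqrt D)).card : ℝ) ≤
        Real.exp (18 * n) :=
      le_trans (by exact_mod_cast Finset.card_filter_le _ _) (card_intNet_le n)
    calc _ ≤ Real.exp (18 * n) * Real.exp (-((a + 18) * n)) := by gcongr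
      _ = Real.exp (-(a * n)) := by rw [← Real.exp_add]; congr 1; ring
      _ ≤ _ := exp_neg_mul_le_rpow hn ha

/-- Sets of size at most `t`. -/
def smallSets (n t : ℕ) : Finset (Finset (Fin n)) := Finset.univ.filter fun S => S.card ≤ t

/-- Compare with the generating function of subsets: at `x = t / n ≤ 1` every set of size at most
`t` has weight at least `x ^ t`, and the total weight is `(1 + x) ^ n ≤ exp t`. -/
theorem card_smallSets_le {n t : ℕ} (ht : 0 < t) (htn : t ≤ n) :
    ((smallSets n t).card : ℝ) ≤ Real.exp (t * (1 + Real.log (n / t))) := by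
  have ht' : (0 : ℝ) < t := by exact_mod_cast ht
  have hn' : (0 : ℝ) < n := by exact_mod_cast ht.trans_le htn
  have htn' : (t : ℝ) ≤ n := by exact_mod_cast htn
  set x : ℝ := t / n with hx
  have hx0 : 0 < x := by positivity
  have hx1 : x ≤ 1 := (div_le_one hn').2 htn'
  have h1 : ((smallSets n t).card : ℝ) * x ^ t ≤ (x + 1) ^ n := by
    have h2 := Fintype.sum_pow_mul_eq_add_pow (Fin n) x 1
    rw [Fintype.card_fin] at h2
    rw [← h2, ← nsmul_eq_mul, ← Finset.sum_const]
    calc ∑ _S ∈ smallSets n t, x ^ t ≤ ∑ S ∈ smallSets n t, x ^ S.card * 1 ^ (n - S.card) := by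
          refine Finset.sum_le_sum fun S hS => ?_
          rw [one_pow, mul_one]
          exact pow_le_pow_of_le_one hx0.le hx1 (by simpa [smallSets] using hS)
      _ ≤ _ := Finset.sum_le_sum_of_subset_of_nonneg (Finset.subset_univ _)
          fun _ _ _ => by positivity
  have h3 : (x + 1) ^ n ≤ Real.exp t := by
    calc (x + 1) ^ n ≤ (Real.exp x) ^ n := by gcongr; exact Real.add_one_le_exp x
      _ = Real.exp t := by rw [← Real.exp_nat_mul]; congr 1; rw [hx]; field_simp
  have h4 : x ^ t = Real.exp (-(t * Real.log (n / t))) := by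
    rw [← Real.exp_log hx0, ← Real.exp_nat_mul, hx, ← inv_div, Real.log_inv]
    congr 1; ring
  have h5 := h1.trans h3
  rw [h4, ← le_div_iff₀ (Real.exp_pos _), ← Real.exp_sub] at h5
  refine h5.trans (le_of_eq ?_)
  congr 1; ring

/-- The entropy `t (1 + log (n/t))` is smallest at `t = 1`. This lets the union bound over `t` cost
only a factor `n`. -/
theorem one_add_log_le {n t : ℕ} (ht : 0 < t) (htn : t ≤ n) :
    1 + Real.log n ≤ t * (1 + Real.log (n / t)) := by
  have ht' : (1 : ℝ) ≤ t := by exact_mod_cast ht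
  have htn' : (t : ℝ) ≤ n := by exact_mod_cast htn
  have hn0 : (n : ℝ) ≠ 0 := by linarith
  rw [Real.log_div hn0 (by positivity)]
  have h1 := Real.log_le_sub_one_of_pos (by positivity : (0 : ℝ) < t)
  have h2 := Real.log_le_log (by positivity) htn'
  have h3 : (t - 1) * Real.log t ≤ (t - 1) * Real.log n :=
    mul_le_mul_of_nonneg_left h2 (by linarith)
  nlinarith

/-- Discrepancy tail bound: uniform control of the weight between two sets of vertices. -/
theorem PoissonDominated.discrepancy_tail (h : PoissonDominated ℙ U m) (hn : 0 < n) {a q : ℝ}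
    (ha : 0 ≤ a) (hm : ∀ x y, m x y ≤ q) (θ : ℕ → ℝ) :
    ℙ.real {ω | ∃ t ∈ Finset.Icc 1 n, ∃ p ∈ smallSets n t ×ˢ smallSets n t,
      q * p.1.card * p.2.card * Real.exp (θ t) + (a + 3) * (t * (1 + Real.log (n / t))) ≤
        θ t * ∑ x ∈ p.1, ∑ y ∈ p.2, U ω x y} ≤ (n : ℝ) ^ (-a) := by
  refine (measureReal_exists_mem_le _ _ (δ := Real.exp (-((a + 1) * Real.log n)))
    fun t ht => ?_).trans ?_
  · rw [Finset.mem_Icc] at ht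
    have hL := one_add_log_le ht.1 ht.2
    set L := (t : ℝ) * (1 + Real.log (n / t)) with hLdef
    refine (measureReal_exists_mem_le _ _ (δ := Real.exp (-((a + 3) * L))) fun p _ => ?_).trans ?_
    · have h1 := h.chernoff (Matrix.of fun x y => if x ∈ p.1 ∧ y ∈ p.2 then θ t else 0)
        (q * p.1.card * p.2.card * Real.exp (θ t) + (a + 3) * L)
      have h2 : ∀ ω, ∑ x, ∑ y, (Matrix.of fun x y => if x ∈ p.1 ∧ y ∈ p.2 then θ t else 0 :
          Matrix (Fin n) (Fin n) ℝ) x y * U ω x y = θ t * ∑ x ∈ p.1, ∑ y ∈ p.2, U ω x y := by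
        intro ω
        simp only [Matrix.of_apply, ite_and, ite_mul, zero_mul, Finset.mul_sum]
        simp
      have h3 : ∑ x, ∑ y, m x y * (Real.exp ((Matrix.of fun x y =>
          if x ∈ p.1 ∧ y ∈ p.2 then θ t else 0 : Matrix (Fin n) (Fin n) ℝ) x y) - 1) =
          ∑ x ∈ p.1, ∑ y ∈ p.2, m x y * (Real.exp (θ t) - 1) := by
        have : ∀ x y, m x y * (Real.exp ((Matrix.of fun x y =>
          if x ∈ p.1 ∧ y ∈ p.2 then θ t else 0 : Matrix (Fin n) (Fin n) ℝ) x y) - 1) =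
          if x ∈ p.1 then (if y ∈ p.2 then m x y * (Real.exp (θ t) - 1) else 0) else 0 := by
          intro x y
          simp only [Matrix.of_apply, ite_and]
          split_ifs <;> simp
        simp only [this]
        simp
      simp only [h2, h3] at h1
      refine h1.trans (Real.exp_le_exp.2 ?_)
      have h4 : ∑ x ∈ p.1, ∑ y ∈ p.2, m x y * (Real.exp (θ t) - 1) ≤
          ∑ x ∈ p.1, ∑ y ∈ p.2, q * Real.exp (θ t) := by
        refine Finset.sum_le_sum fun x _ => Finset.sum_le_sum fun y _ => ?_
        have e1 := hm x y
        have e2 := h.mean_nonneg x y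
        have e3 := Real.exp_pos (θ t)
        nlinarith
      simp only [Finset.sum_const, nsmul_eq_mul] at h4
      linarith
    · rw [Finset.card_product, Nat.cast_mul]
      have h5 := card_smallSets_le ht.1 ht.2
      -- The two sets consume `2 L` of the exponent `(a + 3) L`; the rest exceeds `(a + 1) log n`.
      calc _ ≤ Real.exp L * Real.exp L * Real.exp (-((a + 3) * L)) := by gcongr
        _ = Real.exp (-((a + 1) * L)) := by
            rw [← Real.exp_add, ← Real.exp_add]; congr 1; ring
        _ ≤ _ := Real.exp_le_exp.2 (by nlinarith)
  · rw [Nat.card_Icc, Nat.add_sub_cancel]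
    exact natCast_mul_exp_le hn ha le_rfl

end tails

/-! ### Heavy pairs: level sets, row sums and discrepancy -/

/-- Vertices whose coefficient has absolute value in `[2 ^ i, 2 ^ (i + 1))`. -/
def levelSet {n : ℕ} (k : Fin n → ℤ) (i : ℕ) : Finset (Fin n) :=
  Finset.univ.filter fun x => k x ≠ 0 ∧ Nat.log 2 (k x).natAbs = i

theorem two_pow_log_le {k : ℤ} (hk : k ≠ 0) : (2 : ℝ) ^ Nat.log 2 k.natAbs ≤ |(k : ℝ)| := by
  have h := Nat.pow_log_le_self 2 (Int.natAbs_ne_zero.2 hk)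
  have h2 : ((2 ^ Nat.log 2 k.natAbs : ℕ) : ℝ) ≤ (k.natAbs : ℝ) := by exact_mod_cast h
  rwa [Nat.cast_natAbs, Int.cast_abs, Nat.cast_pow] at h2

theorem abs_lt_two_pow_log (k : ℤ) : |(k : ℝ)| < 2 * (2 : ℝ) ^ Nat.log 2 k.natAbs := by
  have h := Nat.lt_pow_succ_log_self (b := 2) one_lt_two k.natAbs
  have h2 : (k.natAbs : ℝ) < ((2 ^ (Nat.log 2 k.natAbs).succ : ℕ) : ℝ) := by exact_mod_cast h
  rw [Nat.cast_natAbs, Int.cast_abs, Nat.cast_pow, pow_succ] at h2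
  push_cast at h2
  linarith

theorem sum_levelSet {n : ℕ} {k : Fin n → ℤ} {N : ℕ} (hN : ∀ x, Nat.log 2 (k x).natAbs < N)
    (g : Fin n → ℝ) (f : ℕ → ℝ) :
    ∑ x, (if k x ≠ 0 then f (Nat.log 2 (k x).natAbs) * g x else 0) =
      ∑ i ∈ Finset.range N, f i * ∑ x ∈ levelSet k i, g x := by
  have h1 : ∀ x, (if k x ≠ 0 then f (Nat.log 2 (k x).natAbs) * g x else 0) =
      ∑ i ∈ Finset.range N, if k x ≠ 0 ∧ Nat.log 2 (k x).natAbs = i then f i * g x else 0 := by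
    intro x
    by_cases hx : k x ≠ 0
    · simp only [hx, ne_eq, not_false_eq_true, true_and, if_true]
      rw [Finset.sum_ite_eq, if_pos (Finset.mem_range.2 (hN x))]
    · simp [hx]
  simp only [h1]
  rw [Finset.sum_comm]
  refine Finset.sum_congr rfl fun i _ => ?_
  rw [levelSet, Finset.mul_sum, Finset.sum_filter]

theorem log_natAbs_lt {n : ℕ} {k : Fin n → ℤ} (hk : k ∈ intNet n) (x : Fin n) :
    Nat.log 2 (k x).natAbs < 4 * n + 1 := by
  rw [intNet, Finset.mem_filter, Fintype.mem_piFinset] at hk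
  have h := Finset.mem_Icc.1 (hk.1 x)
  have h2 : (k x).natAbs ≤ 4 * n := by omega
  have h3 := Nat.log_le_self 2 (k x).natAbs
  omega

theorem sum_card_levelSet_le {n : ℕ} {k : Fin n → ℤ} (hk : k ∈ intNet n) :
    ∑ i ∈ Finset.range (4 * n + 1), ((levelSet k i).card : ℝ) * 4 ^ i ≤ 16 * n := by
  have h := sum_levelSet (log_natAbs_lt hk) (fun _ => 1) (fun i => (4 : ℝ) ^ i)
  simp only [Finset.sum_const, nsmul_eq_mul, mul_one] at h
  have h2 : ∑ i ∈ Finset.range (4 * n + 1), ((levelSet k i).card : ℝ) * 4 ^ i =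
      ∑ i ∈ Finset.range (4 * n + 1), 4 ^ i * ((levelSet k i).card : ℝ) :=
    Finset.sum_congr rfl fun i _ => mul_comm _ _
  rw [h2, ← h]
  rw [mem_intNet] at hk
  refine le_trans (Finset.sum_le_sum fun x _ => ?_) hk
  split_ifs with hx
  · rw [← sq_abs (k x : ℝ), show (4 : ℝ) = 2 ^ 2 by norm_num, ← pow_mul, mul_comm 2, pow_mul]
    exact pow_le_pow_left₀ (by positivity) (two_pow_log_le hx) 2
  · positivity

/-- Heavy part of the bilinear form of a nonnegative matrix at integer vectors. -/
noncomputable def heavySum {n : ℕ} (U : Matrix (Fin n) (Fin n) ℝ) (r : ℝ) (k l : Fin n → ℤ) : ℝ :=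
  ∑ x, ∑ y, if r < |(k x : ℝ) * l y| then U x y * |(k x : ℝ) * l y| else 0

/-- On a pair of levels, `|k x * l y|` is at most `4 * 2 ^ i * 2 ^ j`. This accounts for the factor
`4` and shows that a pair above `16 δ` lies on levels with product above `δ`. -/
theorem heavySum_le_levels {n : ℕ} {U : Matrix (Fin n) (Fin n) ℝ} {δ : ℝ}
    (hU : ∀ x y, 0 ≤ U x y) {k l : Fin n → ℤ} (hk : k ∈ intNet n)
    (hl : l ∈ intNet n) (hδ : 0 ≤ δ) :
    heavySum U (16 * δ) k l ≤ 4 * ∑ i ∈ Finset.range (4 * n + 1), ∑ j ∈ Finset.range (4 * n + 1),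
      if δ ≤ 2 ^ j * 2 ^ i then (∑ x ∈ levelSet k i, ∑ y ∈ levelSet l j, U x y) * (2 ^ i * 2 ^ j)
      else 0 := by
  set F : ℕ → ℕ → ℝ := fun i j => if δ ≤ 2 ^ j * 2 ^ i then (2 : ℝ) ^ i * 2 ^ j else 0 with hF
  have h1 : heavySum U (16 * δ) k l ≤ 4 * ∑ x, if k x ≠ 0 then
      (∑ y, if l y ≠ 0 then F (Nat.log 2 (k x).natAbs) (Nat.log 2 (l y).natAbs) * U x y else 0)
      else 0 := by
    rw [heavySum, Finset.mul_sum]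
    refine Finset.sum_le_sum fun x _ => ?_
    by_cases hx : k x = 0
    · simp [hx, not_lt.2 (by positivity : 0 ≤ 16 * δ)]
    rw [if_pos hx, Finset.mul_sum]
    refine Finset.sum_le_sum fun y _ => ?_
    by_cases hy : l y = 0
    · simp [hy, not_lt.2 (by positivity : 0 ≤ 16 * δ)]
    rw [if_pos hy]
    have e1 := abs_lt_two_pow_log (k x)
    have e2 := abs_lt_two_pow_log (l y)
    set I : ℝ := 2 ^ Nat.log 2 (k x).natAbs with hI
    set J : ℝ := 2 ^ Nat.log 2 (l y).natAbs with hJ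
    have e3 : |(k x : ℝ) * l y| ≤ 4 * (I * J) := by
      rw [abs_mul]
      calc _ ≤ (2 * I) * (2 * J) := mul_le_mul e1.le e2.le (abs_nonneg _) (by positivity)
        _ = _ := by ring
    split_ifs with h
    · have e4 : δ ≤ J * I := by
        have := mul_pos (show 0 < I by positivity) (show 0 < J by positivity)
        nlinarith
      simp only [hF]
      rw [if_pos e4]
      calc _ ≤ U x y * (4 * (I * J)) := mul_le_mul_of_nonneg_left e3 (hU x y)
        _ = _ := by ring
    · have : 0 ≤ F (Nat.log 2 (k x).natAbs) (Nat.log 2 (l y).natAbs) := by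
        simp only [hF]; positivity
      have := hU x y
      positivity
  refine h1.trans (le_of_eq ?_)
  congr 1
  have h2 : ∀ x, (∑ y, if l y ≠ 0 then
      F (Nat.log 2 (k x).natAbs) (Nat.log 2 (l y).natAbs) * U x y else 0) =
      ∑ j ∈ Finset.range (4 * n + 1), F (Nat.log 2 (k x).natAbs) j * ∑ y ∈ levelSet l j, U x y :=
    fun x => sum_levelSet (log_natAbs_lt hl) (U x) (F (Nat.log 2 (k x).natAbs))
  simp only [h2]
  have h3 : ∀ x, (if k x ≠ 0 then ∑ j ∈ Finset.range (4 * n + 1),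
      F (Nat.log 2 (k x).natAbs) j * ∑ y ∈ levelSet l j, U x y else 0) =
      ∑ j ∈ Finset.range (4 * n + 1), if k x ≠ 0 then
        F (Nat.log 2 (k x).natAbs) j * ∑ y ∈ levelSet l j, U x y else 0 := by
    intro x
    split_ifs <;> simp
  simp only [h3]
  rw [Finset.sum_comm]
  have h4 : ∀ j, ∑ x, (if k x ≠ 0 then
        F (Nat.log 2 (k x).natAbs) j * ∑ y ∈ levelSet l j, U x y else 0) =
      ∑ i ∈ Finset.range (4 * n + 1), F i j * ∑ x ∈ levelSet k i, ∑ y ∈ levelSet l j, U x y :=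
    fun j => sum_levelSet (log_natAbs_lt hk) (fun x => ∑ y ∈ levelSet l j, U x y) (fun i => F i j)
  simp only [h4]
  rw [Finset.sum_comm]
  refine Finset.sum_congr rfl fun i _ => Finset.sum_congr rfl fun j _ => ?_
  simp only [hF]
  split_ifs
  · ring
  · ring

/-- Bounded row and column sums together with bounded discrepancy control the heavy part. -/
theorem heavySum_le {n : ℕ} {U : Matrix (Fin n) (Fin n) ℝ} {q C₁ C₂ : ℝ} (hn : 0 < n)
    (hq : 0 < q) (hC₁ : 0 ≤ C₁) (hC₂ : 0 ≤ C₂) (hU : ∀ x y, 0 ≤ U x y)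
    (hrow : ∀ x, ∑ y, U x y ≤ C₁ * (n * q)) (hcol : ∀ y, ∑ x, U x y ≤ C₁ * (n * q))
    (h1 : ∀ t ∈ Finset.Icc 1 n, ∀ S ∈ smallSets n t, ∀ T ∈ smallSets n t,
      ∑ x ∈ S, ∑ y ∈ T, U x y ≤ 3 * (q * S.card * T.card) +
        C₂ * (t * (1 + Real.log (n / t))))
    (h2 : ∀ t ∈ Finset.Icc 1 n, ∀ S ∈ smallSets n t, ∀ T ∈ smallSets n t,
      (1 + Real.log (n / t)) / 4 * ∑ x ∈ S, ∑ y ∈ T, U x y ≤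
        q * S.card * T.card * Real.exp ((1 + Real.log (n / t)) / 4) +
          C₂ * (t * (1 + Real.log (n / t))))
    {k l : Fin n → ℤ} (hk : k ∈ intNet n) (hl : l ∈ intNet n) :
    heavySum U (16 * Real.sqrt (n * q)) k l ≤
      3072 * (C₁ + 4 * C₂ + 32) * n * Real.sqrt (n * q) := by
  have hn' : (0 : ℝ) < n := by exact_mod_cast hn
  set δ := Real.sqrt (n * q) with hδ
  have hδ0 : 0 < δ := Real.sqrt_pos.2 (by positivity)
  have hδ2 : δ ^ 2 = n * q := Real.sq_sqrt (by positivity)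
  have hδq : ∀ s t : ℝ, δ ^ 2 * s * t / n = q * s * t := by
    intro s t; rw [hδ2]; field_simp
  refine (heavySum_le_levels hU hk hl hδ0.le).trans ?_
  set e : ℕ → ℕ → ℝ := fun i j => ∑ x ∈ levelSet k i, ∑ y ∈ levelSet l j, U x y with he
  have he0 : ∀ i j, 0 ≤ e i j := fun i j =>
    Finset.sum_nonneg fun x _ => Finset.sum_nonneg fun y _ => hU x y
  have key : ∀ S T : Finset (Fin n), ∀ t : ℕ, S.card ≤ t → T.card ≤ t → 0 < t → t ≤ n →
      ∑ x ∈ S, ∑ y ∈ T, U x y ≤ 3 * (q * S.card * T.card) + C₂ * t * (1 + Real.log (n / t)) ∧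
      ∑ x ∈ S, ∑ y ∈ T, U x y ≤
        4 * (q * S.card * T.card) * Real.exp ((1 + Real.log (n / t)) / 4) + 4 * C₂ * t := by
    intro S T t hS hT ht htn
    have m1 : t ∈ Finset.Icc 1 n := Finset.mem_Icc.2 ⟨ht, htn⟩
    have m2 : S ∈ smallSets n t := by simpa [smallSets] using hS
    have m3 : T ∈ smallSets n t := by simpa [smallSets] using hT
    have f1 := h1 t m1 S m2 T m3
    have f2 := h2 t m1 S m2 T m3
    refine ⟨by linarith, ?_⟩
    have ht' : (0 : ℝ) < t := by exact_mod_cast ht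
    have htn' : (t : ℝ) ≤ n := by exact_mod_cast htn
    have hL : 1 ≤ 1 + Real.log (n / t) := by
      linarith [Real.log_nonneg ((one_le_div ht').2 htn')]
    set L := 1 + Real.log (n / t)
    set W := ∑ x ∈ S, ∑ y ∈ T, U x y
    have hR : 0 ≤ q * S.card * T.card * Real.exp (L / 4) := by positivity
    -- Dividing the tilted discrepancy bound by `L / 4` removes the logarithm from the `C₂` term; in
    -- the other term `1 / L ≤ 1` suffices.
    have f3 : L * W ≤ L * (4 * (q * S.card * T.card) * Real.exp (L / 4) + 4 * C₂ * t) := by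
      nlinarith
    exact le_of_mul_le_mul_left f3 (by linarith)
  have hcardn : ∀ (k : Fin n → ℤ) i, (levelSet k i).card ≤ n := fun k i => by
    simpa using Finset.card_le_univ (levelSet k i)
  have A := heavy_levels_sum_le (n := n) (δ := δ) (C₁ := C₁) (C₂ := C₂) (4 * n + 1)
    (s := fun i => ((levelSet k i).card : ℝ)) (t := fun j => ((levelSet l j).card : ℝ)) (e := e)
    hn' hδ0 hC₁ hC₂ (fun i => by positivity) (fun i => by positivity)
    (sum_card_levelSet_le hk) (sum_card_levelSet_le hl)
    (fun i j hj => by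
      have : levelSet l j = ∅ := Finset.card_eq_zero.1 (by exact_mod_cast hj)
      simp [he, this])
    (fun i j => by
      calc e i j ≤ ∑ x ∈ levelSet k i, C₁ * (n * q) := by
            refine Finset.sum_le_sum fun x _ => le_trans ?_ (hrow x)
            exact Finset.sum_le_sum_of_subset_of_nonneg (Finset.subset_univ _)
              fun y _ _ => hU x y
        _ = _ := by rw [Finset.sum_const, nsmul_eq_mul, hδ2]; ring)
    (fun i j hs ht => by
      rw [hδq]
      exact (key _ _ _ (by exact_mod_cast hs) le_rfl (by exact_mod_cast ht) (hcardn _ _)).1)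
    (fun i j hs ht => by
      rw [hδq]
      exact (key _ _ _ (by exact_mod_cast hs) le_rfl (by exact_mod_cast ht) (hcardn _ _)).2)
  have B := heavy_levels_sum_le (n := n) (δ := δ) (C₁ := C₁) (C₂ := C₂) (4 * n + 1)
    (s := fun i => ((levelSet l i).card : ℝ)) (t := fun j => ((levelSet k j).card : ℝ))
    (e := fun i j => e j i)
    hn' hδ0 hC₁ hC₂ (fun i => by positivity) (fun i => by positivity)
    (sum_card_levelSet_le hl) (sum_card_levelSet_le hk)
    (fun i j hj => by
      have : levelSet k j = ∅ := Finset.card_eq_zero.1 (by exact_mod_cast hj)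
      simp [he, this])
    (fun i j => by
      calc e j i = ∑ y ∈ levelSet l i, ∑ x ∈ levelSet k j, U x y := Finset.sum_comm
        _ ≤ ∑ x ∈ levelSet l i, C₁ * (n * q) := by
            refine Finset.sum_le_sum fun x _ => le_trans ?_ (hcol x)
            exact Finset.sum_le_sum_of_subset_of_nonneg (Finset.subset_univ _)
              fun y _ _ => hU y x
        _ = _ := by rw [Finset.sum_const, nsmul_eq_mul, hδ2]; ring)
    (fun i j hs ht => by
      rw [hδq, mul_right_comm q]
      exact (key _ _ _ le_rfl (by exact_mod_cast hs) (by exact_mod_cast ht) (hcardn _ _)).1)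
    (fun i j hs ht => by
      rw [hδq, mul_right_comm q]
      exact (key _ _ _ le_rfl (by exact_mod_cast hs) (by exact_mod_cast ht) (hcardn _ _)).2)
  rw [Finset.sum_comm] at B
  -- The dyadic estimate assumes that the second level set is the larger one. The opposite case is
  -- the transposed estimate `B`, which uses column sums; hence `3072 = 4 * (384 + 384)`.
  have hsplit : ∑ i ∈ Finset.range (4 * n + 1), ∑ j ∈ Finset.range (4 * n + 1),
      (if δ ≤ 2 ^ j * 2 ^ i then e i j * (2 ^ i * 2 ^ j) else 0) ≤
      ∑ i ∈ Finset.range (4 * n + 1), ∑ j ∈ Finset.range (4 * n + 1),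
        (if δ ≤ 2 ^ j * 2 ^ i ∧ ((levelSet k i).card : ℝ) ≤ (levelSet l j).card
          then e i j * (2 ^ i * 2 ^ j) else 0) +
      ∑ i ∈ Finset.range (4 * n + 1), ∑ j ∈ Finset.range (4 * n + 1),
        (if δ ≤ 2 ^ i * 2 ^ j ∧ ((levelSet l j).card : ℝ) ≤ (levelSet k i).card
          then e i j * (2 ^ j * 2 ^ i) else 0) := by
    simp only [← Finset.sum_add_distrib]
    refine Finset.sum_le_sum fun i _ => Finset.sum_le_sum fun j _ => ?_
    have hp : 0 ≤ e i j * (2 ^ i * 2 ^ j) := mul_nonneg (he0 i j) (by positivity)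
    rw [mul_comm (2 ^ j) (2 ^ i)]
    by_cases hd : δ ≤ 2 ^ i * 2 ^ j
    · rcases le_total ((levelSet k i).card : ℝ) (levelSet l j).card with hc | hc
      · simp only [hd, hc, and_self, if_true, true_and]
        split_ifs <;> linarith
      · simp only [hd, hc, and_self, if_true, true_and]
        split_ifs <;> linarith
    · simp [hd]
  linarith

/-! ### Concentration of Poisson dominated matrices -/

section concentration

variable {n : ℕ} {Ω : Type*} [MeasurableSpace Ω] {ℙ : Measure Ω} [IsProbabilityMeasure ℙ]
  {U : Ω → Matrix (Fin n) (Fin n) ℝ} {m : Matrix (Fin n) (Fin n) ℝ}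

theorem specNorm_sub_le_of_light_heavy {n : ℕ} (hn : 0 < n) {U m : Matrix (Fin n) (Fin n) ℝ}
    {q c₁ c₂ : ℝ} (hq : 0 < q) (hc₁ : 0 ≤ c₁) (hc₂ : 0 ≤ c₂) (hU : ∀ x y, 0 ≤ U x y)
    (hm0 : ∀ x y, 0 ≤ m x y) (hm : ∀ x y, m x y ≤ q)
    (hlight : ∀ k ∈ intNet n, ∀ l ∈ intNet n,
      ∑ x, ∑ y, lightCoeff (16 * Real.sqrt (n * q)) k l x y * (U x y - m x y) ≤ c₁ * n)
    (hheavy : ∀ k ∈ intNet n, ∀ l ∈ intNet n,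
      heavySum U (16 * Real.sqrt (n * q)) k l ≤ 16 * c₂ * n * Real.sqrt (n * q)) :
    specNorm (U - m) ≤ 2 * ((c₁ + c₂ + 1) * Real.sqrt (n * q)) := by
  have hn' : (0 : ℝ) < n := by exact_mod_cast hn
  refine specNorm_le_of_intNet hn _ (by positivity) fun k hk l hl => ?_
  set δ := Real.sqrt (n * q) with hδ
  have hδ0 : 0 < δ := Real.sqrt_pos.2 (by positivity)
  have hδ2 : δ ^ 2 = n * q := Real.sq_sqrt (by positivity)
  have h1 : bilin (U - m) (fun a => (k a : ℝ)) (fun a => (l a : ℝ)) ≤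
      16 * δ * (∑ x, ∑ y, lightCoeff (16 * δ) k l x y * (U x y - m x y)) +
        heavySum U (16 * δ) k l +
          ∑ x, ∑ y, (k x : ℝ) ^ 2 * (l y : ℝ) ^ 2 * (q / (16 * δ)) := by
    rw [bilin, heavySum, Finset.mul_sum, ← Finset.sum_add_distrib, ← Finset.sum_add_distrib]
    refine Finset.sum_le_sum fun x _ => ?_
    rw [Finset.mul_sum, ← Finset.sum_add_distrib, ← Finset.sum_add_distrib]
    refine Finset.sum_le_sum fun y _ => ?_
    simp only [lightCoeff, Matrix.of_apply, Matrix.sub_apply]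
    rw [← mul_pow]
    set w := (k x : ℝ) * l y with hw
    have e0 := hU x y
    have e1 := hm0 x y
    have e2 := hm x y
    by_cases h : |w| ≤ 16 * δ
    · rw [if_pos h, if_neg (not_lt.2 h)]
      have : 16 * δ * (w / (16 * δ) * (U x y - m x y)) = (U x y - m x y) * w := by
        field_simp
      rw [this]
      have : 0 ≤ w ^ 2 * (q / (16 * δ)) := by positivity
      linarith
    · rw [if_neg h, if_pos (not_le.1 h)]
      rw [not_le] at h
      -- On heavy pairs `16 δ < |w|`, so the mean is not compared with `U`: its own contribution is
      -- at most `w² q / (16 δ)`, which sums to `16 n δ`.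
      have h2 : m x y * |w| ≤ w ^ 2 * (q / (16 * δ)) := by
        rw [← sq_abs w, mul_div_assoc', le_div_iff₀ (by positivity)]
        have := abs_nonneg w
        calc m x y * |w| * (16 * δ) ≤ q * |w| * |w| := by gcongr
          _ = _ := by ring
      have h3 : U x y * w ≤ U x y * |w| := mul_le_mul_of_nonneg_left (le_abs_self w) e0
      have h4 : -(m x y * w) ≤ m x y * |w| := by
        rw [← mul_neg]; exact mul_le_mul_of_nonneg_left (neg_le_abs w) e1
      rw [sub_mul]
      linarith
  simp only [← Finset.sum_mul, ← Finset.mul_sum] at h1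
  have h5 : (∑ x, (k x : ℝ) ^ 2) * (∑ y, (l y : ℝ) ^ 2) * (q / (16 * δ)) ≤ 16 * n * δ := by
    rw [mem_intNet] at hk hl
    calc _ ≤ (16 * n) * (16 * n) * (q / (16 * δ)) := by gcongr
      _ = 16 * n * (n * q) / δ := by field_simp
      _ = _ := by rw [← hδ2]; field_simp
  have h6 := mul_le_mul_of_nonneg_left (hlight k hk l hl) (by positivity : 0 ≤ 16 * δ)
  have h7 := hheavy k hk l hl
  calc _ ≤ _ := h1
    _ ≤ 16 * δ * (c₁ * n) + 16 * c₂ * n * δ + 16 * n * δ := by gcongr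
    _ = _ := by ring

/-- Spectral concentration without logarithmic loss. -/
theorem PoissonDominated.specNorm_tail (h : PoissonDominated ℙ U m) (hn : 0 < n) {a q : ℝ}
    (ha : 0 ≤ a) (hq : 0 < q) (hm : ∀ x y, m x y ≤ q) (hlog : Real.log n ≤ n * q) :
    ℙ.real {ω | ¬ specNorm (U ω - m) ≤
      2 * (((a + 37) + 192 * (5 * (a + 3) + 32) + 1) * Real.sqrt (n * q))} ≤
      5 * (n : ℝ) ^ (-a) := by
  have hrow : ∀ i, ∑ b, m i b ≤ n * q := fun i => by
    refine (Finset.sum_le_sum fun b _ => hm i b).trans (le_of_eq ?_)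
    simp
  have hcol : ∀ i, ∑ b, m.transpose i b ≤ n * q := fun i => by
    refine (Finset.sum_le_sum fun b _ => hm b i).trans (le_of_eq ?_)
    simp
  have p1 := h.row_sum_tail hn ha hlog hrow
  have p2 := h.transpose.row_sum_tail hn ha hlog hcol
  have p3 := h.light_tail hn ha hq hm
  have p4 := h.discrepancy_tail hn ha hm (fun _ => 1)
  have p5 := h.discrepancy_tail hn ha hm (fun t => (1 + Real.log (n / t)) / 4)
  set B1 := {ω | ∃ i ∈ Finset.univ, (a + 3) * (n * q) ≤ ∑ b, U ω i b}
  set B2 := {ω | ∃ i ∈ Finset.univ, (a + 3) * (n * q) ≤ ∑ b, (U ω).transpose i b}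
  set B3 := {ω | ∃ p ∈ intNet n ×ˢ intNet n, (a + 37) * n ≤ ∑ x, ∑ y,
      lightCoeff (16 * Real.sqrt (n * q)) p.1 p.2 x y * (U ω x y - m x y)}
  set B4 := {ω | ∃ t ∈ Finset.Icc 1 n, ∃ p ∈ smallSets n t ×ˢ smallSets n t,
      q * p.1.card * p.2.card * Real.exp 1 + (a + 3) * (t * (1 + Real.log (n / t))) ≤
        1 * ∑ x ∈ p.1, ∑ y ∈ p.2, U ω x y}
  set B5 := {ω | ∃ t ∈ Finset.Icc 1 n, ∃ p ∈ smallSets n t ×ˢ smallSets n t,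
      q * p.1.card * p.2.card * Real.exp ((1 + Real.log (n / t)) / 4) +
        (a + 3) * (t * (1 + Real.log (n / t))) ≤
        (1 + Real.log (n / t)) / 4 * ∑ x ∈ p.1, ∑ y ∈ p.2, U ω x y}
  have hsub : {ω | ¬ specNorm (U ω - m) ≤
      2 * (((a + 37) + 192 * (5 * (a + 3) + 32) + 1) * Real.sqrt (n * q))} ⊆
      B1 ∪ (B2 ∪ (B3 ∪ (B4 ∪ B5))) := by
    intro ω hω
    by_contra hc
    simp only [Set.mem_union, not_or] at hc
    obtain ⟨b1, b2, b3, b4, b5⟩ := hc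
    refine hω ?_
    refine specNorm_sub_le_of_light_heavy hn hq (by positivity) (by positivity) (h.nonneg ω)
      h.mean_nonneg hm ?_ ?_
    · intro k hk l hl
      by_contra hcon
      exact b3 ⟨(k, l), Finset.mem_product.2 ⟨hk, hl⟩, (not_le.1 hcon).le⟩
    · intro k hk l hl
      have := heavySum_le (U := U ω) (C₁ := a + 3) (C₂ := a + 3) hn hq (by positivity)
        (by positivity) (h.nonneg ω)
        (fun x => by
          by_contra hcon
          exact b1 ⟨x, Finset.mem_univ _, (not_le.1 hcon).le⟩)
        (fun x => by
          by_contra hcon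
          exact b2 ⟨x, Finset.mem_univ _, (not_le.1 hcon).le⟩)
        (fun t ht S hS T hT => by
          by_contra hcon
          refine b4 ⟨t, ht, (S, T), Finset.mem_product.2 ⟨hS, hT⟩, ?_⟩
          have e1 : q * S.card * T.card * Real.exp 1 ≤ q * S.card * T.card * 3 := by
            have := Real.exp_one_lt_d9
            gcongr
            linarith
          rw [one_mul]
          linarith [not_le.1 hcon])
        (fun t ht S hS T hT => by
          by_contra hcon
          exact b5 ⟨t, ht, (S, T), Finset.mem_product.2 ⟨hS, hT⟩, (not_le.1 hcon).le⟩) hk hl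
      refine this.trans (le_of_eq ?_)
      ring
  have u4 := measureReal_union_le (μ := ℙ) B4 B5
  have u3 := measureReal_union_le (μ := ℙ) B3 (B4 ∪ B5)
  have u2 := measureReal_union_le (μ := ℙ) B2 (B3 ∪ (B4 ∪ B5))
  have u1 := measureReal_union_le (μ := ℙ) B1 (B2 ∪ (B3 ∪ (B4 ∪ B5)))
  have := measureReal_mono (μ := ℙ) hsub
  linarith

/-- Concentration of the row sums in `ℓ²`. -/
theorem PoissonDominated.row_sq_tail (h : PoissonDominated ℙ U m) (hn : 0 < n) {a D : ℝ}
    (ha : 0 ≤ a) (hD0 : 0 < D) (hD : Real.log n ≤ D) (hm : ∀ i, ∑ b, m i b ≤ D) :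
    ℙ.real {ω | ¬ ∑ x, (∑ y, (U ω x y - m x y)) ^ 2 ≤ 16 * (a + 12) ^ 2 * (n * D)} ≤
      2 * (n : ℝ) ^ (-a) := by
  have p1 := h.row_sum_tail hn ha hD hm
  have p2 := h.row_form_tail hn ha hD0 hm
  set B1 := {ω | ∃ i ∈ Finset.univ, (a + 3) * D ≤ ∑ b, U ω i b}
  set B2 := {ω | ∃ k ∈ (intNet n).filter (fun k => ∀ x, |(k x : ℝ)| ≤ Real.sqrt D),
      (a + 34) * n ≤ ∑ x, ∑ y, k x / Real.sqrt D * (U ω x y - m x y)}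
  have hsub : {ω | ¬ ∑ x, (∑ y, (U ω x y - m x y)) ^ 2 ≤ 16 * (a + 12) ^ 2 * (n * D)} ⊆
      B1 ∪ B2 := by
    intro ω hω
    by_contra hc
    simp only [Set.mem_union, not_or] at hc
    obtain ⟨b1, b2⟩ := hc
    have hn' : (0 : ℝ) < n := by exact_mod_cast hn
    have hsn := Real.sqrt_pos.2 hn'
    have hsD := Real.sqrt_pos.2 hD0
    have hsn2 := Real.sq_sqrt hn'.le
    have hsD2 := Real.sq_sqrt hD0.le
    set Y : Fin n → ℝ := fun x => ∑ y, (U ω x y - m x y) with hY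
    -- A crude sup bound on the deviations. If their `ℓ²` norm is large, it makes the normalised
    -- vector flat enough for its integer approximation to have entries at most `√D`, as
    -- `row_form_tail` requires.
    have hYD : ∀ x, |Y x| ≤ (a + 3) * D := by
      intro x
      have e1 : ∑ b, U ω x b < (a + 3) * D := by
        by_contra hcon
        exact b1 ⟨x, Finset.mem_univ _, not_lt.1 hcon⟩
      have e2 := hm x
      have e3 : 0 ≤ ∑ b, U ω x b := Finset.sum_nonneg fun b _ => h.nonneg ω x b
      have e4 : 0 ≤ ∑ b, m x b := Finset.sum_nonneg fun b _ => h.mean_nonneg x b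
      simp only [hY, Finset.sum_sub_distrib]
      rw [abs_le]
      constructor <;> nlinarith
    have hlarge : 4 * (a + 12) * (Real.sqrt n * Real.sqrt D) < euclNorm Y := by
      refine not_le.1 fun hcon => hω ?_
      rw [euclNorm_le_iff _ (by positivity)] at hcon
      refine hcon.trans (le_of_eq ?_)
      rw [mul_pow, mul_pow, mul_pow, hsn2, hsD2]; ring
    have hYpos : 0 < euclNorm Y := lt_of_le_of_lt (by positivity) hlarge
    obtain ⟨k, hk, hk1, hk2⟩ := exists_mem_intNet_le_sum hn Y hYpos
    refine b2 ⟨k, Finset.mem_filter.2 ⟨hk, fun x => (hk1 x).trans ?_⟩, ?_⟩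
    · rw [mul_div_assoc', div_le_iff₀ hYpos]
      calc 4 * Real.sqrt n * |Y x| ≤ 4 * Real.sqrt n * ((a + 3) * D) := by
            gcongr; exact hYD x
        _ = Real.sqrt D * (4 * (a + 3) * (Real.sqrt n * Real.sqrt D)) := by
            linear_combination (-(4 * Real.sqrt n * (a + 3))) * hsD2
        _ ≤ Real.sqrt D * (4 * (a + 12) * (Real.sqrt n * Real.sqrt D)) := by
            gcongr; norm_num
        _ ≤ _ := by gcongr
    · have e1 : ∑ x, ∑ y, k x / Real.sqrt D * (U ω x y - m x y) =
          (∑ x, k x * Y x) / Real.sqrt D := by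
        rw [Finset.sum_div]
        refine Finset.sum_congr rfl fun x _ => ?_
        rw [← Finset.mul_sum]; ring
      rw [e1, le_div_iff₀ hsD]
      refine le_trans ?_ hk2
      calc (a + 34) * n * Real.sqrt D ≤ 3 * (4 * (a + 12)) * n * Real.sqrt D := by
            gcongr; linarith
        _ = 3 * Real.sqrt n * (4 * (a + 12) * (Real.sqrt n * Real.sqrt D)) := by
            linear_combination (-(12 * (a + 12) * Real.sqrt D)) * hsn2
        _ ≤ _ := by gcongr
  have u1 := measureReal_union_le (μ := ℙ) B1 B2
  have := measureReal_mono (μ := ℙ) hsub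
  linarith

/-- Lower tail of the sums of a row and the corresponding column. -/
theorem PoissonDominated.row_add_col_lower_tail (h : PoissonDominated ℙ U m) (hn : 0 < n)
    {a M : ℝ} (ha : 0 ≤ a) (hdiag : ∀ x, m x x = 0) (hM : 8 * (a + 1) * Real.log n ≤ M)
    (hm : ∀ x, M ≤ ∑ y, m x y + ∑ y, m y x) :
    ℙ.real {ω | ∃ x ∈ Finset.univ, ∑ y, U ω x y + ∑ y, U ω y x ≤ M / 2} ≤ (n : ℝ) ^ (-a) := by
  have hn1 : (1 : ℝ) ≤ n := by exact_mod_cast hn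
  have hM0 : 0 ≤ M := le_trans (by have := Real.log_nonneg hn1; positivity) hM
  refine (measureReal_exists_mem_le _ _ (δ := Real.exp (-((a + 1) * Real.log n)))
    fun x _ => ?_).trans ?_
  · set c : Matrix (Fin n) (Fin n) ℝ :=
      Matrix.of fun u v => -((if u = x then 1 else 0) + (if v = x then 1 else 0)) with hc
    have h1 := h.chernoff c (-(M / 2))
    have h2 : ∀ W : Matrix (Fin n) (Fin n) ℝ,
        ∑ u, ∑ v, c u v * W u v = -(∑ y, W x y + ∑ y, W y x) := by
      intro W
      have e : ∀ u v, c u v * W u v =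
          (if u = x then -W u v else 0) + (if v = x then -W u v else 0) := by
        intro u v
        simp only [hc, Matrix.of_apply]
        split_ifs <;> ring
      simp only [e, Finset.sum_add_distrib]
      have e2 : ∑ u, ∑ v, (if u = x then -W u v else 0) = -∑ y, W x y := by
        rw [Finset.sum_eq_single x]
        · simp
        · intro u _ hu; simp [hu]
        · simp
      rw [e2]
      simp only [Finset.sum_ite_eq', Finset.mem_univ, if_true, Finset.sum_neg_distrib]
      ring
    -- The coefficients are `0` or `-1` except for `-2` at `(x, x)`, where the mean vanishes; on
    -- `{0, -1}` the function `exp c - 1` is linear.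
    have h3 : ∑ u, ∑ v, m u v * (Real.exp (c u v) - 1) =
        (1 - Real.exp (-1)) * ∑ u, ∑ v, c u v * m u v := by
      rw [Finset.mul_sum]
      refine Finset.sum_congr rfl fun u _ => ?_
      rw [Finset.mul_sum]
      refine Finset.sum_congr rfl fun v _ => ?_
      simp only [hc, Matrix.of_apply]
      by_cases hu : u = x
      · by_cases hv : v = x
        · subst hu; subst hv; simp [hdiag]
        · simp [hu, hv]; ring
      · by_cases hv : v = x
        · simp [hu, hv]; ring
        · simp [hu, hv]
    rw [h3, h2] at h1
    simp only [h2] at h1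
    have h4 : {ω | ∑ y, U ω x y + ∑ y, U ω y x ≤ M / 2} =
        {ω | -(M / 2) ≤ -(∑ y, U ω x y + ∑ y, U ω y x)} := by
      ext ω; simp only [Set.mem_ofPred_eq, neg_le_neg_iff]
    rw [h4]
    refine h1.trans (Real.exp_le_exp.2 ?_)
    -- The exponent is at most `-(1/2 - 1/e) M`, and `1/2 - 1/e > 1/8` explains the `8` in `hM`.
    have h5 := Real.exp_neg_one_lt_d9
    have h6 := hm x
    nlinarith
  · rw [Finset.card_univ, Fintype.card_fin]
    exact natCast_mul_exp_le hn ha le_rfl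

end concentration

/-! ### Smoothing weights -/

/-- Here `κ` is a mean age, at most `(1 - b) / b`. For `b < 1` the lower bound gives `c₁ x ≤ b`, so
`κ x` is bounded. For `b = 1` there is no smoothing and `κ ≤ 0`, which is what covers large `x`; a
bound `κ ≤ 1 / b` would not. -/
theorem mul_sq_le_of_le_inv {c₁ x b κ : ℝ} (hc₁ : 0 < c₁) (hx : 0 ≤ x) (hb : 0 < b) (hb1 : b ≤ 1)
    (hxb : min 1 (c₁ * x) ≤ b) (hκ : κ * b ≤ 1 - b) :
    κ * x ^ 2 ≤ (min 1 c₁ ^ 2)⁻¹ * min 1 x := by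
  set c := min 1 c₁ with hc
  have hcp : 0 < c := lt_min one_pos hc₁
  have hc1 : c ≤ 1 := min_le_left _ _
  have hcc : c ≤ c₁ := min_le_right _ _
  have hrhs : 0 ≤ (c ^ 2)⁻¹ * min 1 x := mul_nonneg (by positivity) (le_min zero_le_one hx)
  rcases hb1.eq_or_lt with rfl | hb1
  · have : κ ≤ 0 := by linarith
    exact (mul_nonpos_of_nonpos_of_nonneg this (sq_nonneg x)).trans hrhs
  rcases le_or_gt κ 0 with hκ0 | hκ0
  · exact (mul_nonpos_of_nonpos_of_nonneg hκ0 (sq_nonneg x)).trans hrhs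
  have h1 : c₁ * x ≤ b := by
    rcases min_le_iff.1 hxb with h | h
    · linarith
    · exact h
  have h2 : c * x ≤ b := (mul_le_mul_of_nonneg_right hcc hx).trans h1
  have h3 : κ * x ^ 2 * c ≤ x := by
    calc κ * x ^ 2 * c = x * (κ * (c * x)) := by ring
      _ ≤ x * (κ * b) := by gcongr
      _ ≤ x * 1 := by gcongr; linarith
      _ = x := mul_one x
  rw [inv_mul_eq_div, le_div_iff₀ (by positivity)]
  refine le_min ?_ ?_
  · calc κ * x ^ 2 * c ^ 2 = c * (κ * x ^ 2 * c) := by ring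
      _ ≤ c * x := by gcongr
      _ ≤ 1 := by linarith
  · calc κ * x ^ 2 * c ^ 2 = c * (κ * x ^ 2 * c) := by ring
      _ ≤ c * x := by gcongr
      _ ≤ 1 * x := by gcongr
      _ = x := one_mul x

theorem sum_exp_weights (lam : ℝ) (t : ℕ) :
    ∑ k ∈ Finset.range t, lam * (1 - lam) ^ k + (1 - lam) ^ t = 1 := by
  induction t with
  | zero => simp
  | succ t ih => rw [Finset.sum_range_succ, pow_succ]; linarith

theorem sum_mul_exp_weights (lam : ℝ) (t : ℕ) :
    (∑ k ∈ Finset.range t, (k : ℝ) * (lam * (1 - lam) ^ k) + t * (1 - lam) ^ t) * lam =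
      (1 - lam) * (1 - (1 - lam) ^ t) := by
  induction t with
  | zero => simp
  | succ t ih =>
    rw [Finset.sum_range_succ, pow_succ]
    push_cast
    linear_combination ih

/-- Both smoothers are averages with weights `w`, bounded by `β ≤ c₂ ρ` and with controlled
mean age. -/
theorem IsSmoother.exists_weights {n : ℕ} {c₁ c₂ x : ℝ} {t : ℕ}
    {S : (ℕ → Matrix (Fin n) (Fin n) ℝ) → Matrix (Fin n) (Fin n) ℝ}
    (h : IsSmoother c₁ c₂ x t S) (hc₁ : 0 < c₁) (hx : 0 ≤ x) :
    ∃ (w : ℕ → ℝ) (β : ℝ), 0 < β ∧ β ≤ c₂ * min 1 x ∧ (∀ k, 0 ≤ w k) ∧ (∀ k, w k ≤ β) ∧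
      ∑ k ∈ Finset.range (t + 1), w k = 1 ∧
      (∀ M, S M = ∑ k ∈ Finset.range (t + 1), w k • M (t - k)) ∧
      (∑ k ∈ Finset.range (t + 1), w k * k) * x ^ 2 ≤ (min 1 c₁ ^ 2)⁻¹ * min 1 x := by
  rcases h with ⟨r, hr1, hrt, hlow, hup, rfl⟩ | ⟨lam, hl0, hl1, hlow, hup, rfl⟩
  · have hr : (1 : ℝ) ≤ r := by exact_mod_cast hr1
    have hr0 : (0 : ℝ) < r := by linarith
    have hsum : ∀ f : ℕ → ℝ, ∑ k ∈ Finset.range (t + 1), (if k < r then f k else 0) =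
        ∑ k ∈ Finset.range r, f k := by
      intro f
      rw [← Finset.sum_filter]
      congr 1
      ext k
      simp only [Finset.mem_filter, Finset.mem_range]
      omega
    refine ⟨fun k => if k < r then 1 / r else 0, 1 / r, by positivity, hup,
      fun k => by positivity, fun k => ?_, ?_, fun M => ?_, ?_⟩
    · dsimp only
      split_ifs
      · exact le_rfl
      · positivity
    · rw [hsum (fun _ => 1 / (r : ℝ))]
      simp [hr0.ne']
    · rw [unifSmooth, Finset.smul_sum]
      simp only [ite_smul, zero_smul]
      rw [← Finset.sum_filter]
      congr 1
      ext k
      simp only [Finset.mem_filter, Finset.mem_range]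
      omega
    · refine mul_sq_le_of_le_inv hc₁ hx (b := 1 / r) (by positivity)
        ((div_le_one hr0).2 hr) hlow ?_
      have h1 : ∀ k : ℕ, (if k < r then 1 / (r : ℝ) else 0) * k =
          if k < r then 1 / (r : ℝ) * k else 0 := fun k => by split_ifs <;> simp
      simp only [h1]
      rw [hsum (fun k => 1 / (r : ℝ) * k)]
      have h2 : ∑ k ∈ Finset.range r, 1 / (r : ℝ) * k ≤ ∑ _k ∈ Finset.range r, 1 / (r : ℝ) * (r - 1) := by
        refine Finset.sum_le_sum fun k hk => ?_
        have h3 : k + 1 ≤ r := Finset.mem_range.1 hk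
        have h4 : (k : ℝ) + 1 ≤ r := by exact_mod_cast h3
        gcongr
        linarith
      rw [Finset.sum_const, Finset.card_range, nsmul_eq_mul] at h2
      calc _ ≤ (r : ℝ) * (1 / (r : ℝ) * (r - 1)) * (1 / r) := by gcongr
        _ = _ := by field_simp
  · have h1l : 0 ≤ 1 - lam := by linarith
    have hw : ∀ f : ℕ → ℝ, ∑ k ∈ Finset.range (t + 1),
        (if k < t then lam * (1 - lam) ^ k else (1 - lam) ^ t) * f k =
        ∑ k ∈ Finset.range t, lam * (1 - lam) ^ k * f k + (1 - lam) ^ t * f t := by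
      intro f
      rw [Finset.sum_range_succ, if_neg (lt_irrefl t)]
      congr 1
      refine Finset.sum_congr rfl fun k hk => ?_
      rw [if_pos (Finset.mem_range.1 hk)]
    refine ⟨fun k => if k < t then lam * (1 - lam) ^ k else (1 - lam) ^ t, expMaxWeight lam t,
      lt_max_of_lt_left hl0, hup, fun k => by positivity, fun k => ?_, ?_, fun M => ?_, ?_⟩
    · dsimp only
      split_ifs
      · refine le_max_of_le_left ?_
        exact mul_le_of_le_one_right hl0.le (pow_le_one₀ h1l (by linarith))
      · exact le_max_right _ _
    · have := hw (fun _ => 1)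
      simp only [mul_one] at this
      rw [this, sum_exp_weights]
    · rw [expSmooth_eq_sum, Finset.sum_range_succ]
      simp only [lt_irrefl, if_false, Nat.sub_self]
      congr 1
      refine Finset.sum_congr rfl fun k hk => ?_
      rw [if_pos (Finset.mem_range.1 hk)]
    · refine mul_sq_le_of_le_inv hc₁ hx (b := lam) hl0 hl1 hlow ?_
      rw [hw (fun k => (k : ℝ))]
      have h2 := sum_mul_exp_weights lam t
      have h3 : ∑ k ∈ Finset.range t, lam * (1 - lam) ^ k * (k : ℝ) + (1 - lam) ^ t * t =
          ∑ k ∈ Finset.range t, (k : ℝ) * (lam * (1 - lam) ^ k) + t * (1 - lam) ^ t := by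
        congr 1
        · exact Finset.sum_congr rfl fun k _ => mul_comm _ _
        · exact mul_comm _ _
      rw [h3, h2]
      have : 0 ≤ (1 - lam) ^ t := by positivity
      nlinarith

/-! ### Deterministic bounds on the probability matrices -/

theorem baseMatrix_apply (K : ℕ) (τ : ℝ) (k l : Fin K) :
    baseMatrix K τ k l = if k = l then 1 else τ := by
  simp only [baseMatrix, Matrix.add_apply, Matrix.smul_apply, Matrix.of_apply, Matrix.one_apply,
    smul_eq_mul]
  split_ifs <;> ring

section base

variable {n K : ℕ} {τ α : ℝ}

theorem baseMatrix_nonneg (h0 : 0 ≤ τ) (k l : Fin K) : 0 ≤ baseMatrix K τ k l := by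
  rw [baseMatrix_apply]; positivity

theorem baseMatrix_le_one (h1 : τ ≤ 1) (k l : Fin K) : baseMatrix K τ k l ≤ 1 := by
  rw [baseMatrix_apply]; split_ifs
  · exact le_rfl
  · exact h1

theorem probMatrix_nonneg (h0 : 0 ≤ τ) (hα : 0 ≤ α) (z : Fin n → Fin K) (a b : Fin n) :
    0 ≤ probMatrix α (baseMatrix K τ) z a b :=
  mul_nonneg hα (baseMatrix_nonneg h0 _ _)

theorem probMatrix_le (h1 : τ ≤ 1) (hα : 0 ≤ α) (z : Fin n → Fin K) (a b : Fin n) :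
    probMatrix α (baseMatrix K τ) z a b ≤ α :=
  mul_le_of_le_one_right hα (baseMatrix_le_one h1 _ _)

theorem probMatrix_symm (z : Fin n → Fin K) (a b : Fin n) :
    probMatrix α (baseMatrix K τ) z b a = probMatrix α (baseMatrix K τ) z a b := by
  simp only [probMatrix, Matrix.of_apply, baseMatrix_apply, eq_comm]

theorem probMatrix_diag (z : Fin n → Fin K) (a : Fin n) :
    probMatrix α (baseMatrix K τ) z a a = α := by
  simp [probMatrix, baseMatrix_apply]

theorem degree_probMatrix (B : Matrix (Fin K) (Fin K) ℝ) (z : Fin n → Fin K) (a : Fin n) :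
    degree (probMatrix α B z) a = α * ∑ l, (commSize z l : ℝ) * B (z a) l := by
  simp only [degree, probMatrix, Matrix.of_apply, ← Finset.mul_sum]
  congr 1
  rw [← Finset.sum_fiberwise Finset.univ z]
  refine Finset.sum_congr rfl fun l _ => ?_
  rw [commSize, ← nsmul_eq_mul, ← Finset.sum_const]
  refine Finset.sum_congr rfl fun b hb => ?_
  rw [(Finset.mem_filter.1 hb).2]

theorem degreeProfiles_subset (h0 : 0 ≤ τ) (h1 : τ ≤ 1) {nmin nmax : ℕ} {y : ℝ}
    (hy : y ∈ degreeProfiles (baseMatrix K τ) n nmin nmax) : 0 ≤ y ∧ y ≤ n := by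
  obtain ⟨m, hm, k, rfl⟩ := hy
  refine ⟨Finset.sum_nonneg fun l _ => mul_nonneg (by positivity) (baseMatrix_nonneg h0 _ _), ?_⟩
  have h2 : ((∑ l, m l : ℕ) : ℝ) = n := by rw [hm.2]
  rw [← h2, Nat.cast_sum]
  exact Finset.sum_le_sum fun l _ =>
    mul_le_of_le_one_right (by positivity) (baseMatrix_le_one h1 _ _)

theorem degree_probMatrix_mem (h0 : 0 ≤ τ) (h1 : τ ≤ 1) (hα : 0 ≤ α) {nmin nmax : ℕ}
    {z : Fin n → Fin K} (hz : commSize z ∈ admissibleSizes n K nmin nmax) (a : Fin n) :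
    α * nbarMin (baseMatrix K τ) n nmin nmax ≤ degree (probMatrix α (baseMatrix K τ) z) a ∧
    degree (probMatrix α (baseMatrix K τ) z) a ≤ α * nbarMax (baseMatrix K τ) n nmin nmax := by
  rw [degree_probMatrix]
  have hmem : ∑ l, (commSize z l : ℝ) * baseMatrix K τ (z a) l ∈
      degreeProfiles (baseMatrix K τ) n nmin nmax := ⟨commSize z, hz, z a, rfl⟩
  constructor
  · refine mul_le_mul_of_nonneg_left (csInf_le ⟨0, fun y hy => ?_⟩ hmem) hα
    exact (degreeProfiles_subset h0 h1 hy).1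
  · refine mul_le_mul_of_nonneg_left (le_csSup ⟨n, fun y hy => ?_⟩ hmem) hα
    exact (degreeProfiles_subset h0 h1 hy).2

theorem le_degree_probMatrix (h0 : 0 ≤ τ) (hα : 0 ≤ α) (z : Fin n → Fin K) (a : Fin n) :
    α ≤ degree (probMatrix α (baseMatrix K τ) z) a := by
  have h : probMatrix α (baseMatrix K τ) z a a ≤ degree (probMatrix α (baseMatrix K τ) z) a :=
    Finset.single_le_sum (f := fun b => probMatrix α (baseMatrix K τ) z a b)
      (fun b _ => probMatrix_nonneg h0 hα z a b) (Finset.mem_univ a)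
  rwa [probMatrix_diag] at h

theorem degree_probMatrix_le (h1 : τ ≤ 1) (hα : 0 ≤ α) (z : Fin n → Fin K) (a : Fin n) :
    degree (probMatrix α (baseMatrix K τ) z) a ≤ n * α := by
  refine (Finset.sum_le_sum fun b _ => probMatrix_le h1 hα z a b).trans (le_of_eq ?_)
  simp

end base

/-! ### Bias caused by moving nodes -/

section change

variable {n : ℕ} {P Q : Matrix (Fin n) (Fin n) ℝ} {p G : ℝ} {D : Finset (Fin n)}

/-- Only rows and columns indexed by `D` change; each has `ℓ¹` difference at most `2 G`, and
symmetry identifies the two contributions. -/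
theorem sum_abs_sub_le (hP : ∀ a b, 0 ≤ P a b) (hQ : ∀ a b, 0 ≤ Q a b)
    (hPs : ∀ a b, P b a = P a b) (hQs : ∀ a b, Q b a = Q a b) (hdP : ∀ a, degree P a ≤ G)
    (hdQ : ∀ a, degree Q a ≤ G) (hD : ∀ a b, a ∉ D → b ∉ D → Q a b = P a b) :
    ∑ a, ∑ b, |Q a b - P a b| ≤ 4 * D.card * G := by
  have hrow : ∀ a, ∑ b, |Q a b - P a b| ≤ 2 * G := by
    intro a
    have : ∑ b, |Q a b - P a b| ≤ degree Q a + degree P a := by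
      rw [degree, degree, ← Finset.sum_add_distrib]
      refine Finset.sum_le_sum fun b _ => ?_
      rw [abs_le]; constructor <;> linarith [hP a b, hQ a b]
    linarith [hdP a, hdQ a]
  have hsum : ∑ a ∈ D, ∑ b, |Q a b - P a b| ≤ D.card * (2 * G) := by
    rw [← nsmul_eq_mul, ← Finset.sum_const]
    exact Finset.sum_le_sum fun a _ => hrow a
  have h1 : ∑ a, ∑ b, |Q a b - P a b| ≤ ∑ a, ∑ b, ((if a ∈ D then |Q a b - P a b| else 0) +
      if b ∈ D then |Q b a - P b a| else 0) := by
    refine Finset.sum_le_sum fun a _ => Finset.sum_le_sum fun b _ => ?_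
    rw [hQs a b, hPs a b]
    have := abs_nonneg (Q a b - P a b)
    by_cases ha : a ∈ D
    · rw [if_pos ha]; split_ifs <;> linarith
    · by_cases hb : b ∈ D
      · simp [ha, hb]
      · simp [hD a b ha hb, ha, hb]
  simp only [Finset.sum_add_distrib] at h1
  have h2 : ∑ a, ∑ b, (if a ∈ D then |Q a b - P a b| else 0) = ∑ a ∈ D, ∑ b, |Q a b - P a b| := by
    have : ∀ a, ∑ b, (if a ∈ D then |Q a b - P a b| else 0) =
        if a ∈ D then ∑ b, |Q a b - P a b| else 0 := fun a => by split_ifs <;> simp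
    simp only [this]
    simp
  have h3 : ∑ a, ∑ b, (if b ∈ D then |Q b a - P b a| else 0) =
      ∑ a ∈ D, ∑ b, |Q a b - P a b| := by rw [Finset.sum_comm]; exact h2
  linarith

theorem sum_sq_sub_le (hP : ∀ a b, 0 ≤ P a b) (hQ : ∀ a b, 0 ≤ Q a b)
    (hPs : ∀ a b, P b a = P a b) (hQs : ∀ a b, Q b a = Q a b) (hdP : ∀ a, degree P a ≤ G)
    (hdQ : ∀ a, degree Q a ≤ G) (hD : ∀ a b, a ∉ D → b ∉ D → Q a b = P a b)
    (hPp : ∀ a b, P a b ≤ p) (hQp : ∀ a b, Q a b ≤ p) (hp : 0 ≤ p) :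
    ∑ a, ∑ b, (Q a b - P a b) ^ 2 ≤ 4 * D.card * G * p := by
  have h1 : ∑ a, ∑ b, (Q a b - P a b) ^ 2 ≤ ∑ a, ∑ b, |Q a b - P a b| * p := by
    refine Finset.sum_le_sum fun a _ => Finset.sum_le_sum fun b _ => ?_
    rw [← sq_abs, sq]
    refine mul_le_mul_of_nonneg_left ?_ (abs_nonneg _)
    rw [abs_le]; constructor <;> linarith [hP a b, hQ a b, hPp a b, hQp a b]
  simp only [← Finset.sum_mul] at h1
  exact h1.trans (mul_le_mul_of_nonneg_right (sum_abs_sub_le hP hQ hPs hQs hdP hdQ hD) hp)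

/-- One factor of the square is bounded by `G`, the other by the `ℓ¹` difference of the row, so that
the bound is linear in the number of changed nodes. -/
theorem sum_sq_degree_sub_le (hP : ∀ a b, 0 ≤ P a b) (hQ : ∀ a b, 0 ≤ Q a b)
    (hPs : ∀ a b, P b a = P a b) (hQs : ∀ a b, Q b a = Q a b) (hdP : ∀ a, degree P a ≤ G)
    (hdQ : ∀ a, degree Q a ≤ G) (hD : ∀ a b, a ∉ D → b ∉ D → Q a b = P a b) (hG : 0 ≤ G) :
    ∑ a, (degree Q a - degree P a) ^ 2 ≤ 4 * D.card * G * G := by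
  have h1 : ∑ a, (degree Q a - degree P a) ^ 2 ≤ ∑ a, (∑ b, |Q a b - P a b|) * G := by
    refine Finset.sum_le_sum fun a _ => ?_
    have e1 : |degree Q a - degree P a| ≤ ∑ b, |Q a b - P a b| := by
      rw [degree, degree, ← Finset.sum_sub_distrib]
      exact Finset.abs_sum_le_sum_abs _ _
    have e2 : |degree Q a - degree P a| ≤ G := by
      have e3 : 0 ≤ degree P a := Finset.sum_nonneg fun b _ => hP a b
      have e4 : 0 ≤ degree Q a := Finset.sum_nonneg fun b _ => hQ a b
      rw [abs_le]; constructor <;> linarith [hdP a, hdQ a]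
    rw [← sq_abs, sq]
    exact mul_le_mul e1 e2 (abs_nonneg _) (Finset.sum_nonneg fun b _ => abs_nonneg _)
  rw [← Finset.sum_mul] at h1
  exact h1.trans (mul_le_mul_of_nonneg_right (sum_abs_sub_le hP hQ hPs hQs hdP hdQ hD) hG)

end change

/-- At most `k * s` nodes change community within `k` steps. -/
theorem IsRegularMembership.card_changed_le {n K t nmin nmax s : ℕ} {z : ℕ → Fin n → Fin K}
    (h : IsRegularMembership t nmin nmax s z) {k : ℕ} (hk : k ≤ t) :
    (Finset.univ.filter fun a => z (t - k) a ≠ z t a).card ≤ k * s := by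
  induction k with
  | zero => simp
  | succ k ih =>
    have h1 : (Finset.univ.filter fun a => z (t - (k + 1)) a ≠ z t a) ⊆
        (Finset.univ.filter fun a => z (t - (k + 1) + 1) a ≠ z (t - (k + 1)) a) ∪
          (Finset.univ.filter fun a => z (t - k) a ≠ z t a) := by
      intro a ha
      have e : t - (k + 1) + 1 = t - k := by omega
      simp only [Finset.mem_filter, Finset.mem_univ, true_and, Finset.mem_union, e] at ha ⊢
      by_contra hc
      push Not at hc
      exact ha (hc.1.symm.trans hc.2)
    have h2 := h.changes (t - (k + 1)) (by omega)
    have h3 := ih (by omega)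
    have h4 := (Finset.card_le_card h1).trans (Finset.card_union_le _ _)
    rw [add_mul, one_mul]
    omega

theorem sq_weighted_sum_sub_le {t : ℕ} {w : ℕ → ℝ} (hw0 : ∀ k, 0 ≤ w k)
    (hw1 : ∑ k ∈ Finset.range (t + 1), w k = 1) (f : ℕ → ℝ) (y : ℝ) :
    (∑ k ∈ Finset.range (t + 1), w k * f k - y) ^ 2 ≤
      ∑ k ∈ Finset.range (t + 1), w k * (f k - y) ^ 2 := by
  have h := Real.pow_arith_mean_le_arith_mean_pow_of_even (Finset.range (t + 1)) w
    (fun k => f k - y) (fun k _ => hw0 k) hw1 even_two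
  have e : ∑ k ∈ Finset.range (t + 1), w k * (f k - y) =
      ∑ k ∈ Finset.range (t + 1), w k * f k - y := by
    simp only [mul_sub, Finset.sum_sub_distrib, ← Finset.sum_mul, hw1, one_mul]
  rwa [e] at h

theorem sum_weighted_le {t : ℕ} {w : ℕ → ℝ} (hw0 : ∀ k, 0 ≤ w k) {f : ℕ → ℝ} {c : ℝ}
    (hf : ∀ k ≤ t, f k ≤ c * k) :
    ∑ k ∈ Finset.range (t + 1), w k * f k ≤ c * ∑ k ∈ Finset.range (t + 1), w k * k := by
  rw [Finset.mul_sum]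
  refine Finset.sum_le_sum fun k hk => ?_
  have := mul_le_mul_of_nonneg_left (hf k (Nat.lt_succ_iff.1 (Finset.mem_range.1 hk))) (hw0 k)
  linarith

/-- Smoothing bias of the probability matrices and of their degrees. -/
theorem IsRegularMembership.smoothing_bias {n K t nmin nmax s : ℕ} {τ α : ℝ}
    {z : ℕ → Fin n → Fin K} (h : IsRegularMembership t nmin nmax s z) (h0 : 0 ≤ τ) (h1 : τ ≤ 1)
    (hα : 0 < α) (hn : 0 < n) {w : ℕ → ℝ} (hw0 : ∀ k, 0 ≤ w k)
    (hw1 : ∑ k ∈ Finset.range (t + 1), w k = 1) :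
    let N := nbarMax (baseMatrix K τ) n nmin nmax
    let P := fun i => probMatrix α (baseMatrix K τ) (z i)
    let R := ∑ k ∈ Finset.range (t + 1), w k • P (t - k)
    let κ := ∑ k ∈ Finset.range (t + 1), w k * k
    ∑ a, ∑ b, (R a b - P t a b) ^ 2 ≤ 4 * s * (α * N) * α * κ ∧
      ∑ a, (degree R a - degree (P t) a) ^ 2 ≤ 4 * s * (α * N) * (α * N) * κ := by
  intro N P R κ
  have hdeg : ∀ i ≤ t, ∀ a, degree (P i) a ≤ α * N := fun i hi a =>
    (degree_probMatrix_mem h0 h1 hα.le (h.sizes i hi) a).2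
  have hG : 0 ≤ α * N :=
    le_trans (Finset.sum_nonneg fun b _ => probMatrix_nonneg h0 hα.le _ _ b) (hdeg t le_rfl ⟨0, hn⟩)
  have hch : ∀ k, ∀ a b, a ∉ (Finset.univ.filter fun a => z (t - k) a ≠ z t a) →
      b ∉ (Finset.univ.filter fun a => z (t - k) a ≠ z t a) → P (t - k) a b = P t a b := by
    intro k a b ha hb
    simp only [Finset.mem_filter, Finset.mem_univ, true_and, not_not] at ha hb
    simp only [P, probMatrix, Matrix.of_apply, ha, hb]
  have hcard : ∀ k ≤ t, ((Finset.univ.filter fun a => z (t - k) a ≠ z t a).card : ℝ) ≤ k * s :=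
    fun k hk => by exact_mod_cast h.card_changed_le hk
  have hR : ∀ a b, R a b = ∑ k ∈ Finset.range (t + 1), w k * P (t - k) a b := by
    intro a b
    simp only [R, Matrix.sum_apply, Matrix.smul_apply, smul_eq_mul]
  have hdR : ∀ a, degree R a = ∑ k ∈ Finset.range (t + 1), w k * degree (P (t - k)) a := by
    intro a
    simp only [degree, hR, Finset.mul_sum]
    rw [Finset.sum_comm]
  constructor
  · calc ∑ a, ∑ b, (R a b - P t a b) ^ 2
        ≤ ∑ a, ∑ b, ∑ k ∈ Finset.range (t + 1), w k * (P (t - k) a b - P t a b) ^ 2 := by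
          refine Finset.sum_le_sum fun a _ => Finset.sum_le_sum fun b _ => ?_
          rw [hR]
          exact sq_weighted_sum_sub_le hw0 hw1 _ _
      _ = ∑ k ∈ Finset.range (t + 1), w k * ∑ a, ∑ b, (P (t - k) a b - P t a b) ^ 2 := by
          simp only [Finset.mul_sum]
          rw [Finset.sum_comm]
          refine (Finset.sum_congr rfl fun b _ => Finset.sum_comm).trans ?_
          rw [Finset.sum_comm]
          refine Finset.sum_congr rfl fun b _ => Finset.sum_comm
      _ ≤ _ := by
          refine sum_weighted_le hw0 fun k hk => ?_
          have := sum_sq_sub_le (P := P t) (Q := P (t - k))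
            (fun a b => probMatrix_nonneg h0 hα.le _ a b)
            (fun a b => probMatrix_nonneg h0 hα.le _ a b) (fun a b => probMatrix_symm _ a b)
            (fun a b => probMatrix_symm _ a b) (hdeg t le_rfl) (hdeg (t - k) (Nat.sub_le _ _))
            (hch k) (fun a b => probMatrix_le h1 hα.le _ a b)
            (fun a b => probMatrix_le h1 hα.le _ a b) hα.le
          refine this.trans ?_
          calc _ ≤ 4 * (k * s) * (α * N) * α := by gcongr; exact hcard k hk
            _ = _ := by ring
  · calc ∑ a, (degree R a - degree (P t) a) ^ 2
        ≤ ∑ a, ∑ k ∈ Finset.range (t + 1), w k * (degree (P (t - k)) a - degree (P t) a) ^ 2 := by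
          refine Finset.sum_le_sum fun a _ => ?_
          rw [hdR]
          exact sq_weighted_sum_sub_le hw0 hw1 _ _
      _ = ∑ k ∈ Finset.range (t + 1), w k * ∑ a, (degree (P (t - k)) a - degree (P t) a) ^ 2 := by
          simp only [Finset.mul_sum]
          rw [Finset.sum_comm]
      _ ≤ _ := by
          refine sum_weighted_le hw0 fun k hk => ?_
          have := sum_sq_degree_sub_le (P := P t) (Q := P (t - k))
            (fun a b => probMatrix_nonneg h0 hα.le _ a b)
            (fun a b => probMatrix_nonneg h0 hα.le _ a b) (fun a b => probMatrix_symm _ a b)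
            (fun a b => probMatrix_symm _ a b) (hdeg t le_rfl) (hdeg (t - k) (Nat.sub_le _ _))
            (hch k) hG
          refine this.trans ?_
          calc _ ≤ 4 * (k * s) * (α * N) * (α * N) := by gcongr; exact hcard k hk
            _ = _ := by ring

/-! ### Averaged Bernoulli matrices are Poisson dominated -/

/-- Convexity of `exp` between `0` and `c`. This is what allows a Bernoulli variable scaled by a
weight in `[0, 1]` to be replaced by a Poisson variable with scaled mean. -/
theorem exp_mul_sub_one_le {c s : ℝ} (h0 : 0 ≤ s) (h1 : s ≤ 1) :
    Real.exp (c * s) - 1 ≤ s * (Real.exp c - 1) := by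
  have h := convexOn_exp.2 (Set.mem_univ c) (Set.mem_univ 0) h0 (sub_nonneg.2 h1)
    (add_sub_cancel s 1)
  simp only [smul_eq_mul, mul_zero, add_zero, Real.exp_zero, mul_one] at h
  rw [mul_comm c s]
  linarith

section bernoulli

variable {Ω : Type*} [MeasurableSpace Ω] {ℙ : Measure Ω} [IsProbabilityMeasure ℙ] {X : Ω → ℝ}

theorem exp_mul_eq_of_zero_or_one {Ω : Type*} {X : Ω → ℝ} (hX : ∀ ω, X ω = 0 ∨ X ω = 1) (g : ℝ)
    (ω : Ω) :
    Real.exp (g * X ω) = 1 + {ω | X ω = 1}.indicator (fun _ => Real.exp g - 1) ω := by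
  rcases hX ω with h | h
  · simp [Set.indicator, h]
  · simp [Set.indicator, h]

theorem integrable_exp_mul_of_zero_or_one (hm : Measurable X) (hX : ∀ ω, X ω = 0 ∨ X ω = 1)
    (g : ℝ) : Integrable (fun ω => Real.exp (g * X ω)) ℙ := by
  have hs : MeasurableSet {ω | X ω = 1} := hm (measurableSet_singleton 1)
  simp only [exp_mul_eq_of_zero_or_one hX]
  exact (integrable_const _).add ((integrable_const _).indicator hs)

theorem integral_exp_mul_of_zero_or_one (hm : Measurable X) (hX : ∀ ω, X ω = 0 ∨ X ω = 1)
    (g : ℝ) : ∫ ω, Real.exp (g * X ω) ∂ℙ = 1 + ℙ.real {ω | X ω = 1} * (Real.exp g - 1) := by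
  have hs : MeasurableSet {ω | X ω = 1} := hm (measurableSet_singleton 1)
  simp only [exp_mul_eq_of_zero_or_one hX]
  rw [integral_add (integrable_const _) ((integrable_const _).indicator hs),
    integral_indicator_const _ hs]
  simp

end bernoulli

/-- Part of a symmetric matrix above the diagonal, for the average with weights `v` of the
matrices `M t, M (t - 1), …, M 0`. -/
def upperAverage {n : ℕ} (t : ℕ) (v : ℕ → ℝ) (M : ℕ → Matrix (Fin n) (Fin n) ℝ) :
    Matrix (Fin n) (Fin n) ℝ :=
  Matrix.of fun a b => if a < b then ∑ k ∈ Finset.range (t + 1), v k * M (t - k) a b else 0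

theorem sum_upper_index {n t : ℕ}
    (f : Fin (t + 1) × Fin n × Fin n → ℝ) :
    ∑ p : {p : Fin (t + 1) × Fin n × Fin n // p.2.1 < p.2.2}, f p.1 =
      ∑ a, ∑ b, if a < b then ∑ k : Fin (t + 1), f (k, a, b) else 0 := by
  rw [← Finset.sum_subtype (Finset.univ.filter
    fun p : Fin (t + 1) × Fin n × Fin n => p.2.1 < p.2.2) (by simp) f, Finset.sum_filter]
  simp only [Fintype.sum_prod_type]
  rw [Finset.sum_comm]
  refine Finset.sum_congr rfl fun a _ => ?_
  rw [Finset.sum_comm]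
  refine Finset.sum_congr rfl fun b _ => ?_
  split_ifs <;> simp

/-- Weighted averages of the adjacency matrices are dominated by Poisson matrices. -/
theorem IsSBMSequence.poissonDominated {n K t : ℕ} {Ω : Type*} [MeasurableSpace Ω]
    {ℙ : Measure Ω} [IsProbabilityMeasure ℙ] {α : ℝ} {B : Matrix (Fin K) (Fin K) ℝ}
    {z : ℕ → Fin n → Fin K} {A : ℕ → Ω → Matrix (Fin n) (Fin n) ℝ}
    (h : IsSBMSequence ℙ t α B z A) (hP : ∀ i a b, 0 ≤ probMatrix α B (z i) a b)
    {v : ℕ → ℝ} (hv0 : ∀ k, 0 ≤ v k) (hv1 : ∀ k, v k ≤ 1) :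
    PoissonDominated ℙ (fun ω => upperAverage t v fun i => A i ω)
      (upperAverage t v fun i => probMatrix α B (z i)) := by
  let I := {p : Fin (t + 1) × Fin n × Fin n // p.2.1 < p.2.2}
  have hle : ∀ k : Fin (t + 1), t - (k : ℕ) ≤ t := fun k => Nat.sub_le _ _
  -- Ages `k ≤ t` are reindexed as times `t - k`. Truncated subtraction is injective on this range,
  -- so independence is inherited.
  let g : I → {e : ℕ × Fin n × Fin n // e.1 ≤ t ∧ e.2.1 < e.2.2} :=
    fun p => ⟨(t - (p.1.1 : ℕ), p.1.2), hle _, p.2⟩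
  have hg : Function.Injective g := by
    rintro ⟨⟨k, ab⟩, hp⟩ ⟨⟨k', ab'⟩, hp'⟩ he
    have h1 : t - (k : ℕ) = t - (k' : ℕ) := congrArg (fun e => e.1.1) he
    have h2 : ab = ab' := congrArg (fun e => e.1.2) he
    refine Subtype.ext (Prod.ext (Fin.ext ?_) h2)
    change (k : ℕ) = k'
    have := k.2
    have := k'.2
    omega
  have hind := h.indep.precomp hg
  have hA0 : ∀ i ≤ t, ∀ ω a b, 0 ≤ A i ω a b := fun i hi ω a b => by
    rcases h.zero_or_one i hi ω a b with h | h <;> simp [h]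
  have key : ∀ c : Matrix (Fin n) (Fin n) ℝ,
      Integrable (fun ω => Real.exp (∑ a, ∑ b, c a b * upperAverage t v (fun i => A i ω) a b)) ℙ ∧
      ∫ ω, Real.exp (∑ a, ∑ b, c a b * upperAverage t v (fun i => A i ω) a b) ∂ℙ ≤
      Real.exp (∑ a, ∑ b, upperAverage t v (fun i => probMatrix α B (z i)) a b *
        (Real.exp (c a b) - 1)) := by
    intro c
    let Y : I → Ω → ℝ := fun p ω =>
      c p.1.2.1 p.1.2.2 * v p.1.1 * A (t - (p.1.1 : ℕ)) ω p.1.2.1 p.1.2.2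
    have hYind : ProbabilityTheory.iIndepFun Y ℙ :=
      hind.comp (fun p x => c p.1.2.1 p.1.2.2 * v p.1.1 * x)
        (fun p => measurable_const.mul measurable_id)
    have hAm : ∀ p : I, Measurable fun ω => A (t - (p.1.1 : ℕ)) ω p.1.2.1 p.1.2.2 :=
      fun p => h.measurable _ (hle _) _ _
    have hYm : ∀ p, Measurable (Y p) := fun p => measurable_const.mul (hAm p)
    have h01 : ∀ p : I, ∀ ω, A (t - (p.1.1 : ℕ)) ω p.1.2.1 p.1.2.2 = 0 ∨
        A (t - (p.1.1 : ℕ)) ω p.1.2.1 p.1.2.2 = 1 := fun p ω => h.zero_or_one _ (hle _) _ _ _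
    have hsum : ∀ ω, ∑ a, ∑ b, c a b * upperAverage t v (fun i => A i ω) a b =
        (∑ p, Y p) ω := by
      intro ω
      rw [Finset.sum_apply]
      refine Eq.trans ?_ (sum_upper_index (t := t) fun p =>
        c p.2.1 p.2.2 * v p.1 * A (t - (p.1 : ℕ)) ω p.2.1 p.2.2).symm
      refine Finset.sum_congr rfl fun a _ => Finset.sum_congr rfl fun b _ => ?_
      simp only [upperAverage, Matrix.of_apply]
      split_ifs
      · rw [Finset.mul_sum, Fin.sum_univ_eq_sum_range
          (fun k => c a b * v k * A (t - k) ω a b) (t + 1)]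
        exact Finset.sum_congr rfl fun k _ => by ring
      · simp
    have hsumP : ∑ a, ∑ b, upperAverage t v (fun i => probMatrix α B (z i)) a b *
        (Real.exp (c a b) - 1) = ∑ p : I, probMatrix α B (z (t - (p.1.1 : ℕ))) p.1.2.1 p.1.2.2 *
          (v p.1.1 * (Real.exp (c p.1.2.1 p.1.2.2) - 1)) := by
      refine Eq.trans ?_ (sum_upper_index (t := t) fun p =>
        probMatrix α B (z (t - (p.1 : ℕ))) p.2.1 p.2.2 *
          (v p.1 * (Real.exp (c p.2.1 p.2.2) - 1))).symm
      refine Finset.sum_congr rfl fun a _ => Finset.sum_congr rfl fun b _ => ?_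
      simp only [upperAverage, Matrix.of_apply]
      split_ifs
      · rw [Finset.sum_mul, Fin.sum_univ_eq_sum_range
          (fun k => probMatrix α B (z (t - k)) a b * (v k * (Real.exp (c a b) - 1))) (t + 1)]
        exact Finset.sum_congr rfl fun k _ => by ring
      · simp
    constructor
    · have := hYind.integrable_exp_mul_sum (t := 1) hYm (s := Finset.univ) fun p _ => by
        simpa only [one_mul] using integrable_exp_mul_of_zero_or_one (hAm p) (h01 p) _
      simpa only [hsum, one_mul] using this
    · have h2 := hYind.mgf_sum (t := 1) hYm Finset.univ
      simp only [ProbabilityTheory.mgf, one_mul] at h2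
      simp only [hsum, h2, hsumP]
      rw [Real.exp_sum]
      refine Finset.prod_le_prod (fun p _ => integral_nonneg fun _ => (Real.exp_pos _).le)
        fun p _ => ?_
      have h3 := integral_exp_mul_of_zero_or_one (ℙ := ℙ) (hAm p) (h01 p)
        (c p.1.2.1 p.1.2.2 * v p.1.1)
      rw [h.prob _ (hle _) _ _ p.2] at h3
      refine h3.le.trans ?_
      rw [add_comm]
      refine (Real.add_one_le_exp _).trans (Real.exp_le_exp.2 ?_)
      exact mul_le_mul_of_nonneg_left (exp_mul_sub_one_le (hv0 _) (hv1 _)) (hP _ _ _)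
  refine ⟨fun ω a b => ?_, fun a b => ?_, fun c => (key c).1, fun c => (key c).2⟩
  · simp only [upperAverage, Matrix.of_apply]
    split_ifs
    · exact Finset.sum_nonneg fun k _ => mul_nonneg (hv0 k) (hA0 _ (Nat.sub_le _ _) _ _ _)
    · exact le_rfl
  · simp only [upperAverage, Matrix.of_apply]
    split_ifs
    · exact Finset.sum_nonneg fun k _ => mul_nonneg (hv0 k) (hP _ _ _)
    · exact le_rfl

/-- A weighted average of symmetric matrices, off the diagonal, in terms of its upper part. -/
theorem smul_upperAverage_add_transpose_apply {n t : ℕ} {w : ℕ → ℝ} {β : ℝ} (hβ : 0 < β)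
    {M : ℕ → Matrix (Fin n) (Fin n) ℝ} (hs : ∀ i ≤ t, ∀ a b, M i b a = M i a b) (a b : Fin n) :
    β * (upperAverage t (fun k => w k / β) M a b + upperAverage t (fun k => w k / β) M b a) =
      if a = b then 0 else ∑ k ∈ Finset.range (t + 1), w k * M (t - k) a b := by
  have e : ∀ a b, β * ∑ k ∈ Finset.range (t + 1), w k / β * M (t - k) a b =
      ∑ k ∈ Finset.range (t + 1), w k * M (t - k) a b := by
    intro a b
    rw [Finset.mul_sum]
    refine Finset.sum_congr rfl fun k _ => ?_
    field_simp
  simp only [upperAverage, Matrix.of_apply]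
  rcases lt_trichotomy a b with h | h | h
  · rw [if_pos h, if_neg h.asymm, if_neg h.ne, add_zero, e]
  · subst h; simp
  · rw [if_pos h, if_neg h.asymm, if_neg h.ne', zero_add, e]
    exact Finset.sum_congr rfl fun k _ => by rw [hs _ (Nat.sub_le _ _)]

/-- Used with `d = 0` for the adjacency matrices and `d = α` for the probability matrices; the
mismatch `α` on the diagonal is a separate error term later. -/
theorem weighted_sum_eq_smul_upperAverage {n t : ℕ} {w : ℕ → ℝ} {β d : ℝ} (hβ : 0 < β)
    {M : ℕ → Matrix (Fin n) (Fin n) ℝ} (hs : ∀ i ≤ t, ∀ a b, M i b a = M i a b)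
    (hd : ∀ i ≤ t, ∀ a, M i a a = d) (hw : ∑ k ∈ Finset.range (t + 1), w k = 1) :
    ∑ k ∈ Finset.range (t + 1), w k • M (t - k) =
      β • (upperAverage t (fun k => w k / β) M + (upperAverage t (fun k => w k / β) M)ᵀ) +
        d • (1 : Matrix (Fin n) (Fin n) ℝ) := by
  ext a b
  simp only [Matrix.add_apply, Matrix.smul_apply, Matrix.sum_apply, Matrix.transpose_apply,
    smul_eq_mul, smul_upperAverage_add_transpose_apply hβ hs, Matrix.one_apply]
  split_ifs with h
  · subst h
    rw [Finset.sum_congr rfl fun k _ => by rw [hd _ (Nat.sub_le _ _)], ← Finset.sum_mul, hw]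
    ring
  · ring

theorem degree_smul_add_transpose {n : ℕ} (β : ℝ) (U : Matrix (Fin n) (Fin n) ℝ) (a : Fin n) :
    degree (β • (U + Uᵀ)) a = β * (∑ b, U a b + ∑ b, U b a) := by
  simp only [degree, Matrix.smul_apply, Matrix.add_apply, Matrix.transpose_apply, smul_eq_mul,
    ← Finset.mul_sum, Finset.sum_add_distrib]

theorem degree_add_smul_one {n : ℕ} (M : Matrix (Fin n) (Fin n) ℝ) (d : ℝ) (a : Fin n) :
    degree (M + d • (1 : Matrix (Fin n) (Fin n) ℝ)) a = degree M a + d := by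
  simp only [degree, Matrix.add_apply, Matrix.smul_apply, Matrix.one_apply, smul_eq_mul,
    Finset.sum_add_distrib]
  simp

theorem specNorm_smul_one_le {n : ℕ} {d : ℝ} (hd : 0 ≤ d) :
    specNorm (d • (1 : Matrix (Fin n) (Fin n) ℝ)) ≤ d := by
  rw [Matrix.smul_one_eq_diagonal]
  exact specNorm_diagonal_le _ hd fun a => by rw [abs_of_nonneg hd]

/-! ### Assembling noise and bias -/

/-- Constant of the deterministic error bound. -/
noncomputable def errorConst (c₂ c₃ K₁ K₂ : ℝ) : ℝ :=
  4 * (2 * K₁ * Real.sqrt c₂ + 1 + 2 * Real.sqrt c₃) +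
    6 * (1 + Real.sqrt (3 * (4 * c₃ + 2 * K₂ * c₂)))

/-- The error bound on the event where the upper parts concentrate. -/
theorem specNorm_laplacian_sub_le_of_concentration {n : ℕ} {X R P U m : Matrix (Fin n) (Fin n) ℝ}
    {α β ρ N g c₂ c₃ K₁ K₂ : ℝ} (hα : 0 < α) (hβ : 0 < β) (hρ : 0 < ρ) (hg : 0 < g)
    (hgN : g ≤ N) (hc₂ : 0 < c₂) (hc₃ : 0 ≤ c₃) (hK₁ : 0 ≤ K₁) (hK₂ : 0 ≤ K₂)
    (hβρ : β ≤ c₂ * ρ) (hαρ : α ≤ n * ρ)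
    (hX : X = β • (U + Uᵀ)) (hR : R = β • (m + mᵀ) + α • (1 : Matrix (Fin n) (Fin n) ℝ))
    (hP : ∀ a b, 0 ≤ P a b) (hPs : ∀ a b, P b a = P a b) (hPp : ∀ a b, P a b ≤ α)
    (hdP : ∀ a, α * g ≤ degree P a) (hdN : ∀ a, degree P a ≤ α * N)
    (hdX : ∀ a, α * g / 4 ≤ degree X a)
    (hRP : ∑ a, ∑ b, (R a b - P a b) ^ 2 ≤ 4 * c₃ * (n * α * ρ))
    (hdRP : ∑ a, (degree R a - degree P a) ^ 2 ≤ 4 * c₃ * (n * α * ρ) * N)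
    (hU : specNorm (U - m) ≤ K₁ * Real.sqrt (n * (α / β)))
    (hrow : ∑ a, (∑ b, (U a b - m a b)) ^ 2 ≤ K₂ * (n * (α * N / β)))
    (hcol : ∑ a, (∑ b, (U b a - m b a)) ^ 2 ≤ K₂ * (n * (α * N / β))) :
    specNorm (laplacian X - laplacian P) ≤
      errorConst c₂ c₃ K₁ K₂ * (N / g) * Real.sqrt (n * ρ / (g ^ 2 * α)) := by
  have hn0 : (0 : ℝ) ≤ n := Nat.cast_nonneg n
  have hN : 0 < N := hg.trans_le hgN
  set T := Real.sqrt (n * α * ρ) with hT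
  have hT2 : T ^ 2 = n * α * ρ := Real.sq_sqrt (by positivity)
  have hT0 : 0 ≤ T := Real.sqrt_nonneg _
  have hαT : α ≤ T := by
    refine Real.le_sqrt_of_sq_le ?_
    calc α ^ 2 = α * α := sq α
      _ ≤ α * (n * ρ) := by gcongr
      _ = _ := by ring
  have hQ : Real.sqrt (n * ρ / (g ^ 2 * α)) = T / (α * g) := by
    rw [show n * ρ / (g ^ 2 * α) = n * α * ρ / (α * g) ^ 2 by field_simp,
      Real.sqrt_div (by positivity), Real.sqrt_sq (by positivity)]
  have hβT : β * Real.sqrt (n * (α / β)) ≤ Real.sqrt c₂ * T := by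
    rw [hT, ← Real.sqrt_mul hc₂.le]
    refine Real.le_sqrt_of_sq_le ?_
    rw [mul_pow, Real.sq_sqrt (by positivity)]
    calc β ^ 2 * (n * (α / β)) = n * α * β := by field_simp
      _ ≤ n * α * (c₂ * ρ) := by gcongr
      _ = _ := by ring
  have hXP : specNorm (X - P) ≤ (2 * K₁ * Real.sqrt c₂ + 1 + 2 * Real.sqrt c₃) * T := by
    -- Noise above and below the diagonal, the diagonal of the means (absent in `X`), and the
    -- smoothing bias.
    have e : X - P = (β • (U - m) + β • (U - m)ᵀ - α • (1 : Matrix (Fin n) (Fin n) ℝ)) +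
        (R - P) := by
      rw [hX, hR, Matrix.transpose_sub]
      module
    have b1 : specNorm (R - P) ≤ 2 * Real.sqrt c₃ * T := by
      refine (specNorm_le_sqrt_sum_sq _).trans ?_
      simp only [Matrix.sub_apply]
      refine (Real.sqrt_le_sqrt hRP).trans (le_of_eq ?_)
      rw [Real.sqrt_mul (by positivity), Real.sqrt_mul (by norm_num),
        show (4 : ℝ) = 2 ^ 2 by norm_num, Real.sqrt_sq (by norm_num)]
    have b2 : specNorm (β • (U - m)) ≤ K₁ * (Real.sqrt c₂ * T) := by
      rw [specNorm_smul, abs_of_pos hβ]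
      calc β * specNorm (U - m) ≤ β * (K₁ * Real.sqrt (n * (α / β))) := by gcongr
        _ = K₁ * (β * Real.sqrt (n * (α / β))) := by ring
        _ ≤ _ := by gcongr
    have b3 : specNorm (β • (U - m)ᵀ) ≤ K₁ * (Real.sqrt c₂ * T) := by
      rw [← Matrix.transpose_smul, specNorm_transpose]; exact b2
    have b4 := specNorm_smul_one_le (n := n) hα.le
    rw [e]
    have s1 := specNorm_add_le (β • (U - m) + β • (U - m)ᵀ - α • (1 : Matrix (Fin n) (Fin n) ℝ))
      (R - P)
    have s2 := specNorm_sub_le (β • (U - m) + β • (U - m)ᵀ) (α • (1 : Matrix (Fin n) (Fin n) ℝ))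
    have s3 := specNorm_add_le (β • (U - m)) (β • (U - m)ᵀ)
    linarith
  -- The shift by `α` removes the diagonal's share of the degrees. As a uniform shift it costs only
  -- `α ≤ T`.
  set K₄ := 3 * (4 * c₃ + 2 * K₂ * c₂) with hK₄
  have hZ : ∑ a, (degree P a - degree X a - α) ^ 2 ≤ K₄ * (N * T ^ 2) := by
    have e : ∀ a, (degree P a - degree X a - α) ^ 2 ≤
        3 * ((degree R a - degree P a) ^ 2 + β ^ 2 * (∑ b, (U a b - m a b)) ^ 2 +
          β ^ 2 * (∑ b, (U b a - m b a)) ^ 2) := by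
      intro a
      have e1 : degree P a - degree X a - α = -(degree R a - degree P a) -
          β * (∑ b, (U a b - m a b)) - β * (∑ b, (U b a - m b a)) := by
        rw [hX, hR, degree_add_smul_one, degree_smul_add_transpose, degree_smul_add_transpose]
        simp only [Finset.sum_sub_distrib]
        ring
      rw [e1]
      set x := degree R a - degree P a
      set y := β * (∑ b, (U a b - m a b)) with hy
      set v := β * (∑ b, (U b a - m b a)) with hv
      rw [← mul_pow, ← mul_pow, ← hy, ← hv]
      nlinarith [sq_nonneg (x - y), sq_nonneg (x - v), sq_nonneg (y - v)]
    refine (Finset.sum_le_sum fun a _ => e a).trans ?_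
    rw [← Finset.mul_sum, Finset.sum_add_distrib, Finset.sum_add_distrib, ← Finset.mul_sum,
      ← Finset.mul_sum, hK₄, mul_assoc]
    refine mul_le_mul_of_nonneg_left ?_ (by norm_num)
    have b : β ^ 2 * (K₂ * (n * (α * N / β))) ≤ K₂ * c₂ * (N * T ^ 2) := by
      calc β ^ 2 * (K₂ * (n * (α * N / β))) = K₂ * (N * (n * α * β)) := by field_simp
        _ ≤ K₂ * (N * (n * α * (c₂ * ρ))) := by gcongr
        _ = _ := by rw [hT2]; ring
    have b1 := mul_le_mul_of_nonneg_left hrow (sq_nonneg β)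
    have b2 := mul_le_mul_of_nonneg_left hcol (sq_nonneg β)
    rw [← hT2] at hdRP
    linarith
  have hmain := specNorm_laplacian_sub_le (A := X) hP hPs hPp (by positivity : 0 < α * g) hdP hdN
    hdX hα.le
  set μ := N / g with hμ
  have hμ1 : 1 ≤ μ := (one_le_div hg).2 hgN
  have hGg : α * N / (α * g) = μ := by rw [hμ]; field_simp
  rw [hGg] at hmain
  set Q := T / (α * g) with hQd
  have hQ0 : 0 ≤ Q := by positivity
  rw [hQ]
  have t1 : 4 / (α * g) * specNorm (X - P) ≤
      4 * (2 * K₁ * Real.sqrt c₂ + 1 + 2 * Real.sqrt c₃) * Q := by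
    calc _ ≤ 4 / (α * g) * ((2 * K₁ * Real.sqrt c₂ + 1 + 2 * Real.sqrt c₃) * T) := by gcongr
      _ = _ := by rw [hQd]; ring
  have t2 : 2 / (α * g) * α ≤ 2 * Q := by
    calc 2 / (α * g) * α ≤ 2 / (α * g) * T := by gcongr
      _ = _ := by rw [hQd]; ring
  have hK₄0 : 0 ≤ K₄ := by positivity
  have t3 : 2 / (α * g) * Real.sqrt (α / (α * g) * ∑ a, (degree P a - degree X a - α) ^ 2) ≤
      2 * (Real.sqrt μ * Real.sqrt K₄) * Q := by
    have : Real.sqrt (α / (α * g) * ∑ a, (degree P a - degree X a - α) ^ 2) ≤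
        Real.sqrt μ * Real.sqrt K₄ * T := by
      refine Real.sqrt_le_iff.2 ⟨by positivity, ?_⟩
      rw [mul_pow, mul_pow, Real.sq_sqrt (by positivity), Real.sq_sqrt hK₄0]
      calc _ ≤ α / (α * g) * (K₄ * (N * T ^ 2)) := by gcongr
        _ = _ := by rw [hμ]; field_simp
    calc _ ≤ 2 / (α * g) * (Real.sqrt μ * Real.sqrt K₄ * T) := by gcongr
      _ = _ := by rw [hQd]; ring
  have hsμ : 1 ≤ Real.sqrt μ := Real.one_le_sqrt.2 hμ1
  have hsμ2 : Real.sqrt μ * Real.sqrt μ = μ := Real.mul_self_sqrt (by positivity)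
  -- One `√μ` comes from the ratio of degrees, the other from the `ℓ²` degree deviation; since `μ ≥
  -- 1`, the lower powers are absorbed.
  have t4 : (2 * Real.sqrt μ + 1) * (2 / (α * g) * α + 2 / (α * g) *
      Real.sqrt (α / (α * g) * ∑ a, (degree P a - degree X a - α) ^ 2)) ≤
      6 * (1 + Real.sqrt K₄) * μ * Q := by
    calc _ ≤ (2 * Real.sqrt μ + Real.sqrt μ) *
          (2 * (Real.sqrt μ * Q) + 2 * (Real.sqrt μ * Real.sqrt K₄) * Q) := by
          have t2' : 2 / (α * g) * α ≤ 2 * (Real.sqrt μ * Q) :=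
            t2.trans (mul_le_mul_of_nonneg_left (le_mul_of_one_le_left hQ0 hsμ) (by norm_num))
          exact mul_le_mul (by linarith) (add_le_add t2' t3) (by positivity) (by positivity)
      _ = 6 * (1 + Real.sqrt K₄) * (Real.sqrt μ * Real.sqrt μ) * Q := by ring
      _ = _ := by rw [hsμ2]
  have t5 : 4 * (2 * K₁ * Real.sqrt c₂ + 1 + 2 * Real.sqrt c₃) * Q ≤
      4 * (2 * K₁ * Real.sqrt c₂ + 1 + 2 * Real.sqrt c₃) * μ * Q := by
    refine mul_le_mul_of_nonneg_right ?_ hQ0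
    exact le_mul_of_one_le_right (by positivity) hμ1
  calc _ ≤ _ := hmain
    _ ≤ _ := add_le_add (t1.trans t5) t4
    _ = _ := by rw [errorConst]; ring

/-- Concentration of a Poisson dominated matrix and of its degrees. -/
theorem PoissonDominated.concentration {n : ℕ} {Ω : Type*} [MeasurableSpace Ω] {ℙ : Measure Ω}
    [IsProbabilityMeasure ℙ] {U : Ω → Matrix (Fin n) (Fin n) ℝ} {m : Matrix (Fin n) (Fin n) ℝ}
    (h : PoissonDominated ℙ U m) (hn : 2 ≤ n) {ν q D M : ℝ} (hν : 0 ≤ ν) (hq : 0 < q)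
    (hm : ∀ x y, m x y ≤ q) (hlog : Real.log n ≤ n * q) (hD0 : 0 < D) (hD : Real.log n ≤ D)
    (hrow : ∀ x, ∑ y, m x y ≤ D) (hcol : ∀ x, ∑ y, m y x ≤ D) (hdiag : ∀ x, m x x = 0)
    (hM : 8 * (ν + 5) * Real.log n ≤ M) (hmM : ∀ x, M ≤ ∑ y, m x y + ∑ y, m y x) :
    1 - (n : ℝ) ^ (-ν) ≤ ℙ.real {ω |
      specNorm (U ω - m) ≤
        2 * ((ν + 41) + 192 * (5 * (ν + 7) + 32) + 1) * Real.sqrt (n * q) ∧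
      ∑ x, (∑ y, (U ω x y - m x y)) ^ 2 ≤ 16 * (ν + 16) ^ 2 * (n * D) ∧
      ∑ x, (∑ y, (U ω y x - m y x)) ^ 2 ≤ 16 * (ν + 16) ^ 2 * (n * D) ∧
      ∀ x, M / 2 < ∑ y, U ω x y + ∑ y, U ω y x} := by
  have hn0 : 0 < n := by omega
  have ha : 0 ≤ ν + 4 := by linarith
  have p1 := h.specNorm_tail hn0 ha hq hm hlog
  have p2 := h.row_sq_tail hn0 ha hD0 hD hrow
  have p3 := h.transpose.row_sq_tail hn0 ha hD0 hD hcol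
  have p4 := h.row_add_col_lower_tail hn0 ha hdiag (by linarith) hmM
  simp only [Matrix.transpose_apply] at p3
  set B1 := {ω | ¬ specNorm (U ω - m) ≤
      2 * (((ν + 4 + 37) + 192 * (5 * (ν + 4 + 3) + 32) + 1) * Real.sqrt (n * q))}
  set B2 := {ω | ¬ ∑ x, (∑ y, (U ω x y - m x y)) ^ 2 ≤ 16 * (ν + 4 + 12) ^ 2 * (n * D)}
  set B3 := {ω | ¬ ∑ x, (∑ y, (U ω y x - m y x)) ^ 2 ≤ 16 * (ν + 4 + 12) ^ 2 * (n * D)}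
  set B4 := {ω | ∃ x ∈ Finset.univ, ∑ y, U ω x y + ∑ y, U ω y x ≤ M / 2}
  set E := {ω | specNorm (U ω - m) ≤
        2 * ((ν + 41) + 192 * (5 * (ν + 7) + 32) + 1) * Real.sqrt (n * q) ∧
      ∑ x, (∑ y, (U ω x y - m x y)) ^ 2 ≤ 16 * (ν + 16) ^ 2 * (n * D) ∧
      ∑ x, (∑ y, (U ω y x - m y x)) ^ 2 ≤ 16 * (ν + 16) ^ 2 * (n * D) ∧
      ∀ x, M / 2 < ∑ y, U ω x y + ∑ y, U ω y x}
  have hcover : (Set.univ : Set Ω) ⊆ E ∪ (B1 ∪ (B2 ∪ (B3 ∪ B4))) := by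
    intro ω _
    by_contra hc
    simp only [Set.mem_union, not_or] at hc
    obtain ⟨e, b1, b2, b3, b4⟩ := hc
    refine e ⟨?_, ?_, ?_, fun x => ?_⟩
    · have := not_not.1 b1
      refine this.trans (le_of_eq ?_)
      ring
    · have := not_not.1 b2
      refine this.trans (le_of_eq ?_)
      ring
    · have := not_not.1 b3
      refine this.trans (le_of_eq ?_)
      ring
    · by_contra hcon
      exact b4 ⟨x, Finset.mem_univ x, not_lt.1 hcon⟩
  have u0 := measureReal_mono (μ := ℙ) hcover
  have u1 := measureReal_union_le (μ := ℙ) E (B1 ∪ (B2 ∪ (B3 ∪ B4)))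
  have u2 := measureReal_union_le (μ := ℙ) B1 (B2 ∪ (B3 ∪ B4))
  have u3 := measureReal_union_le (μ := ℙ) B2 (B3 ∪ B4)
  have u4 := measureReal_union_le (μ := ℙ) B3 B4
  rw [probReal_univ] at u0
  have hn2 : (2 : ℝ) ≤ n := by exact_mod_cast hn
  -- The failure probabilities add up to `5 + 2 + 2 + 1 = 10` times `n ^ (-(ν + 4))`, and `n ^ 4 ≥
  -- 16` because `n ≥ 2`.
  have hpow : 10 * (n : ℝ) ^ (-(ν + 4)) ≤ (n : ℝ) ^ (-ν) := by
    rw [neg_add, Real.rpow_add (by positivity), Real.rpow_neg (by positivity) 4]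
    have h16 : (16 : ℝ) ≤ (n : ℝ) ^ (4 : ℝ) := by
      rw [show (4 : ℝ) = ((4 : ℕ) : ℝ) by norm_num, Real.rpow_natCast]
      calc (16 : ℝ) = 2 ^ 4 := by norm_num
        _ ≤ _ := by gcongr
    have hi : ((n : ℝ) ^ (4 : ℝ))⁻¹ ≤ 16⁻¹ := inv_anti₀ (by norm_num) h16
    have h0 : 0 ≤ (n : ℝ) ^ (-ν) := by positivity
    nlinarith
  linarith

end DSBM

/-! ### The main theorem -/

set_option maxHeartbeats 1600000 in
theorem theorem2 (ν : ℝ) (hν : 0 < ν) (c₁ c₂ : ℝ) (hc₁ : 0 < c₁) (hc₂ : 0 < c₂) :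
    ∃ C C' : ℝ, 0 < C ∧ 0 < C' ∧
      ∀ (n K t nmin nmax s : ℕ) (τ α nMax nMin ε x ρ μB : ℝ) (z : ℕ → Fin n → Fin K)
        (Ω : Type*) [MeasurableSpace Ω] (ℙ : MeasureTheory.Measure Ω)
        [MeasureTheory.IsProbabilityMeasure ℙ]
        (A : ℕ → Ω → Matrix (Fin n) (Fin n) ℝ)
        (S : (ℕ → Matrix (Fin n) (Fin n) ℝ) → Matrix (Fin n) (Fin n) ℝ),
        0 < n → s ≤ n → 0 ≤ τ → τ ≤ 1 → 0 < α → α < 1 →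
        nMax = DSBM.nbarMax (DSBM.baseMatrix K τ) n nmin nmax →
        nMin = DSBM.nbarMin (DSBM.baseMatrix K τ) n nmin nmax →
        0 < nMin →
        ε = (s : ℝ) / n →
        x = Real.sqrt (nMax * α * ε) →
        ρ = min 1 x →
        μB = nMax / nMin →
        DSBM.IsRegularMembership t nmin nmax s z →
        DSBM.IsSBMSequence ℙ t α (DSBM.baseMatrix K τ) z A →
        DSBM.IsSmoother c₁ c₂ x t S →
        DSBM.tMin n α ρ ≤ t →
        C' * μB * (Real.log n / nMin) ≤ α / ρ →
        1 - (n : ℝ) ^ (-ν) ≤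
          ℙ.real {ω | (2 ≤ nMin → ∀ a, 0 < DSBM.degree (S fun i => A i ω) a) ∧
            DSBM.specNorm (DSBM.laplacian (S fun i => A i ω) -
                DSBM.laplacian (DSBM.probMatrix α (DSBM.baseMatrix K τ) (z t))) ≤
              C * μB * Real.sqrt (n * ρ / (nMin ^ 2 * α))} := by
  set K₁ : ℝ := 2 * ((ν + 41) + 192 * (5 * (ν + 7) + 32) + 1) with hK₁
  set K₂ : ℝ := 16 * (ν + 16) ^ 2 with hK₂
  set c₃ : ℝ := (min 1 c₁ ^ 2)⁻¹ with hc₃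
  have hc₃0 : 0 ≤ c₃ := by positivity
  have hK₁0 : 0 ≤ K₁ := by positivity
  have hK₂0 : 0 ≤ K₂ := by positivity
  have hC6 : 6 ≤ DSBM.errorConst c₂ c₃ K₁ K₂ := by
    have h1 : 0 ≤ 4 * (2 * K₁ * Real.sqrt c₂ + 1 + 2 * Real.sqrt c₃) := by positivity
    have h2 := Real.sqrt_nonneg (3 * (4 * c₃ + 2 * K₂ * c₂))
    rw [DSBM.errorConst]; linarith
  refine ⟨DSBM.errorConst c₂ c₃ K₁ K₂, 16 * (ν + 5) * c₂, by linarith, by positivity, ?_⟩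
  intro n K t nmin nmax s τ α N g ε x ρ μ z Ω _ ℙ _ A S hn _ hτ0 hτ1 hα hα1 hN hg hg0 hε hx hρ hμ
    hz hA hS _ hcond
  have hx0 : 0 ≤ x := by rw [hx]; exact Real.sqrt_nonneg _
  obtain ⟨w, β, hβ, hβρ, hw0, hwβ, hw1, hSw, hκ⟩ := hS.exists_weights hc₁ hx0
  rw [← hρ] at hβρ hκ
  set P : ℕ → Matrix (Fin n) (Fin n) ℝ := fun i => DSBM.probMatrix α (DSBM.baseMatrix K τ) (z i)
    with hP
  have hn' : (0 : ℝ) < n := by exact_mod_cast hn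
  have hn1 : (1 : ℝ) ≤ n := by exact_mod_cast hn
  have hlog0 : 0 ≤ Real.log n := Real.log_nonneg hn1
  have hρ0 : 0 < ρ := pos_of_mul_pos_right (hβ.trans_le hβρ) hc₂.le
  have hdP : ∀ i ≤ t, ∀ a, α * g ≤ DSBM.degree (P i) a ∧ DSBM.degree (P i) a ≤ α * N := by
    intro i hi a
    rw [hN, hg]
    exact DSBM.degree_probMatrix_mem hτ0 hτ1 hα.le (hz.sizes i hi) a
  have hgN : g ≤ N := by
    have := hdP t le_rfl ⟨0, hn⟩
    exact le_of_mul_le_mul_left (this.1.trans this.2) hα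
  have hN1 : 1 ≤ N := by
    have h1 := DSBM.le_degree_probMatrix hτ0 hα.le (z t) ⟨0, hn⟩
    have h2 := (hdP t le_rfl ⟨0, hn⟩).2
    refine le_of_mul_le_mul_left ?_ hα
    rw [mul_one]
    exact h1.trans h2
  have hgn : g ≤ n := by
    have h1 := DSBM.degree_probMatrix_le hτ1 hα.le (z t) ⟨0, hn⟩
    have h2 := (hdP t le_rfl ⟨0, hn⟩).1
    refine le_of_mul_le_mul_left ?_ hα
    rw [mul_comm α (n : ℝ)]
    exact h2.trans h1
  have hμ1 : 1 ≤ μ := by rw [hμ]; exact (one_le_div hg0).2 hgN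
  have hx2 : x ^ 2 * n = s * (α * N) := by
    rw [hx, Real.sq_sqrt (by rw [hε]; positivity), hε]
    field_simp
  -- The positive weight bound `β ≤ c₂ ρ` forces `ρ > 0`, hence `s ≥ 1`; then `x² n = s α N ≥ α`,
  -- because `N ≥ 1`.
  have hαρ : α ≤ n * ρ := by
    have hxpos : 0 < x := hρ0.trans_le (by rw [hρ]; exact min_le_right _ _)
    have hs : (1 : ℝ) ≤ s := by
      have : s ≠ 0 := by
        rintro rfl
        rw [hx, hε] at hxpos
        simp at hxpos
      exact_mod_cast Nat.one_le_iff_ne_zero.2 this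
    have h1 : α ≤ n * x := by
      refine abs_le_of_sq_le_sq' ?_ (by positivity) |>.2
      have e1 : α * 1 ≤ α * N := by gcongr
      have e2 : 1 * (α * 1) ≤ s * (α * N) := by gcongr
      calc α ^ 2 ≤ α := by nlinarith
        _ ≤ x ^ 2 * n := by rw [hx2]; linarith
        _ ≤ x ^ 2 * n * n := le_mul_of_one_le_right (by positivity) hn1
        _ = _ := by ring
    rw [hρ, mul_min_of_nonneg _ _ hn'.le]
    exact le_min (by linarith) h1
  have hAnn : ∀ i ≤ t, ∀ ω a b, 0 ≤ A i ω a b := fun i hi ω a b => by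
    rcases hA.zero_or_one i hi ω a b with h | h <;> simp [h]
  have hPnn : ∀ i a b, 0 ≤ P i a b := fun i a b => DSBM.probMatrix_nonneg hτ0 hα.le _ a b
  have hPsymm : ∀ i a b, P i b a = P i a b := fun i a b => DSBM.probMatrix_symm _ a b
  have hPle : ∀ i a b, P i a b ≤ α := fun i a b => DSBM.probMatrix_le hτ1 hα.le _ a b
  have hpow0 : 0 ≤ (n : ℝ) ^ (-ν) := by positivity
  rcases lt_or_ge g 2 with hg2 | hg2
  -- For `g < 2` the claim is deterministic: both Laplacians have norm at most one, while the
  -- right-hand side is at least `6 * 1 * (1/2) = 3`.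
  · have hall : ∀ ω, (2 ≤ g → ∀ a, 0 < DSBM.degree (S fun i => A i ω) a) ∧
        DSBM.specNorm (DSBM.laplacian (S fun i => A i ω) - DSBM.laplacian (P t)) ≤
          DSBM.errorConst c₂ c₃ K₁ K₂ * μ * Real.sqrt (n * ρ / (g ^ 2 * α)) := by
      intro ω
      refine ⟨fun h => absurd h (not_le.2 hg2), ?_⟩
      have h1 : DSBM.specNorm (DSBM.laplacian (S fun i => A i ω)) ≤ 1 := by
        rw [hSw]
        refine DSBM.specNorm_laplacian_le_one _ (fun a b => ?_) (fun a b => ?_)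
        · simp only [Matrix.sum_apply, Matrix.smul_apply, smul_eq_mul]
          exact Finset.sum_nonneg fun k _ => mul_nonneg (hw0 k) (hAnn _ (Nat.sub_le _ _) _ _ _)
        · simp only [Matrix.sum_apply, Matrix.smul_apply, smul_eq_mul]
          exact Finset.sum_congr rfl fun k _ => by rw [hA.symm _ (Nat.sub_le _ _)]
      have h2 : DSBM.specNorm (DSBM.laplacian (P t)) ≤ 1 :=
        DSBM.specNorm_laplacian_le_one _ (hPnn t) (hPsymm t)
      have h3 : 1 / 2 ≤ Real.sqrt (n * ρ / (g ^ 2 * α)) := by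
        refine Real.le_sqrt_of_sq_le ?_
        rw [le_div_iff₀ (by positivity)]
        have : g ^ 2 ≤ 4 := by nlinarith
        calc (1 / 2 : ℝ) ^ 2 * (g ^ 2 * α) ≤ (1 / 2 : ℝ) ^ 2 * (4 * α) := by gcongr
          _ = α := by ring
          _ ≤ _ := hαρ
      calc _ ≤ _ := DSBM.specNorm_sub_le _ _
        _ ≤ 6 * 1 * (1 / 2) := by linarith
        _ ≤ _ := by gcongr
    have : {ω | (2 ≤ g → ∀ a, 0 < DSBM.degree (S fun i => A i ω) a) ∧
        DSBM.specNorm (DSBM.laplacian (S fun i => A i ω) - DSBM.laplacian (P t)) ≤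
          DSBM.errorConst c₂ c₃ K₁ K₂ * μ * Real.sqrt (n * ρ / (g ^ 2 * α))} = Set.univ :=
      Set.eq_univ_of_forall hall
    rw [this, MeasureTheory.probReal_univ]
    linarith
  have hn2 : 2 ≤ n := by
    have : (2 : ℝ) ≤ n := hg2.trans hgn
    exact_mod_cast this
  -- The choice `C' = 16 (ν + 5) c₂` gives this after `β ≤ c₂ ρ`. It is twice what the lower tail
  -- requires, since `M` below is half of `g α / β`.
  have hkey : 16 * (ν + 5) * Real.log n ≤ g * (α / β) := by
    have h1 : α / (c₂ * ρ) ≤ α / β := by gcongr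
    have h2 : 16 * (ν + 5) * c₂ * (Real.log n / g) ≤ α / ρ := by
      refine le_trans ?_ hcond
      refine mul_le_mul_of_nonneg_right ?_ (by positivity)
      exact le_mul_of_one_le_right (by positivity) hμ1
    have h3 : 16 * (ν + 5) * (Real.log n / g) ≤ α / (c₂ * ρ) := by
      rw [le_div_iff₀ (by positivity)]
      rw [le_div_iff₀ hρ0] at h2
      linarith
    calc 16 * (ν + 5) * Real.log n = g * (16 * (ν + 5) * (Real.log n / g)) := by field_simp
      _ ≤ _ := by gcongr; exact h3.trans h1
  have hlogle : Real.log n ≤ g * (α / β) := by nlinarith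
  set v : ℕ → ℝ := fun k => w k / β with hv
  set m := DSBM.upperAverage t v P with hm
  set U : Ω → Matrix (Fin n) (Fin n) ℝ := fun ω => DSBM.upperAverage t v fun i => A i ω with hU
  have hdom : DSBM.PoissonDominated ℙ U m :=
    hA.poissonDominated hPnn (fun k => div_nonneg (hw0 k) hβ.le)
      fun k => (div_le_one hβ).2 (hwβ k)
  set R := ∑ k ∈ Finset.range (t + 1), w k • P (t - k) with hR
  have hRm : R = β • (m + m.transpose) + α • (1 : Matrix (Fin n) (Fin n) ℝ) :=
    DSBM.weighted_sum_eq_smul_upperAverage hβ (fun i _ => hPsymm i)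
      (fun i _ a => DSBM.probMatrix_diag _ a) hw1
  have hXU : ∀ ω, S (fun i => A i ω) = β • (U ω + (U ω).transpose) := by
    intro ω
    rw [hSw]
    have := DSBM.weighted_sum_eq_smul_upperAverage (w := w) (d := 0) hβ
      (M := fun i => A i ω) (fun i hi => hA.symm i hi ω) (fun i hi => hA.diag i hi ω) hw1
    simpa using this
  have hRapply : ∀ a b, R a b = ∑ k ∈ Finset.range (t + 1), w k * P (t - k) a b := by
    intro a b
    simp only [hR, Matrix.sum_apply, Matrix.smul_apply, smul_eq_mul]
  have hdR : ∀ a, α * g ≤ DSBM.degree R a ∧ DSBM.degree R a ≤ α * N := by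
    intro a
    have e : DSBM.degree R a = ∑ k ∈ Finset.range (t + 1), w k * DSBM.degree (P (t - k)) a := by
      simp only [DSBM.degree, hRapply, Finset.mul_sum]
      rw [Finset.sum_comm]
    rw [e]
    constructor
    · rw [← one_mul (α * g), ← hw1, Finset.sum_mul]
      exact Finset.sum_le_sum fun k _ =>
        mul_le_mul_of_nonneg_left (hdP _ (Nat.sub_le _ _) a).1 (hw0 k)
    · rw [← one_mul (α * N), ← hw1, Finset.sum_mul]
      exact Finset.sum_le_sum fun k _ =>
        mul_le_mul_of_nonneg_left (hdP _ (Nat.sub_le _ _) a).2 (hw0 k)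
  have hdm : ∀ a, DSBM.degree R a = β * (∑ b, m a b + ∑ b, m b a) + α := by
    intro a
    rw [hRm, DSBM.degree_add_smul_one, DSBM.degree_smul_add_transpose]
  have hmq : ∀ a b, m a b ≤ α / β := by
    intro a b
    simp only [hm, DSBM.upperAverage, Matrix.of_apply]
    split_ifs
    · calc _ ≤ ∑ k ∈ Finset.range (t + 1), v k * α :=
            Finset.sum_le_sum fun k _ =>
              mul_le_mul_of_nonneg_left (hPle _ _ _) (div_nonneg (hw0 k) hβ.le)
        _ = _ := by
            rw [← Finset.sum_mul]
            simp only [hv]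
            rw [← Finset.sum_div, hw1]; ring
    · positivity
  have hmdiag : ∀ a, m a a = 0 := fun a => by simp [hm, DSBM.upperAverage]
  have hmsum : ∀ a, ∑ b, m a b + ∑ b, m b a ≤ α * N / β := by
    intro a
    rw [le_div_iff₀ hβ]
    linarith [hdm a, (hdR a).2]
  have hmrow : ∀ a, 0 ≤ ∑ b, m a b := fun a => Finset.sum_nonneg fun b _ => hdom.mean_nonneg a b
  have hmcol : ∀ a, 0 ≤ ∑ b, m b a := fun a => Finset.sum_nonneg fun b _ => hdom.mean_nonneg b a
  have hαβ : 0 < α / β := by positivity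
  have hD : g * (α / β) ≤ α * N / β := by
    calc _ ≤ N * (α / β) := by gcongr
      _ = _ := by ring
  -- The zero diagonal of `m` removes `α` from each degree of `R`; as `g ≥ 2`, at least half of `α
  -- g` remains, which permits `M = g (α / β) / 2`.
  have hconc := hdom.concentration hn2 (ν := ν) (q := α / β) (D := α * N / β)
    (M := g * (α / β) / 2) hν.le hαβ hmq
    (hlogle.trans (by gcongr)) (by positivity) (hlogle.trans hD)
    (fun a => by linarith [hmsum a, hmcol a]) (fun a => by linarith [hmsum a, hmrow a]) hmdiag
    (by linarith) (fun a => by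
      have h1 := hdm a
      have h2 := (hdR a).1
      have h3 : g * (α / β) / 2 = α * g / 2 / β := by ring
      rw [h3, div_le_iff₀ hβ]
      nlinarith)
  refine hconc.trans (MeasureTheory.measureReal_mono ?_)
  rintro ω ⟨e1, e2, e3, e4⟩
  have hdX : ∀ a, α * g / 4 < DSBM.degree (S fun i => A i ω) a := by
    intro a
    rw [hXU, DSBM.degree_smul_add_transpose]
    calc α * g / 4 = β * (g * (α / β) / 2 / 2) := by field_simp; ring
      _ < _ := by gcongr; exact e4 a
  have hbias := hz.smoothing_bias hτ0 hτ1 hα hn hw0 hw1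
  simp only [← hN] at hbias
  set κ := ∑ k ∈ Finset.range (t + 1), w k * k with hκd
  -- The definition of `x` enters here: `s α N = x² n` converts the mean-age bound into the bias
  -- rate.
  have hsκ : s * (α * N) * κ ≤ c₃ * (n * ρ) := by
    rw [← hx2]
    nlinarith
  refine ⟨fun _ a => lt_trans (by positivity) (hdX a), ?_⟩
  rw [hμ]
  refine DSBM.specNorm_laplacian_sub_le_of_concentration hα hβ hρ0 hg0 hgN hc₂ hc₃0 hK₁0 hK₂0 hβρ
    hαρ (hXU ω) hRm (hPnn t) (hPsymm t) (hPle t) (fun a => (hdP t le_rfl a).1)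
    (fun a => (hdP t le_rfl a).2) (fun a => (hdX a).le) ?_ ?_ e1 e2 e3
  · refine hbias.1.trans ?_
    calc 4 * s * (α * N) * α * κ = 4 * α * (s * (α * N) * κ) := by ring
      _ ≤ 4 * α * (c₃ * (n * ρ)) := by gcongr
      _ = _ := by ring
  · refine hbias.2.trans ?_
    calc 4 * s * (α * N) * (α * N) * κ = 4 * (α * N) * (s * (α * N) * κ) := by ring
      _ ≤ 4 * (α * N) * (c₃ * (n * ρ)) := by gcongr
      _ = _ := by ring
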